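/- **Theorem (Error Estimate: Mean Field Ensemble Kalman Filter).** Let $d_u,d_y,J$ be natural numbers, $\Sigma\in\mathbb R^{d_u\times d_u}$ and $\Gamma\in\mathbb R^{d_y\times d_y}$ symmetric positive definite, and $\kappa_y,\kappa_\Psi,\kappa_h,\ell_h>0$. *Notation.* $|\cdot|$ is the Euclidean norm and $|x|_S^2=x^\top S^{-1}x$ for $S$ positive definite. For (measurable) $\Psi:\mathbb R^{d_u}\to\mathbb R^{d_u}$, $h:\mathbb R^{d_u}\to\mathbb R^{d_y}$, a probability measure $\mu$ on $\mathbb R^{d_u}$, and $z\in\mathbb R^{d_y}$, let $\mathsf P\mu$ and $\mathsf Q\mathsf P\mu$ be the probability measures with Lebesgue densities $$\mathsf P\mu(u)=\frac1{\sqrt{(2\pi)^{d_u}\det\Sigma}}\int e^{-\frac12|u-\Psi(v)|_\Sigma^2}\,\mu(dv),\qquad \mathsf Q\mathsf P\mu(u,y)=\frac{1}{\sqrt{(2\pi)^{d_y}\det\Gamma}}\,e^{-\frac12|y-h(u)|_\Gamma^2}\,\mathsf P\mu(u).$$ For a joint density $\pi(u,y)$, let $\mathsf B_z\pi$ be the probability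 measure with density $u\mapsto\pi(u,z)/\int\pi(U,z)\,dU$, and let $\mathsf T_z\pi$ be the pushforward of $\pi$ under $$(u,y)\mapsto u+\mathcal C^{uy}(\pi)\,\mathcal C^{yy}(\pi)^{-1}(z-y),$$ where $\mathcal C^{uy}(\pi),\mathcal C^{yy}(\pi)$ are the corresponding blocks of the covariance matrix of $\pi$. Given data $y_1^\dagger,\dots,y_J^\dagger\in\mathbb R^{d_y}$ and an initial measure $\mu_0$, the true filter and the mean field ensemble Kalman filter are defined, for $0\le j\le J-1$, by $$\mu_{j+1}=\mathsf B_{y_{j+1}^\dagger}\mathsf Q\mathsf P\mu_j,\qquad \mu^{\rm EK}_{j+1}=\mathsf T_{y_{j+1}^\dagger}\mathsf Q\mathsf P\mu^{\rm EK}_j,\qquad \mu^{\rm EK}_0=\mu_0 .$$ Finally $\mathcal M_q(\mu)=\int|x|^q\,\mu(dx)$ and $d_g(\mu,\nu)=\sup_{|f|\le g}|\mu[f]-\nu[f]|$ with $g(v)=1+|v|^2$, the supremum being over measurable $f$. *Statement.* Put $q=2\max\{3+d_u,4+d_y\}$. There is a constant $C=C(\mathcal M_q(\mu_0),\kappa_y,\kappa_\Psi,\kappa_h,\ell_h,\Sigma,\Gamma,J)$,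 depending only on the listed quantities (and on $d_u,d_y$), such that the following holds. Let $\mu_0$ be a Gaussian measure on $\mathbb R^{d_u}$, possibly degenerate; let the data satisfy $\max_{1\le j\le J}|y_j^\dagger|\le\kappa_y$; let $\Psi_0:\mathbb R^{d_u}\to\mathbb R^{d_u}$ and $h_0:\mathbb R^{d_u}\to\mathbb R^{d_y}$ be affine with $|\Psi_0(u)|\le\kappa_\Psi(1+|u|)$ and $|h_0(u)|\le\kappa_h(1+|u|)$ for all $u$. Let $\varepsilon\in[0,1]$, let $\Psi$ be measurable and let $h$ be Lipschitz with constant at most $\ell_h$, with $\|\Psi-\Psi_0\|_{L^\infty}\le\varepsilon$ and $\|h-h_0\|_{L^\infty}\le\varepsilon$ with respect to Lebesgue measure, and with $|\Psi-\Psi_0|\le\varepsilon$ also $\mu_0$-almost everywhere (which is automatic if $\mu_0$ has a density, or if the bound holds everywhere). Then $$d_g(\mu_J^{\rm EK},\mu_J)\le C\,\varepsilon .$$ -/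

import Mathlib

open MeasureTheory ProbabilityTheory
open scoped NNReal ENNReal Matrix

noncomputable section

namespace MeanFieldEnKF

/-- `ℝⁿ` with the Euclidean norm. -/
abbrev E (n : ℕ) : Type := EuclideanSpace ℝ (Fin n)

/-- The weighted total variation distance with weight `g v = 1 + |v| ^ 2`: the supremum of
`|μ₁[f] - μ₂[f]|` over all measurable `f` with `|f| ≤ g`. It takes values in `[0, ∞]`. The
integrability conditions hold automatically when both measures have finite second moments; they
only exclude test functions for which `μ₁[f]` or `μ₂[f]` is undefined. -/
def weightedTV {n : ℕ} (μ₁ μ₂ : Measure (E n)) : ℝ≥0∞ :=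
  ⨆ (f : E n → ℝ) (_ : Measurable f) (_ : ∀ v, |f v| ≤ 1 + ‖v‖ ^ 2)
    (_ : Integrable f μ₁) (_ : Integrable f μ₂),
    ENNReal.ofReal |(∫ v, f v ∂μ₁) - ∫ v, f v ∂μ₂|

/-- The polynomial moment of order `q`. -/
def polyMoment {n : ℕ} (q : ℕ) (μ : Measure (E n)) : ℝ := ∫ x, ‖x‖ ^ q ∂μ

/-- The Lebesgue density of the centred Gaussian with (positive definite) covariance `S`. The
exponent uses `|S^(-1/2) x| ^ 2 = xᵀ S⁻¹ x`. -/
def gaussianDensity {n : ℕ} (S : Matrix (Fin n) (Fin n) ℝ) (x : E n) : ℝ≥0∞ :=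
  ENNReal.ofReal
    ((√((2 * Real.pi) ^ n * S.det))⁻¹ * Real.exp (-(1 / 2) * (x.ofLp ⬝ᵥ (S⁻¹ *ᵥ x.ofLp))))

/-- Prediction: the Lebesgue density of the law of `Ψ(v) + ξ`, where `v` has law `μ` and
`ξ ~ N(0, Sig)` is independent of `v`. -/
def predict {n : ℕ} (Ψ : E n → E n) (Sig : Matrix (Fin n) (Fin n) ℝ) (μ : Measure (E n)) :
    E n → ℝ≥0∞ :=
  fun u => ∫⁻ v, gaussianDensity Sig (u - Ψ v) ∂μ

/-- Lift to the joint space of state and data: the density of the law of `(u, h(u) + η)`, where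
`u` has density `ρ` and `η ~ N(0, Gam)` is independent of `u`. -/
def lift {n m : ℕ} (h : E n → E m) (Gam : Matrix (Fin m) (Fin m) ℝ) (ρ : E n → ℝ≥0∞) :
    E n × E m → ℝ≥0∞ :=
  fun p => gaussianDensity Gam (p.2 - h p.1) * ρ p.1

/-- Conditioning of a joint density on the datum `z`. -/
def condition {n m : ℕ} (z : E m) (ρ : E n × E m → ℝ≥0∞) : E n → ℝ≥0∞ :=
  fun u => ρ (u, z) / ∫⁻ U, ρ (U, z)

/-- The state-data block of the covariance matrix. -/
def covUY {n m : ℕ} (π : Measure (E n × E m)) : Matrix (Fin n) (Fin m) ℝ :=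
  Matrix.of fun i j => cov[fun p => p.1 i, fun p => p.2 j; π]

/-- The data-data block of the covariance matrix. -/
def covYY {n m : ℕ} (π : Measure (E n × E m)) : Matrix (Fin m) (Fin m) ℝ :=
  Matrix.of fun i j => cov[fun p => p.2 i, fun p => p.2 j; π]

/-- The Kalman transport map `(u, y) ↦ u + C^{uy}(π) C^{yy}(π)⁻¹ (z - y)`. -/
def kalmanMap {n m : ℕ} (π : Measure (E n × E m)) (z : E m) (p : E n × E m) : E n :=
  p.1 + WithLp.toLp 2 ((covUY π * (covYY π)⁻¹) *ᵥ (z - p.2).ofLp)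

/-- The mean field Kalman analysis step: pushforward of `π` under its Kalman transport map. -/
def kalmanTransport {n m : ℕ} (z : E m) (π : Measure (E n × E m)) : Measure (E n) :=
  π.map (kalmanMap π z)

/-- The true filter: predict, lift to state-data space, condition on the new datum. -/
def trueFilter {n m : ℕ} (Ψ : E n → E n) (h : E n → E m) (Sig : Matrix (Fin n) (Fin n) ℝ)
    (Gam : Matrix (Fin m) (Fin m) ℝ) (y : ℕ → E m) (μ₀ : Measure (E n)) : ℕ → Measure (E n)
  | 0 => μ₀
  | j + 1 => volume.withDensity
      (condition (y (j + 1)) (lift h Gam (predict Ψ Sig (trueFilter Ψ h Sig Gam y μ₀ j))))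

/-- The mean field ensemble Kalman filter: predict, lift to state-data space, apply the Kalman
transport map. -/
def meanFieldEnKF {n m : ℕ} (Ψ : E n → E n) (h : E n → E m) (Sig : Matrix (Fin n) (Fin n) ℝ)
    (Gam : Matrix (Fin m) (Fin m) ℝ) (y : ℕ → E m) (μ₀ : Measure (E n)) : ℕ → Measure (E n)
  | 0 => μ₀
  | j + 1 => kalmanTransport (y (j + 1)) (volume.withDensity
      (lift h Gam (predict Ψ Sig (meanFieldEnKF Ψ h Sig Gam y μ₀ j))))

end MeanFieldEnKF

end

open MeanFieldEnKF

namespace MeanFieldEnKF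

open scoped Matrix.Norms.L2Operator MatrixOrder

/-! Both filters are compared with one Gaussian reference sequence: the mean field ensemble Kalman
filter of the affine model `(Ψ₀, h₀)` started from the same `μ₀`. For affine maps the joint law of
state and data is Gaussian, and on Gaussian laws Kalman transport and conditioning agree
(`kalmanTransport_eq_posterior`). The reference sequence is therefore also the exact filter of the
affine model, and the triangle inequality gives the theorem once each filter of `(Ψ, h)` is shown to
stay within `O(ε)` of it (`exists_distLE_filters`, by induction on time).

The induction needs each step to be Lipschitz around the reference in the weighted distance
`DistLE`, with an additional error `O(ε)` from the change of model. Prediction and lifting have this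
property because adding Gaussian noise turns a shift of the mean into a small relative change of a
smooth density (`abs_integral_noise_shift_le`, `DistLE.jointLaw`). Conditioning has it because the
likelihood is bounded and the evidence is bounded below by second moments (`le_evidence`,
`DistLE.posterior`).

Kalman transport is the delicate step, since the map itself depends on the law. The gain is
Lipschitz in the law (`DistLE.norm_gain_sub_le`): covariances integrate quadratic test functions,
and the data covariance dominates that of the noise. Changing the gain shears the state by a
function of the data; a shear preserves Lebesgue measure and changes the Gaussian joint density by a
small relative amount (`exists_abs_integral_gainMap_sub_le`). This last estimate is made for the
reference law only, so moments above the second are needed for the reference alone. -/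

/-! ### Gaussian densities and Gaussian noise. -/

/-- The centred Gaussian noise with (positive definite) covariance `S`, given by its density. -/
noncomputable def noise {n : ℕ} (S : Matrix (Fin n) (Fin n) ℝ) : Measure (E n) :=
  volume.withDensity (gaussianDensity S)

/-- The real-valued Gaussian density. -/
noncomputable def realDensity {n : ℕ} (S : Matrix (Fin n) (Fin n) ℝ) (x : E n) : ℝ :=
  (√((2 * Real.pi) ^ n * S.det))⁻¹ * Real.exp (-(1 / 2) * (x.ofLp ⬝ᵥ (S⁻¹ *ᵥ x.ofLp)))

lemma gaussianDensity_eq {n : ℕ} (S : Matrix (Fin n) (Fin n) ℝ) (x : E n) :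
    gaussianDensity S x = ENNReal.ofReal (realDensity S x) := rfl

lemma continuous_realDensity {n : ℕ} (S : Matrix (Fin n) (Fin n) ℝ) :
    Continuous (realDensity S) := by
  unfold realDensity
  refine continuous_const.mul (Real.continuous_exp.comp (continuous_const.mul ?_))
  exact (PiLp.continuous_ofLp 2 _).dotProduct
    (Continuous.matrix_mulVec continuous_const (PiLp.continuous_ofLp 2 _))

lemma continuous_gaussianDensity {n : ℕ} (S : Matrix (Fin n) (Fin n) ℝ) :
    Continuous (gaussianDensity S) :=
  ENNReal.continuous_ofReal.comp (continuous_realDensity S)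

@[fun_prop]
lemma measurable_realDensity {n : ℕ} (S : Matrix (Fin n) (Fin n) ℝ) :
    Measurable (realDensity S) := (continuous_realDensity S).measurable

@[fun_prop]
lemma measurable_gaussianDensity {n : ℕ} (S : Matrix (Fin n) (Fin n) ℝ) :
    Measurable (gaussianDensity S) := (continuous_gaussianDensity S).measurable

lemma realDensity_nonneg {n : ℕ} (S : Matrix (Fin n) (Fin n) ℝ) (x : E n) :
    0 ≤ realDensity S x := by unfold realDensity; positivity

lemma realDensity_pos {n : ℕ} {S : Matrix (Fin n) (Fin n) ℝ} (hS : S.PosDef) (x : E n) :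
    0 < realDensity S x := by
  have := hS.det_pos
  unfold realDensity; positivity

/-- The standard Gaussian measure has the usual Lebesgue density. -/
lemma stdGaussian_eq_withDensity (n : ℕ) :
    stdGaussian (E n) = volume.withDensity (fun x : E n =>
      ENNReal.ofReal ((√((2 * Real.pi) ^ n))⁻¹ * Real.exp (-(1 / 2) * ‖x‖ ^ 2))) := by
  have hint : Integrable (fun x : E n => Real.exp (-(1 / 2) * ‖x‖ ^ 2)) := by
    have := GaussianFourier.integrable_cexp_neg_mul_sq_norm_add (V := E n) (b := 1 / 2)
      (by norm_num) 0 0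
    refine this.norm.congr (ae_of_all _ fun x => ?_)
    simp only [Complex.norm_exp]
    congr 1
    simp [← Complex.ofReal_pow]
  set c := (√((2 * Real.pi) ^ n))⁻¹ with hc
  have hint' := hint.const_mul c
  have hnn : ∀ x : E n, 0 ≤ c * Real.exp (-(1 / 2) * ‖x‖ ^ 2) := fun x => by positivity
  have : IsFiniteMeasure (volume.withDensity (fun x : E n =>
      ENNReal.ofReal (c * Real.exp (-(1 / 2) * ‖x‖ ^ 2)))) :=
    isFiniteMeasure_withDensity_ofReal hint'.2
  refine Measure.ext_of_charFun ?_
  ext t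
  rw [charFun_stdGaussian, charFun_apply,
    integral_withDensity_eq_integral_toReal_smul (by fun_prop) (by simp)]
  -- The measures are identified by their characteristic functions; this Gaussian integral supplies
  -- that of the density.
  have key := GaussianFourier.integral_cexp_neg_mul_sq_norm_add_of_euclideanSpace
    (ι := Fin n) (b := 1 / 2) (by norm_num) Complex.I t
  have : ∀ x : E n, (ENNReal.ofReal (c * Real.exp (-(1 / 2) * ‖x‖ ^ 2))).toReal •
      Complex.exp (inner ℝ x t * Complex.I) =
      (c : ℂ) * Complex.exp (-(1 / 2) * ‖x‖ ^ 2 + Complex.I * inner ℝ t x) := by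
    intro x
    rw [ENNReal.toReal_ofReal (hnn x), Complex.exp_add, real_inner_comm]
    simp only [Complex.real_smul]
    push_cast
    ring_nf
  simp_rw [this]
  rw [integral_const_mul, key]
  have hpi : (0 : ℝ) < 2 * Real.pi := by positivity
  have h1 : ((Real.pi : ℂ) / (1 / 2)) ^ ((Fintype.card (Fin n) : ℂ) / 2)
      = ((√((2 * Real.pi) ^ n) : ℝ) : ℂ) := by
    rw [Real.sqrt_eq_rpow, ← Real.rpow_natCast, ← Real.rpow_mul hpi.le,
      Complex.ofReal_cpow hpi.le]
    push_cast
    simp only [Fintype.card_fin]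
    congr 1 <;> ring
  rw [h1, ← mul_assoc, ← Complex.ofReal_mul, hc, inv_mul_cancel₀ (by positivity)]
  simp only [Complex.ofReal_one, one_mul]
  congr 1
  rw [Complex.I_sq]; ring

/-- Change of variables by the symmetric square root of `S`. It makes all moments and the covariance
of the noise available from the theory of Gaussian measures. -/
lemma noise_eq_multivariateGaussian {n : ℕ} {S : Matrix (Fin n) (Fin n) ℝ} (hS : S.PosDef) :
    noise S = multivariateGaussian 0 S := by
  set R := CFC.sqrt S with hR
  have hRR : R * R = S := CFC.sqrt_mul_sqrt_self _ hS.posSemidef.nonneg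
  have hdetS := hS.det_pos
  have hdet : R.det * R.det = S.det := by rw [← Matrix.det_mul, hRR]
  have hRdet : R.det ≠ 0 := by
    intro h; rw [h] at hdet; simp at hdet; linarith
  have hRsymm : Rᵀ = R := by
    have : R.IsHermitian := (Matrix.nonneg_iff_posSemidef.1 (CFC.sqrt_nonneg S)).isHermitian
    simpa [Matrix.IsHermitian] using this
  set B := Matrix.toEuclideanCLM (𝕜 := ℝ) R with hB
  have hBdet : LinearMap.det (B : E n →ₗ[ℝ] E n) = R.det := by
    rw [hB, Matrix.coe_toEuclideanCLM_eq_toEuclideanLin]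
    change LinearMap.det (Matrix.toLpLin 2 2 R) = R.det
    rw [Matrix.toLpLin_eq_toLin,
      LinearMap.det_toLin]
  rw [multivariateGaussian]
  simp only [zero_add]
  rw [← hR, ← hB, stdGaussian_eq_withDensity]
  refine Measure.ext_of_lintegral _ fun f hf => ?_
  rw [lintegral_map hf (by fun_prop), lintegral_withDensity_eq_lintegral_mul _ (by fun_prop)
    (by fun_prop), noise, lintegral_withDensity_eq_lintegral_mul _ (by fun_prop) hf]
  have hmap := Measure.map_linearMap_addHaar_eq_smul_addHaar (volume : Measure (E n))
    (f := (B : E n →ₗ[ℝ] E n)) (by rw [hBdet]; exact hRdet)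
  have hgf : Measurable (gaussianDensity S * f) := (measurable_gaussianDensity S).mul hf
  have h2 : ∫⁻ z, (gaussianDensity S * f) (B z) =
      ENNReal.ofReal |R.det⁻¹| * ∫⁻ x, (gaussianDensity S * f) x := by
    rw [← lintegral_map hgf (by fun_prop : Measurable B)]
    have : (volume : Measure (E n)).map B = ENNReal.ofReal |R.det⁻¹| • volume := by
      rw [← hBdet]; exact hmap
    rw [this, lintegral_smul_measure, smul_eq_mul]
  have h3 : ∀ z : E n, ((fun x : E n => ENNReal.ofReal ((√((2 * Real.pi) ^ n))⁻¹ *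
      Real.exp (-(1 / 2) * ‖x‖ ^ 2))) * fun z => f (B z)) z =
      ENNReal.ofReal |R.det| * (gaussianDensity S * f) (B z) := by
    intro z
    simp only [Pi.mul_apply]
    rw [← mul_assoc]
    congr 1
    rw [gaussianDensity, ← ENNReal.ofReal_mul (abs_nonneg _)]
    congr 1
    have e1 : (B z).ofLp = R *ᵥ z.ofLp := Matrix.ofLp_toEuclideanCLM _ _
    have e2 : (B z).ofLp ⬝ᵥ (S⁻¹ *ᵥ (B z).ofLp) = ‖z‖ ^ 2 := by
      rw [e1, Matrix.mulVec_mulVec, ← hRR, Matrix.mul_inv_rev, mul_assoc,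
        Matrix.nonsing_inv_mul _ hRdet.isUnit, mul_one, Matrix.dotProduct_mulVec]
      nth_rw 1 [← hRsymm]
      rw [Matrix.mulVec_transpose, Matrix.vecMul_vecMul, Matrix.mul_nonsing_inv _ hRdet.isUnit,
        Matrix.vecMul_one, EuclideanSpace.real_norm_sq_eq]
      simp [dotProduct, sq]
    rw [e2, ← mul_assoc]
    congr 1
    rw [← hdet, Real.sqrt_mul (by positivity), Real.sqrt_mul_self_eq_abs, mul_inv]
    have : |R.det| ≠ 0 := abs_ne_zero.2 hRdet
    field_simp
  rw [lintegral_congr h3, lintegral_const_mul (f := fun z => (gaussianDensity S * f) (B z)) _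
    (hgf.comp B.continuous.measurable), h2, ← mul_assoc,
    ← ENNReal.ofReal_mul (abs_nonneg _), ← abs_mul, mul_inv_cancel₀ hRdet]
  simp

lemma isGaussian_noise {n : ℕ} {S : Matrix (Fin n) (Fin n) ℝ} (hS : S.PosDef) :
    IsGaussian (noise S) := by
  rw [noise_eq_multivariateGaussian hS]; infer_instance

/-- Convexity of the exponential. Keeping both exponentials on the right makes it a relative bound,
so that differences of Gaussian densities are controlled by moments of the same two Gaussians. -/
lemma abs_exp_neg_sub_exp_neg_le (a b : ℝ) :
    |Real.exp (-a) - Real.exp (-b)| ≤ |a - b| * (Real.exp (-a) + Real.exp (-b)) := by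
  wlog h : a ≤ b generalizing a b
  · have := this b a (le_of_not_ge h)
    rwa [abs_sub_comm, abs_sub_comm a, add_comm (Real.exp (-a))]
  have h1 : Real.exp (-b) = Real.exp (-a) * Real.exp (-(b - a)) := by
    rw [← Real.exp_add]; ring_nf
  have h2 : -(b - a) + 1 ≤ Real.exp (-(b - a)) := Real.add_one_le_exp _
  have h3 := Real.exp_pos (-a)
  have h4 := Real.exp_pos (-b)
  rw [abs_of_nonneg (sub_nonneg.2 (Real.exp_le_exp.2 (by linarith))), abs_of_nonpos (by linarith)]
  nlinarith [mul_le_mul_of_nonneg_left h2 h3.le, mul_nonneg (sub_nonneg.2 h) h4.le]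

/-- The quadratic form in the exponent of the Gaussian density. -/
noncomputable def precForm {n : ℕ} (S : Matrix (Fin n) (Fin n) ℝ) (x : E n) : ℝ :=
  x.ofLp ⬝ᵥ (S⁻¹ *ᵥ x.ofLp)

lemma abs_dotProduct_le {n : ℕ} (x y : E n) : |x.ofLp ⬝ᵥ y.ofLp| ≤ ‖x‖ * ‖y‖ := by
  have h : inner ℝ y x = x.ofLp ⬝ᵥ y.ofLp := by
    simp [PiLp.inner_apply, dotProduct]
  rw [← h, mul_comm]
  exact abs_real_inner_le_norm y x

lemma abs_precForm_sub_le {n : ℕ} (S : Matrix (Fin n) (Fin n) ℝ) (x y : E n) :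
    |precForm S x - precForm S y| ≤ ‖S⁻¹‖ * ‖x - y‖ * (‖x‖ + ‖y‖) := by
  have h : precForm S x - precForm S y =
      (x - y).ofLp ⬝ᵥ (WithLp.toLp 2 (S⁻¹ *ᵥ x.ofLp) : E n).ofLp +
      y.ofLp ⬝ᵥ (WithLp.toLp 2 (S⁻¹ *ᵥ (x - y).ofLp) : E n).ofLp := by
    simp only [precForm, WithLp.ofLp_sub, Matrix.mulVec_sub, sub_dotProduct, dotProduct_sub]
    ring
  rw [h]
  refine (abs_add_le _ _).trans ?_
  have h1 := (abs_dotProduct_le (x - y) (WithLp.toLp 2 (S⁻¹ *ᵥ x.ofLp))).trans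
    (mul_le_mul_of_nonneg_left (Matrix.l2_opNorm_mulVec S⁻¹ x) (norm_nonneg _))
  have h2 := (abs_dotProduct_le y (WithLp.toLp 2 (S⁻¹ *ᵥ (x - y).ofLp))).trans
    (mul_le_mul_of_nonneg_left (Matrix.l2_opNorm_mulVec S⁻¹ (x - y)) (norm_nonneg _))
  linarith

lemma realDensity_eq {n : ℕ} (S : Matrix (Fin n) (Fin n) ℝ) (x : E n) :
    realDensity S x =
      (√((2 * Real.pi) ^ n * S.det))⁻¹ * Real.exp (-(1 / 2 * precForm S x)) := by
  rw [realDensity, precForm, neg_mul]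

lemma abs_realDensity_sub_le {n : ℕ} (S : Matrix (Fin n) (Fin n) ℝ) (x y : E n) :
    |realDensity S x - realDensity S y| ≤
      ‖S⁻¹‖ * ‖x - y‖ * (‖x‖ + ‖y‖) * (realDensity S x + realDensity S y) := by
  rw [realDensity_eq, realDensity_eq, ← mul_sub, abs_mul, abs_of_nonneg (by positivity),
    ← mul_add, mul_left_comm]
  refine mul_le_mul_of_nonneg_left ?_ (by positivity)
  refine (abs_exp_neg_sub_exp_neg_le _ _).trans
    (mul_le_mul_of_nonneg_right ?_ (by positivity))
  rw [← mul_sub, abs_mul, abs_of_pos (by norm_num : (0:ℝ) < 1 / 2)]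
  have := abs_precForm_sub_le S x y
  linarith [abs_nonneg (precForm S x - precForm S y)]

/-- The product of two Gaussian densities varies at most like its logarithm. -/
lemma abs_realDensity_mul_sub_le {n m : ℕ} (S : Matrix (Fin n) (Fin n) ℝ)
    (R : Matrix (Fin m) (Fin m) ℝ) (x x' : E n) (y y' : E m) :
    |realDensity S x * realDensity R y - realDensity S x' * realDensity R y'| ≤
      (‖S⁻¹‖ * ‖x - x'‖ * (‖x‖ + ‖x'‖) + ‖R⁻¹‖ * ‖y - y'‖ * (‖y‖ + ‖y'‖)) *
        (realDensity S x * realDensity R y + realDensity S x' * realDensity R y') := by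
  have h : ∀ (x : E n) (y : E m), realDensity S x * realDensity R y =
      ((√((2 * Real.pi) ^ n * S.det))⁻¹ * (√((2 * Real.pi) ^ m * R.det))⁻¹) *
        Real.exp (-(1 / 2 * precForm S x + 1 / 2 * precForm R y)) := by
    intro x y
    rw [realDensity_eq, realDensity_eq, neg_add, Real.exp_add]
    ring
  rw [h x y, h x' y', ← mul_sub, abs_mul, abs_of_nonneg (by positivity),
    ← mul_add (_ * _ : ℝ) (Real.exp _), mul_left_comm]
  refine mul_le_mul_of_nonneg_left ?_ (by positivity)
  refine (abs_exp_neg_sub_exp_neg_le _ _).trans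
    (mul_le_mul_of_nonneg_right ?_ (by positivity))
  have e : 1 / 2 * precForm S x + 1 / 2 * precForm R y
      - (1 / 2 * precForm S x' + 1 / 2 * precForm R y') =
      1 / 2 * ((precForm S x - precForm S x') + (precForm R y - precForm R y')) := by ring
  rw [e, abs_mul, abs_of_pos (by norm_num : (0:ℝ) < 1 / 2)]
  have h1 := abs_precForm_sub_le S x x'
  have h2 := abs_precForm_sub_le R y y'
  have h3 := abs_add_le (precForm S x - precForm S x') (precForm R y - precForm R y')
  linarith [abs_nonneg ((precForm S x - precForm S x') + (precForm R y - precForm R y'))]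

lemma realDensity_le {n : ℕ} {S : Matrix (Fin n) (Fin n) ℝ} (hS : S.PosDef) (x : E n) :
    realDensity S x ≤ (√((2 * Real.pi) ^ n * S.det))⁻¹ := by
  rw [realDensity_eq]
  refine mul_le_of_le_one_right (by positivity) (Real.exp_le_one_iff.2 ?_)
  have : 0 ≤ precForm S x := by
    have := hS.inv.posSemidef.dotProduct_mulVec_nonneg x.ofLp
    simpa [precForm] using this
  linarith

lemma le_realDensity {n : ℕ} (S : Matrix (Fin n) (Fin n) ℝ) (x : E n) :
    (√((2 * Real.pi) ^ n * S.det))⁻¹ * Real.exp (-(‖S⁻¹‖ * ‖x‖ ^ 2)) ≤ realDensity S x := by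
  rw [realDensity_eq]
  refine mul_le_mul_of_nonneg_left (Real.exp_le_exp.2 ?_) (by positivity)
  have := abs_precForm_sub_le S x 0
  have h0 : precForm S (0 : E n) = 0 := by simp [precForm]
  rw [h0, sub_zero, sub_zero, norm_zero, add_zero] at this
  have h1 := le_abs_self (precForm S x)
  have h2 : 0 ≤ ‖S⁻¹‖ * ‖x‖ ^ 2 := by positivity
  nlinarith

lemma integrable_noise_weight {n : ℕ} {S : Matrix (Fin n) (Fin n) ℝ} (hS : S.PosDef) (k : ℕ) :
    Integrable (fun ξ : E n => (1 + ‖ξ‖) ^ k) (noise S) := by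
  have := isGaussian_noise hS
  have h : MemLp (fun ξ : E n => 1 + ‖ξ‖) k (noise S) :=
    (memLp_const (1 : ℝ)).add (IsGaussian.memLp_id (noise S) k (ENNReal.natCast_ne_top k)).norm
  refine (h.integrable_norm_pow').congr (ae_of_all _ fun x => ?_)
  simp only
  rw [Real.norm_of_nonneg (by positivity)]

lemma sFinite_noise {n : ℕ} (S : Matrix (Fin n) (Fin n) ℝ) : SFinite (noise S) := by
  unfold noise; infer_instance

/-- Moves a shift off the test function, which is only measurable, onto the Gaussian density, which
is smooth. -/
lemma integral_noise_add {n : ℕ} (S : Matrix (Fin n) (Fin n) ℝ) (F : E n → ℝ) (a : E n) :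
    ∫ ξ, F (a + ξ) ∂noise S = ∫ u, F u * realDensity S (u - a) := by
  rw [noise, integral_withDensity_eq_integral_toReal_smul (by fun_prop) (by simp [gaussianDensity_eq])]
  rw [← integral_sub_right_eq_self _ a]
  refine integral_congr_ae (ae_of_all _ fun u => ?_)
  simp [gaussianDensity_eq, ENNReal.toReal_ofReal (realDensity_nonneg S _), mul_comm]

lemma integrable_noise_add {n : ℕ} (S : Matrix (Fin n) (Fin n) ℝ) (F : E n → ℝ) (a : E n) :
    Integrable (fun ξ => F (a + ξ)) (noise S) ↔
      Integrable (fun u => F u * realDensity S (u - a)) := by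
  rw [noise, integrable_withDensity_iff (by fun_prop) (by simp [gaussianDensity_eq])]
  have h := MeasurePreserving.integrable_comp_emb (measurePreserving_sub_right volume a)
    (MeasurableEquiv.subRight a).measurableEmbedding
    (g := fun x => F (a + x) * (gaussianDensity S x).toReal)
  rw [← h]
  simp [Function.comp_def, gaussianDensity_eq, ENNReal.toReal_ofReal (realDensity_nonneg S _)]

lemma lintegral_noise_add {n : ℕ} (S : Matrix (Fin n) (Fin n) ℝ) (F : E n → ℝ≥0∞)
    (hF : Measurable F) (a : E n) :
    ∫⁻ ξ, F (a + ξ) ∂noise S = ∫⁻ u, gaussianDensity S (u - a) * F u := by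
  rw [noise, lintegral_withDensity_eq_lintegral_mul _ (by fun_prop) (by fun_prop)]
  rw [← lintegral_sub_right_eq_self _ a]
  simp

/-! ### Weighted total variation distance and moments. -/

section Weighted

variable {X Y : Type*} [NormedAddCommGroup X] [MeasurableSpace X]
  [NormedAddCommGroup Y] [MeasurableSpace Y]

/-- The weighted total variation distance with weight `(1 + |x|) ^ 2` is at most `δ`. -/
def DistLE (μ ν : Measure X) (δ : ℝ) : Prop :=
  ∀ f : X → ℝ, Measurable f → (∀ x, |f x| ≤ (1 + ‖x‖) ^ 2) → |∫ x, f x ∂μ - ∫ x, f x ∂ν| ≤ δ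

/-- The moment of order `k` is finite and at most `M`. -/
def HasMoment (k : ℕ) (μ : Measure X) (M : ℝ) : Prop :=
  Integrable (fun x => (1 + ‖x‖) ^ k) μ ∧ ∫ x, (1 + ‖x‖) ^ k ∂μ ≤ M

lemma DistLE.nonneg {μ ν : Measure X} {δ : ℝ} (h : DistLE μ ν δ) : 0 ≤ δ :=
  (abs_nonneg _).trans (h 0 measurable_zero fun x => by simp; positivity)

lemma DistLE.abs_sub_le {μ ν : Measure X} {δ A : ℝ} (h : DistLE μ ν δ) {f : X → ℝ}
    (hf : Measurable f) (hA : 0 ≤ A) (hfA : ∀ x, |f x| ≤ A * (1 + ‖x‖) ^ 2) :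
    |∫ x, f x ∂μ - ∫ x, f x ∂ν| ≤ A * δ := by
  rcases hA.eq_or_lt with rfl | hA
  · have : ∀ x, f x = 0 := fun x => abs_nonpos_iff.1 (by simpa using hfA x)
    simp [this]
  · have := h (fun x => A⁻¹ * f x) (hf.const_mul _) fun x => by
      rw [abs_mul, abs_of_pos (inv_pos.2 hA), inv_mul_le_iff₀ hA]
      exact hfA x
    rw [integral_const_mul, integral_const_mul, ← mul_sub, abs_mul, abs_of_pos (inv_pos.2 hA),
      inv_mul_le_iff₀ hA] at this
    exact this

lemma DistLE.symm {μ ν : Measure X} {δ : ℝ} (h : DistLE μ ν δ) : DistLE ν μ δ :=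
  fun f hf hb => by rw [abs_sub_comm]; exact h f hf hb

lemma DistLE.trans {μ ν ρ : Measure X} {δ δ' : ℝ} (h : DistLE μ ν δ) (h' : DistLE ν ρ δ') :
    DistLE μ ρ (δ + δ') :=
  fun f hf hb => (_root_.abs_sub_le _ _ _).trans (add_le_add (h f hf hb) (h' f hf hb))

lemma DistLE.mono {μ ν : Measure X} {δ δ' : ℝ} (h : DistLE μ ν δ) (hle : δ ≤ δ') :
    DistLE μ ν δ' :=
  fun f hf hb => (h f hf hb).trans hle

lemma DistLE.refl (μ : Measure X) {δ : ℝ} (hδ : 0 ≤ δ) : DistLE μ μ δ :=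
  fun f _ _ => by simpa using hδ

lemma DistLE.map {μ ν : Measure X} {δ c : ℝ} (h : DistLE μ ν δ) {T : X → Y}
    (hT : Measurable T) (hc : ∀ x, 1 + ‖T x‖ ≤ c * (1 + ‖x‖)) :
    DistLE (μ.map T) (ν.map T) (c ^ 2 * δ) := by
  intro f hf hb
  rw [integral_map hT.aemeasurable hf.aestronglyMeasurable,
    integral_map hT.aemeasurable hf.aestronglyMeasurable]
  refine h.abs_sub_le (hf.comp hT) (sq_nonneg c) fun x => (hb _).trans ?_
  rw [← mul_pow]
  exact pow_le_pow_left₀ (by positivity) (hc x) 2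

lemma HasMoment.mono {k : ℕ} {μ : Measure X} {M M' : ℝ} (h : HasMoment k μ M) (hM : M ≤ M') :
    HasMoment k μ M' := ⟨h.1, h.2.trans hM⟩

lemma HasMoment.integrable_of_le {k : ℕ} {μ : Measure X} {M : ℝ} (h : HasMoment k μ M)
    {f : X → ℝ} (hf : Measurable f) {A : ℝ} (hb : ∀ x, |f x| ≤ A * (1 + ‖x‖) ^ k) :
    Integrable f μ :=
  (h.1.const_mul A).mono' hf.aestronglyMeasurable (ae_of_all _ hb)

lemma HasMoment.abs_integral_le {k : ℕ} {μ : Measure X} {M : ℝ} (h : HasMoment k μ M)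
    {f : X → ℝ} {A : ℝ} (hA : 0 ≤ A) (hb : ∀ x, |f x| ≤ A * (1 + ‖x‖) ^ k) :
    |∫ x, f x ∂μ| ≤ A * M := by
  refine (norm_integral_le_of_norm_le (f := f) (h.1.const_mul A) (ae_of_all _ hb)).trans ?_
  rw [integral_const_mul]
  exact mul_le_mul_of_nonneg_left h.2 hA

lemma HasMoment.nonneg {k : ℕ} {μ : Measure X} {M : ℝ} (h : HasMoment k μ M) : 0 ≤ M :=
  (integral_nonneg fun x => by positivity).trans h.2

lemma HasMoment.of_le [BorelSpace X] {k l : ℕ} (hkl : k ≤ l) {μ : Measure X} {M : ℝ} (h : HasMoment l μ M) :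
    HasMoment k μ M := by
  have hb : ∀ x : X, (1 + ‖x‖) ^ k ≤ (1 + ‖x‖) ^ l := fun x =>
    pow_le_pow_right₀ (by linarith [norm_nonneg x]) hkl
  have hi : Integrable (fun x : X => (1 + ‖x‖) ^ k) μ :=
    h.integrable_of_le (A := 1) (by fun_prop) fun x => by
      rw [abs_of_nonneg (by positivity), one_mul]; exact hb x
  exact ⟨hi, (integral_mono hi h.1 hb).trans h.2⟩

lemma HasMoment.map [BorelSpace Y] {k : ℕ} {μ : Measure X} {M c : ℝ} (h : HasMoment k μ M) {T : X → Y}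
    (hT : Measurable T) (hc0 : 0 ≤ c) (hc : ∀ x, 1 + ‖T x‖ ≤ c * (1 + ‖x‖)) :
    HasMoment k (μ.map T) (c ^ k * M) := by
  have hw : Measurable (fun y : Y => (1 + ‖y‖) ^ k) := by fun_prop
  have hb : ∀ x, |(1 + ‖T x‖) ^ k| ≤ c ^ k * (1 + ‖x‖) ^ k := fun x => by
    rw [abs_of_nonneg (by positivity), ← mul_pow]
    exact pow_le_pow_left₀ (by positivity) (hc x) k
  refine ⟨(integrable_map_measure hw.aestronglyMeasurable hT.aemeasurable).2
    (h.integrable_of_le (hw.comp hT) hb), ?_⟩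
  rw [integral_map hT.aemeasurable hw.aestronglyMeasurable]
  exact (le_abs_self _).trans (h.abs_integral_le (pow_nonneg hc0 k) hb)

/-- The weight is itself an admissible test function. Integrability must be assumed separately,
because the integral of a non-integrable function is zero by convention and `DistLE` would not
detect it. -/
lemma DistLE.hasMoment [BorelSpace X] {μ ν : Measure X} {δ M : ℝ} (h : DistLE μ ν δ)
    (hν : HasMoment 2 ν M)
    (hμ : Integrable (fun x => (1 + ‖x‖) ^ 2) μ) : HasMoment 2 μ (M + δ) := by
  refine ⟨hμ, ?_⟩
  have := h (fun x => (1 + ‖x‖) ^ 2) (by fun_prop) fun x => by rw [abs_of_nonneg (by positivity)]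
  linarith [hν.2, le_abs_self (∫ x, (1 + ‖x‖) ^ 2 ∂μ - ∫ x, (1 + ‖x‖) ^ 2 ∂ν)]

end Weighted

/-! ### Prediction and lifting as laws of noisy images. -/

/-- The moments of the noise. -/
noncomputable def noiseMoment {n : ℕ} (S : Matrix (Fin n) (Fin n) ℝ) (k : ℕ) : ℝ :=
  ∫ ξ, (1 + ‖ξ‖) ^ k ∂noise S

lemma noiseMoment_nonneg {n : ℕ} (S : Matrix (Fin n) (Fin n) ℝ) (k : ℕ) : 0 ≤ noiseMoment S k :=
  integral_nonneg fun x => by positivity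

lemma hasMoment_noise {n : ℕ} {S : Matrix (Fin n) (Fin n) ℝ} (hS : S.PosDef) (k : ℕ) :
    HasMoment k (noise S) (noiseMoment S k) := ⟨integrable_noise_weight hS k, le_rfl⟩

/-- The law of `(v, h v + ξ)` where `v ~ μ` and `ξ ~ N(0, S)` are independent. -/
noncomputable def jointLaw {n m : ℕ} (h : E n → E m) (S : Matrix (Fin m) (Fin m) ℝ)
    (μ : Measure (E n)) : Measure (E n × E m) :=
  (μ.prod (noise S)).map fun p => (p.1, h p.1 + p.2)

/-- The law of `Ψ v + ξ` where `v ~ μ` and `ξ ~ N(0, S)` are independent. -/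
noncomputable def predictLaw {n m : ℕ} (Ψ : E n → E m) (S : Matrix (Fin m) (Fin m) ℝ)
    (μ : Measure (E n)) : Measure (E m) :=
  (jointLaw Ψ S μ).map Prod.snd

lemma lintegral_jointLaw {n m : ℕ} {h : E n → E m} (hh : Measurable h)
    (S : Matrix (Fin m) (Fin m) ℝ) (μ : Measure (E n)) {F : E n × E m → ℝ≥0∞}
    (hF : Measurable F) :
    ∫⁻ p, F p ∂jointLaw h S μ = ∫⁻ v, ∫⁻ ξ, F (v, h v + ξ) ∂noise S ∂μ := by
  have := sFinite_noise S
  rw [jointLaw, lintegral_map hF (by fun_prop), lintegral_prod _ (by fun_prop)]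

lemma withDensity_lift {n m : ℕ} {h : E n → E m} (hh : Measurable h)
    (S : Matrix (Fin m) (Fin m) ℝ) {ρ : E n → ℝ≥0∞} (hρ : Measurable ρ) :
    volume.withDensity (lift h S ρ) = jointLaw h S (volume.withDensity ρ) := by
  refine Measure.ext_of_lintegral _ fun F hF => ?_
  have hl : Measurable (lift h S ρ) := by unfold lift; fun_prop
  have := sFinite_noise S
  have hG : Measurable fun v => ∫⁻ ξ, F (v, h v + ξ) ∂noise S :=
    Measurable.lintegral_prod_right' (f := fun p : E n × E m => F (p.1, h p.1 + p.2))
      (by fun_prop)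
  rw [lintegral_jointLaw hh S _ hF, lintegral_withDensity_eq_lintegral_mul _ hl hF,
    lintegral_withDensity_eq_lintegral_mul _ hρ hG, Measure.volume_eq_prod,
    lintegral_prod _ (by fun_prop)]
  refine lintegral_congr fun u => ?_
  simp only [Pi.mul_apply]
  rw [lintegral_noise_add S (fun y => F (u, y)) (by fun_prop), ← lintegral_const_mul _
    (by fun_prop)]
  refine lintegral_congr fun y => ?_
  simp only [lift]
  ring

lemma lintegral_predictLaw {n m : ℕ} {Ψ : E n → E m} (hΨ : Measurable Ψ)
    (S : Matrix (Fin m) (Fin m) ℝ) (μ : Measure (E n)) {F : E m → ℝ≥0∞} (hF : Measurable F) :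
    ∫⁻ p, F p ∂predictLaw Ψ S μ = ∫⁻ v, ∫⁻ ξ, F (Ψ v + ξ) ∂noise S ∂μ := by
  rw [predictLaw, lintegral_map hF measurable_snd,
    lintegral_jointLaw hΨ S μ (F := fun p => F p.2) (hF.comp measurable_snd)]

lemma measurable_predict {n : ℕ} {Ψ : E n → E n} (hΨ : Measurable Ψ)
    (S : Matrix (Fin n) (Fin n) ℝ) (μ : Measure (E n)) [SFinite μ] :
    Measurable (predict Ψ S μ) :=
  Measurable.lintegral_prod_right' (f := fun p : E n × E n => gaussianDensity S (p.1 - Ψ p.2))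
    (by fun_prop)

lemma withDensity_predict {n : ℕ} {Ψ : E n → E n} (hΨ : Measurable Ψ)
    (S : Matrix (Fin n) (Fin n) ℝ) (μ : Measure (E n)) [SFinite μ] :
    volume.withDensity (predict Ψ S μ) = predictLaw Ψ S μ := by
  refine Measure.ext_of_lintegral _ fun F hF => ?_
  rw [lintegral_predictLaw hΨ S μ hF,
    lintegral_withDensity_eq_lintegral_mul _ (measurable_predict hΨ S μ) hF]
  simp only [Pi.mul_apply, predict]
  simp_rw [lintegral_noise_add S F hF]
  rw [lintegral_lintegral_swap (by fun_prop)]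
  refine lintegral_congr fun u => ?_
  rw [lintegral_mul_const _ (by fun_prop)]

lemma isProbabilityMeasure_noise {n : ℕ} {S : Matrix (Fin n) (Fin n) ℝ} (hS : S.PosDef) :
    IsProbabilityMeasure (noise S) := by
  have := isGaussian_noise hS
  infer_instance

lemma isProbabilityMeasure_jointLaw {n m : ℕ} {h : E n → E m} (hh : Measurable h)
    {S : Matrix (Fin m) (Fin m) ℝ} (hS : S.PosDef) (μ : Measure (E n)) [IsProbabilityMeasure μ] :
    IsProbabilityMeasure (jointLaw h S μ) := by
  have := isProbabilityMeasure_noise hS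
  exact Measure.isProbabilityMeasure_map (by fun_prop)

lemma isProbabilityMeasure_predictLaw {n m : ℕ} {h : E n → E m} (hh : Measurable h)
    {S : Matrix (Fin m) (Fin m) ℝ} (hS : S.PosDef) (μ : Measure (E n)) [IsProbabilityMeasure μ] :
    IsProbabilityMeasure (predictLaw h S μ) := by
  have := isProbabilityMeasure_jointLaw hh hS μ
  exact Measure.isProbabilityMeasure_map (by fun_prop)

/-- The product form separates the independent variables, so moments of the joint law factor into
those of the state and of the noise. -/
lemma one_add_norm_graph_le {n m : ℕ} {h : E n → E m} {κ : ℝ}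
    (hκ : ∀ v, ‖h v‖ ≤ κ * (1 + ‖v‖)) (v : E n) (ξ : E m) :
    1 + ‖(v, h v + ξ)‖ ≤ (1 + κ) * ((1 + ‖v‖) * (1 + ‖ξ‖)) := by
  have hκ0 : 0 ≤ κ := by
    have := (norm_nonneg _).trans (hκ 0)
    simpa using this
  have h1 := hκ v
  have h2 := norm_add_le (h v) ξ
  have h3 := norm_nonneg v
  have h4 := norm_nonneg ξ
  have h5 : 0 ≤ ‖v‖ * ‖ξ‖ := by positivity
  have h6 : 0 ≤ κ * (‖ξ‖ + ‖v‖ * ‖ξ‖) := by positivity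
  have h7 : 0 ≤ κ * (1 + ‖v‖) := by positivity
  rw [Prod.norm_mk]
  rcases max_cases ‖v‖ ‖h v + ξ‖ with h | h <;> rw [h.1] <;> nlinarith

lemma hasMoment_jointLaw {n m k : ℕ} {h : E n → E m} (hh : Measurable h) {κ : ℝ}
    (hκ : ∀ v, ‖h v‖ ≤ κ * (1 + ‖v‖)) {S : Matrix (Fin m) (Fin m) ℝ} (hS : S.PosDef)
    {μ : Measure (E n)} [SFinite μ] {M : ℝ} (hμ : HasMoment k μ M) :
    HasMoment k (jointLaw h S μ) ((1 + κ) ^ k * (noiseMoment S k * M)) := by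
  have hκ0 : 0 ≤ κ := by
    have := (norm_nonneg _).trans (hκ 0)
    simpa using this
  have := isProbabilityMeasure_noise hS
  have hw : Measurable (fun y : E n × E m => (1 + ‖y‖) ^ k) := by fun_prop
  have hT : Measurable (fun p : E n × E m => (p.1, h p.1 + p.2)) := by fun_prop
  have hi : Integrable (fun p : E n × E m => (1 + κ) ^ k * ((1 + ‖p.1‖) ^ k * (1 + ‖p.2‖) ^ k))
      (μ.prod (noise S)) := (hμ.1.mul_prod (integrable_noise_weight hS k)).const_mul _
  have hb : ∀ p : E n × E m, ‖(1 + ‖(p.1, h p.1 + p.2)‖) ^ k‖ ≤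
      (1 + κ) ^ k * ((1 + ‖p.1‖) ^ k * (1 + ‖p.2‖) ^ k) := fun p => by
    rw [Real.norm_of_nonneg (by positivity), ← mul_pow, ← mul_pow]
    exact pow_le_pow_left₀ (by positivity) (one_add_norm_graph_le hκ _ _) k
  refine ⟨(integrable_map_measure hw.aestronglyMeasurable hT.aemeasurable).2
    (hi.mono' (hw.comp hT).aestronglyMeasurable (ae_of_all _ hb)), ?_⟩
  rw [jointLaw, integral_map hT.aemeasurable hw.aestronglyMeasurable]
  refine (le_abs_self _).trans ((norm_integral_le_of_norm_le hi (ae_of_all _ hb)).trans ?_)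
  rw [integral_const_mul, integral_prod_mul (fun v : E n => (1 + ‖v‖) ^ k)
    (fun ξ : E m => (1 + ‖ξ‖) ^ k), mul_comm (∫ v, (1 + ‖v‖) ^ k ∂μ)]
  exact mul_le_mul_of_nonneg_left (mul_le_mul_of_nonneg_left hμ.2 (noiseMoment_nonneg S k))
    (by positivity)

lemma one_add_norm_snd_le {n m : ℕ} (p : E n × E m) : 1 + ‖p.2‖ ≤ 1 * (1 + ‖p‖) := by
  linarith [norm_snd_le p]

lemma hasMoment_predictLaw {n m k : ℕ} {h : E n → E m} (hh : Measurable h) {κ : ℝ}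
    (hκ : ∀ v, ‖h v‖ ≤ κ * (1 + ‖v‖)) {S : Matrix (Fin m) (Fin m) ℝ} (hS : S.PosDef)
    {μ : Measure (E n)} [SFinite μ] {M : ℝ} (hμ : HasMoment k μ M) :
    HasMoment k (predictLaw h S μ) ((1 + κ) ^ k * (noiseMoment S k * M)) := by
  simpa [predictLaw] using (hasMoment_jointLaw hh hκ hS hμ).map measurable_snd zero_le_one one_add_norm_snd_le

lemma integral_jointLaw {n m k : ℕ} {h : E n → E m} (hh : Measurable h) {κ : ℝ}
    (hκ : ∀ v, ‖h v‖ ≤ κ * (1 + ‖v‖)) {S : Matrix (Fin m) (Fin m) ℝ} (hS : S.PosDef)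
    {μ : Measure (E n)} [SFinite μ] {M : ℝ} (hμ : HasMoment k μ M) {F : E n × E m → ℝ}
    (hF : Measurable F) {A : ℝ} (hb : ∀ p, |F p| ≤ A * (1 + ‖p‖) ^ k) :
    ∫ p, F p ∂jointLaw h S μ = ∫ v, ∫ ξ, F (v, h v + ξ) ∂noise S ∂μ := by
  have := isProbabilityMeasure_noise hS
  have hT : Measurable (fun p : E n × E m => (p.1, h p.1 + p.2)) := by fun_prop
  have hi := (hasMoment_jointLaw hh hκ hS hμ).integrable_of_le hF hb
  rw [jointLaw, integrable_map_measure hF.aestronglyMeasurable hT.aemeasurable] at hi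
  rw [jointLaw, integral_map hT.aemeasurable hF.aestronglyMeasurable,
    integral_prod (fun p => F (p.1, h p.1 + p.2)) hi]

lemma measurable_integral_noise_graph {n m : ℕ} {h : E n → E m} (hh : Measurable h)
    {S : Matrix (Fin m) (Fin m) ℝ} {F : E n × E m → ℝ} (hF : Measurable F) :
    Measurable fun v => ∫ ξ, F (v, h v + ξ) ∂noise S := by
  have := sFinite_noise S
  exact (StronglyMeasurable.integral_prod_right' (ν := noise S)
    (f := fun p : E n × E m => F (p.1, h p.1 + p.2))
    (hF.comp (by fun_prop)).stronglyMeasurable).measurable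

lemma abs_integral_noise_graph_le {n m k : ℕ} {h : E n → E m} {κ : ℝ}
    (hκ : ∀ v, ‖h v‖ ≤ κ * (1 + ‖v‖)) {S : Matrix (Fin m) (Fin m) ℝ} (hS : S.PosDef)
    {F : E n × E m → ℝ} {A : ℝ} (hA : 0 ≤ A) (hb : ∀ p, |F p| ≤ A * (1 + ‖p‖) ^ k) (v : E n) :
    |∫ ξ, F (v, h v + ξ) ∂noise S| ≤ (A * (1 + κ) ^ k * noiseMoment S k) * (1 + ‖v‖) ^ k := by
  have hκ0 : 0 ≤ κ := by
    have := (norm_nonneg _).trans (hκ 0)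
    simpa using this
  have := (hasMoment_noise hS k).abs_integral_le (f := fun ξ => F (v, h v + ξ))
    (A := A * ((1 + κ) * (1 + ‖v‖)) ^ k) (by positivity) fun ξ => (hb _).trans (by
      rw [mul_assoc, ← mul_pow]
      exact mul_le_mul_of_nonneg_left (pow_le_pow_left₀ (by positivity)
        ((one_add_norm_graph_le hκ v ξ).trans (le_of_eq (by ring))) k) hA)
  exact this.trans (le_of_eq (by rw [mul_pow]; ring))

/-! ### Stability of prediction and lifting. -/

/-- Averages against Gaussian noise depend Lipschitz continuously on a shift, even for test
functions that are merely measurable. -/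
lemma abs_integral_noise_shift_le {n : ℕ} {S : Matrix (Fin n) (Fin n) ℝ} (hS : S.PosDef)
    {F : E n → ℝ} (hF : Measurable F) {A : ℝ} (hA : 0 ≤ A)
    (hb : ∀ x, |F x| ≤ A * (1 + ‖x‖) ^ 2) {a b : E n} (hab : ‖a - b‖ ≤ 1) :
    |∫ ξ, F (a + ξ) ∂noise S - ∫ ξ, F (b + ξ) ∂noise S| ≤
      A * ‖S⁻¹‖ * ‖a - b‖ * (1 + ‖a‖) ^ 2 * (10 * noiseMoment S 3) := by
  have hw := integrable_noise_weight hS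
  have hsub : ∀ c x : E n, 1 + ‖x‖ ≤ (1 + ‖c‖) * (1 + ‖x - c‖) := fun c x => by
    have := norm_add_le (x - c) c
    rw [sub_add_cancel] at this
    nlinarith [norm_nonneg c, norm_nonneg (x - c), mul_nonneg (norm_nonneg c) (norm_nonneg (x - c))]
  have hi : ∀ c : E n, Integrable fun u => F u * realDensity S (u - c) := fun c => by
    rw [← integrable_noise_add]
    refine ((hw 2).const_mul (A * (1 + ‖c‖) ^ 2)).mono'
      (hF.comp (measurable_const_add c)).aestronglyMeasurable
      (ae_of_all _ fun ξ => (hb _).trans ?_)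
    rw [mul_assoc, ← mul_pow]
    refine mul_le_mul_of_nonneg_left (pow_le_pow_left₀ (by positivity) ?_ 2) hA
    simpa using hsub c (c + ξ)
  have hm : ∀ c : E n, Integrable fun u => (1 + ‖u - c‖) ^ 3 * realDensity S (u - c) := fun c => by
    rw [← integrable_noise_add S (fun u => (1 + ‖u - c‖) ^ 3)]
    simpa using hw 3
  have hm' : ∀ c : E n, ∫ u, (1 + ‖u - c‖) ^ 3 * realDensity S (u - c) = noiseMoment S 3 :=
    fun c => by
      rw [← integral_noise_add S (fun u => (1 + ‖u - c‖) ^ 3), noiseMoment]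
      simp
  rw [integral_noise_add, integral_noise_add, ← integral_sub (hi a) (hi b)]
  set K := A * ‖S⁻¹‖ * ‖a - b‖ * (1 + ‖a‖) ^ 2 with hK
  -- Each density is paired with the cubic weight centred at its own mean, so both terms integrate
  -- to the same noise moment. The factor 8 is `2 ^ 2 * 2`, where `2 ^ 2` pays for replacing `‖b‖`
  -- by `‖a‖`; the 10 in the statement is `2 + 8`.
  have hbound : ∀ u, ‖F u * realDensity S (u - a) - F u * realDensity S (u - b)‖ ≤
      K * (2 * ((1 + ‖u - a‖) ^ 3 * realDensity S (u - a)) +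
        8 * ((1 + ‖u - b‖) ^ 3 * realDensity S (u - b))) := fun u => by
    rw [← mul_sub, norm_mul, Real.norm_eq_abs, Real.norm_eq_abs]
    have hga := realDensity_nonneg S (u - a)
    have hgb := realDensity_nonneg S (u - b)
    have h1 := abs_realDensity_sub_le S (u - a) (u - b)
    rw [sub_sub_sub_cancel_left, norm_sub_rev b a] at h1
    have hna := norm_nonneg (u - a)
    have hnb := norm_nonneg (u - b)
    have h2 : ‖u - b‖ ≤ ‖u - a‖ + 1 := by
      have := norm_add_le (u - a) (a - b)
      rw [sub_add_sub_cancel] at this; linarith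
    have h3 : ‖u - a‖ ≤ ‖u - b‖ + 1 := by
      have := norm_add_le (u - b) (b - a)
      rw [sub_add_sub_cancel, norm_sub_rev b a] at this; linarith
    have h4 : 1 + ‖b‖ ≤ 2 * (1 + ‖a‖) := by
      have := norm_add_le (b - a) a
      rw [sub_add_cancel, norm_sub_rev b a] at this; linarith [norm_nonneg a]
    have h5 : (1 + ‖u‖) ^ 2 * (‖u - a‖ + ‖u - b‖) ≤ (1 + ‖a‖) ^ 2 * (2 * (1 + ‖u - a‖) ^ 3) := by
      calc (1 + ‖u‖) ^ 2 * (‖u - a‖ + ‖u - b‖)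
          ≤ ((1 + ‖a‖) * (1 + ‖u - a‖)) ^ 2 * (2 * (1 + ‖u - a‖)) :=
            mul_le_mul (pow_le_pow_left₀ (by positivity) (hsub a u) 2) (by linarith)
              (by positivity) (by positivity)
        _ = _ := by ring
    have h6 : (1 + ‖u‖) ^ 2 * (‖u - a‖ + ‖u - b‖) ≤ (1 + ‖a‖) ^ 2 * (8 * (1 + ‖u - b‖) ^ 3) := by
      calc (1 + ‖u‖) ^ 2 * (‖u - a‖ + ‖u - b‖)
          ≤ ((2 * (1 + ‖a‖)) * (1 + ‖u - b‖)) ^ 2 * (2 * (1 + ‖u - b‖)) :=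
            mul_le_mul (pow_le_pow_left₀ (by positivity) ((hsub b u).trans
              (mul_le_mul_of_nonneg_right h4 (by positivity))) 2) (by linarith)
              (by positivity) (by positivity)
        _ = _ := by ring
    calc |F u| * |realDensity S (u - a) - realDensity S (u - b)|
        ≤ (A * (1 + ‖u‖) ^ 2) * (‖S⁻¹‖ * ‖a - b‖ * (‖u - a‖ + ‖u - b‖) *
            (realDensity S (u - a) + realDensity S (u - b))) :=
          mul_le_mul (hb u) h1 (abs_nonneg _) (by positivity)
      _ = A * ‖S⁻¹‖ * ‖a - b‖ *
          ((1 + ‖u‖) ^ 2 * (‖u - a‖ + ‖u - b‖) * realDensity S (u - a) +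
            (1 + ‖u‖) ^ 2 * (‖u - a‖ + ‖u - b‖) * realDensity S (u - b)) := by ring
      _ ≤ A * ‖S⁻¹‖ * ‖a - b‖ *
          ((1 + ‖a‖) ^ 2 * (2 * (1 + ‖u - a‖) ^ 3) * realDensity S (u - a) +
            (1 + ‖a‖) ^ 2 * (8 * (1 + ‖u - b‖) ^ 3) * realDensity S (u - b)) := by gcongr
      _ = _ := by rw [hK]; ring
  refine (norm_integral_le_of_norm_le
    ((((hm a).const_mul 2).add ((hm b).const_mul 8)).const_mul K) (ae_of_all _ hbound)).trans
    (le_of_eq ?_)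
  simp only [Pi.add_apply]
  rw [integral_const_mul, integral_add ((hm a).const_mul 2) ((hm b).const_mul 8),
    integral_const_mul, integral_const_mul, hm', hm']
  ring

/-- The joint law of state and noisy observation depends Lipschitz continuously on the law of the
state and on the observation map. -/
lemma DistLE.jointLaw {n m : ℕ} {S : Matrix (Fin m) (Fin m) ℝ} (hS : S.PosDef)
    {h h₀ : E n → E m} (hh : Measurable h) (hh₀ : Measurable h₀) {κ : ℝ}
    (hκ : ∀ v, ‖h v‖ ≤ κ * (1 + ‖v‖)) (hκ₀ : ∀ v, ‖h₀ v‖ ≤ κ * (1 + ‖v‖))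
    {ε : ℝ} (hε : ε ≤ 1) (hd : ∀ v, ‖h v - h₀ v‖ ≤ ε) {μ μ₀ : Measure (E n)} [SFinite μ]
    [SFinite μ₀] {δ M M' : ℝ} (hμ : HasMoment 2 μ M') (hμ₀ : HasMoment 4 μ₀ M)
    (hdist : DistLE μ μ₀ δ) :
    DistLE (jointLaw h S μ) (jointLaw h₀ S μ₀)
      ((1 + κ) ^ 2 * noiseMoment S 2 * δ +
        ‖S⁻¹‖ * (1 + κ) ^ 2 * (10 * noiseMoment S 3) * M * ε) := by
  intro F hF hb
  have hκ0 : 0 ≤ κ := by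
    have := (norm_nonneg _).trans (hκ 0)
    simpa using this
  have hε0 : 0 ≤ ε := (norm_nonneg _).trans (hd 0)
  have := isProbabilityMeasure_noise hS
  have hμ₀2 := hμ₀.of_le (by norm_num : 2 ≤ 4)
  have hb1 : ∀ p, |F p| ≤ 1 * (1 + ‖p‖) ^ 2 := fun p => by rw [one_mul]; exact hb p
  rw [integral_jointLaw hh hκ hS hμ hF hb1, integral_jointLaw hh₀ hκ₀ hS hμ₀2 hF hb1]
  set φ : E n → ℝ := fun v => ∫ ξ, F (v, h v + ξ) ∂noise S with hφ
  set φ₀ : E n → ℝ := fun v => ∫ ξ, F (v, h₀ v + ξ) ∂noise S with hφ₀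
  have hmeas : ∀ {k : E n → E m}, Measurable k →
      Measurable fun v => ∫ ξ, F (v, k v + ξ) ∂noise S := fun hk =>
    measurable_integral_noise_graph hk hF
  have hgrowth : ∀ {k : E n → E m}, (∀ v, ‖k v‖ ≤ κ * (1 + ‖v‖)) → ∀ v,
      |∫ ξ, F (v, k v + ξ) ∂noise S| ≤ ((1 + κ) ^ 2 * noiseMoment S 2) * (1 + ‖v‖) ^ 2 :=
    fun hk v => by simpa using abs_integral_noise_graph_le hk hS zero_le_one hb1 v
  -- The law is changed first, with `h` fixed, and the observation map second, under `μ₀`. Hence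
  -- only `μ₀` needs the fourth moment: two powers come from the test function and two from the
  -- growth of `h`.
  have h1 : |∫ v, φ v ∂μ - ∫ v, φ v ∂μ₀| ≤ (1 + κ) ^ 2 * noiseMoment S 2 * δ :=
    hdist.abs_sub_le (hmeas hh) (mul_nonneg (by positivity) (noiseMoment_nonneg S 2))
      (hgrowth hκ)
  have hpt : ∀ v, ‖φ v - φ₀ v‖ ≤
      (‖S⁻¹‖ * (1 + κ) ^ 2 * (10 * noiseMoment S 3) * ε) * (1 + ‖v‖) ^ 4 := by
    intro v
    have hm3 := noiseMoment_nonneg S 3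
    have hs := abs_integral_noise_shift_le hS (F := fun y => F (v, y)) (hF.comp (by fun_prop))
      (A := (1 + ‖v‖) ^ 2) (by positivity) (fun y => (hb _).trans (by
        rw [← mul_pow]
        refine pow_le_pow_left₀ (by positivity) ?_ 2
        rw [Prod.norm_mk]
        have := mul_nonneg (norm_nonneg v) (norm_nonneg y)
        rcases max_cases ‖v‖ ‖y‖ with h | h <;> rw [h.1] <;>
          nlinarith [norm_nonneg v, norm_nonneg y])) ((hd v).trans hε)
    refine hs.trans ?_
    have h2 : 1 + ‖h v‖ ≤ (1 + κ) * (1 + ‖v‖) := by nlinarith [hκ v, norm_nonneg v]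
    calc (1 + ‖v‖) ^ 2 * ‖S⁻¹‖ * ‖h v - h₀ v‖ * (1 + ‖h v‖) ^ 2 * (10 * noiseMoment S 3)
        ≤ (1 + ‖v‖) ^ 2 * ‖S⁻¹‖ * ε * ((1 + κ) * (1 + ‖v‖)) ^ 2 * (10 * noiseMoment S 3) := by
          gcongr
          exact hd v
      _ = _ := by ring
  have hi : ∀ {k : E n → E m}, Measurable k → (∀ v, ‖k v‖ ≤ κ * (1 + ‖v‖)) →
      Integrable (fun v => ∫ ξ, F (v, k v + ξ) ∂noise S) μ₀ := fun hk hk' =>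
    hμ₀2.integrable_of_le (hmeas hk) (hgrowth hk')
  have h2 : |∫ v, φ v ∂μ₀ - ∫ v, φ₀ v ∂μ₀| ≤
      ‖S⁻¹‖ * (1 + κ) ^ 2 * (10 * noiseMoment S 3) * M * ε := by
    have hm3 := noiseMoment_nonneg S 3
    rw [← integral_sub (hi hh hκ) (hi hh₀ hκ₀)]
    refine (hμ₀.abs_integral_le (by positivity) hpt).trans (le_of_eq (by ring))
  exact (_root_.abs_sub_le _ _ _).trans (add_le_add h1 h2)

/-- The second marginal of the joint estimate; projecting does not increase the weight. -/
lemma DistLE.predictLaw {n m : ℕ} {S : Matrix (Fin m) (Fin m) ℝ} (hS : S.PosDef)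
    {h h₀ : E n → E m} (hh : Measurable h) (hh₀ : Measurable h₀) {κ : ℝ}
    (hκ : ∀ v, ‖h v‖ ≤ κ * (1 + ‖v‖)) (hκ₀ : ∀ v, ‖h₀ v‖ ≤ κ * (1 + ‖v‖))
    {ε : ℝ} (hε : ε ≤ 1) (hd : ∀ v, ‖h v - h₀ v‖ ≤ ε) {μ μ₀ : Measure (E n)} [SFinite μ]
    [SFinite μ₀] {δ M M' : ℝ} (hμ : HasMoment 2 μ M') (hμ₀ : HasMoment 4 μ₀ M)
    (hdist : DistLE μ μ₀ δ) :
    DistLE (predictLaw h S μ) (predictLaw h₀ S μ₀)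
      ((1 + κ) ^ 2 * noiseMoment S 2 * δ +
        ‖S⁻¹‖ * (1 + κ) ^ 2 * (10 * noiseMoment S 3) * M * ε) := by
  simpa [MeanFieldEnKF.predictLaw] using
    (hdist.jointLaw hS hh hh₀ hκ hκ₀ hε hd hμ hμ₀).map measurable_snd one_add_norm_snd_le

/-! ### Covariances and coercive matrices. -/

section Covariance

variable {X : Type*} [NormedAddCommGroup X]

lemma abs_mul_le_weight {f g : X → ℝ} (hf : ∀ p, |f p| ≤ 1 + ‖p‖) (hg : ∀ p, |g p| ≤ 1 + ‖p‖)
    (p : X) : |f p * g p| ≤ 1 * (1 + ‖p‖) ^ 2 := by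
  rw [abs_mul, one_mul, sq]
  exact mul_le_mul (hf p) (hg p) (abs_nonneg _) (by positivity)

lemma abs_le_weight {f : X → ℝ} (hf : ∀ p, |f p| ≤ 1 + ‖p‖) (p : X) :
    |f p| ≤ 1 * (1 + ‖p‖) ^ 2 := by
  have := norm_nonneg p
  have := hf p
  nlinarith

variable [MeasurableSpace X]

lemma HasMoment.memLp_two {π : Measure X} {M : ℝ} (h : HasMoment 2 π M) {f : X → ℝ}
    (hf : Measurable f) {A : ℝ} (hb : ∀ p, |f p| ≤ A * (1 + ‖p‖)) : MemLp f 2 π := by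
  refine (memLp_two_iff_integrable_sq hf.aestronglyMeasurable).2
    (h.integrable_of_le (hf.pow_const 2) (A := A ^ 2) fun p => ?_)
  rw [abs_pow, ← mul_pow]
  exact pow_le_pow_left₀ (abs_nonneg _) (hb p) 2

lemma HasMoment.abs_covariance_le {π : Measure X} [IsProbabilityMeasure π] {M : ℝ}
    (h : HasMoment 2 π M) {f g : X → ℝ} (hfm : Measurable f) (hgm : Measurable g)
    (hf : ∀ p, |f p| ≤ 1 + ‖p‖) (hg : ∀ p, |g p| ≤ 1 + ‖p‖) :
    |cov[f, g; π]| ≤ M + M * M := by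
  rw [covariance_eq_sub (h.memLp_two hfm (A := 1) (by simpa using hf))
    (h.memLp_two hgm (A := 1) (by simpa using hg))]
  have h1 := h.abs_integral_le zero_le_one (abs_mul_le_weight hf hg)
  have h2 := h.abs_integral_le zero_le_one (abs_le_weight hf)
  have h3 := h.abs_integral_le zero_le_one (abs_le_weight hg)
  rw [one_mul] at h1 h2 h3
  refine (abs_sub _ _).trans (add_le_add h1 ?_)
  rw [abs_mul]
  exact mul_le_mul h2 h3 (abs_nonneg _) h.nonneg

/-- A covariance is a mean of a product minus a product of means. All three integrands are dominated
by the weight, and the product of means is changed one factor at a time. -/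
lemma DistLE.abs_covariance_sub_le {π π₀ : Measure X} [IsProbabilityMeasure π]
    [IsProbabilityMeasure π₀] {M δ : ℝ} (h : HasMoment 2 π M) (h₀ : HasMoment 2 π₀ M)
    (hd : DistLE π π₀ δ) {f g : X → ℝ} (hfm : Measurable f) (hgm : Measurable g)
    (hf : ∀ p, |f p| ≤ 1 + ‖p‖) (hg : ∀ p, |g p| ≤ 1 + ‖p‖) :
    |cov[f, g; π] - cov[f, g; π₀]| ≤ (1 + 2 * M) * δ := by
  rw [covariance_eq_sub (h.memLp_two hfm (A := 1) (by simpa using hf))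
    (h.memLp_two hgm (A := 1) (by simpa using hg)),
    covariance_eq_sub (h₀.memLp_two hfm (A := 1) (by simpa using hf))
    (h₀.memLp_two hgm (A := 1) (by simpa using hg))]
  have h1 := hd.abs_sub_le (hfm.mul hgm) zero_le_one (abs_mul_le_weight hf hg)
  have h2 := hd.abs_sub_le hfm zero_le_one (abs_le_weight hf)
  have h3 := hd.abs_sub_le hgm zero_le_one (abs_le_weight hg)
  have h4 := h.abs_integral_le zero_le_one (abs_le_weight hg)
  have h5 := h₀.abs_integral_le zero_le_one (abs_le_weight hf)
  rw [one_mul] at h1 h2 h3 h4 h5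
  set a := ∫ x, f x ∂π
  set a₀ := ∫ x, f x ∂π₀
  set b := ∫ x, g x ∂π
  set b₀ := ∫ x, g x ∂π₀
  have e : ∀ s s₀ : ℝ, (s - a * b) - (s₀ - a₀ * b₀) = (s - s₀) - (a - a₀) * b - a₀ * (b - b₀) := by
    intros; ring
  rw [e]
  have h6 : |(a - a₀) * b| ≤ δ * M := by
    rw [abs_mul]; exact mul_le_mul h2 h4 (abs_nonneg _) hd.nonneg
  have h7 : |a₀ * (b - b₀)| ≤ M * δ := by
    rw [abs_mul]; exact mul_le_mul h5 h3 (abs_nonneg _) h.nonneg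
  refine (abs_sub _ _).trans ?_
  refine (add_le_add ((abs_sub _ _).trans (add_le_add h1 h6)) h7).trans (le_of_eq (by ring))

end Covariance

/-- A constant comparing the operator norm of a matrix with its largest entry. -/
noncomputable def entryConst (n m : ℕ) : ℝ :=
  ∑ i : Fin n, ∑ j : Fin m, ‖(Matrix.single i j 1 : Matrix (Fin n) (Fin m) ℝ)‖

lemma entryConst_nonneg (n m : ℕ) : 0 ≤ entryConst n m :=
  Finset.sum_nonneg fun _ _ => Finset.sum_nonneg fun _ _ => norm_nonneg _

lemma l2_opNorm_le_of_entries {n m : ℕ} {A : Matrix (Fin n) (Fin m) ℝ} {r : ℝ}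
    (hA : ∀ i j, |A i j| ≤ r) : ‖A‖ ≤ entryConst n m * r := by
  conv_lhs => rw [Matrix.matrix_eq_sum_single A]
  rw [entryConst, Finset.sum_mul]
  refine (norm_sum_le _ _).trans (Finset.sum_le_sum fun i _ => ?_)
  rw [Finset.sum_mul]
  refine (norm_sum_le _ _).trans (Finset.sum_le_sum fun j _ => ?_)
  have : Matrix.single i j (A i j) = A i j • (Matrix.single i j 1 : Matrix (Fin n) (Fin m) ℝ) := by
    rw [Matrix.smul_single]; simp
  rw [this, norm_smul, mul_comm]
  exact mul_le_mul_of_nonneg_left (hA i j) (norm_nonneg _)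

/-- With `R` the symmetric square root of `S`, the form is `‖R x‖ ^ 2`, and `R` is invertible. -/
lemma exists_posDef_lower_bound {n : ℕ} {S : Matrix (Fin n) (Fin n) ℝ} (hS : S.PosDef) :
    ∃ γ > 0, ∀ x : E n, γ * ‖x‖ ^ 2 ≤ x.ofLp ⬝ᵥ (S *ᵥ x.ofLp) := by
  set R := CFC.sqrt S with hR
  have hRR : R * R = S := CFC.sqrt_mul_sqrt_self _ hS.posSemidef.nonneg
  have hdet : R.det * R.det = S.det := by rw [← Matrix.det_mul, hRR]
  have hRdet : R.det ≠ 0 := by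
    intro h
    have := hS.det_pos
    rw [← hdet, h] at this; simp at this
  have hRsymm : Rᵀ = R := by
    have : R.IsHermitian := (Matrix.nonneg_iff_posSemidef.1 (CFC.sqrt_nonneg S)).isHermitian
    simpa [Matrix.IsHermitian] using this
  refine ⟨(‖R⁻¹‖ ^ 2 + 1)⁻¹, by positivity, fun x => ?_⟩
  set w : E n := WithLp.toLp 2 (R *ᵥ x.ofLp) with hw
  have h1 : x.ofLp ⬝ᵥ (S *ᵥ x.ofLp) = ‖w‖ ^ 2 := by
    rw [← hRR, ← Matrix.mulVec_mulVec, Matrix.dotProduct_mulVec, ← Matrix.mulVec_transpose, hRsymm,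
      EuclideanSpace.real_norm_sq_eq]
    simp [dotProduct, sq, hw]
  have h2 : ‖x‖ ≤ ‖R⁻¹‖ * ‖w‖ := by
    have := Matrix.l2_opNorm_mulVec R⁻¹ w
    rw [hw] at this
    simpa [Matrix.mulVec_mulVec, Matrix.nonsing_inv_mul _ hRdet.isUnit] using this
  rw [h1, inv_mul_le_iff₀ (by positivity)]
  have h3 := pow_le_pow_left₀ (norm_nonneg x) h2 2
  rw [mul_pow] at h3
  nlinarith [sq_nonneg ‖w‖]

/-- By Cauchy–Schwarz, coercivity of the form gives `γ * ‖x‖ ≤ ‖A x‖`, hence injectivity and the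
bound on the inverse; symmetry plays no role. -/
lemma isUnit_det_and_norm_inv_le {n : ℕ} {A : Matrix (Fin n) (Fin n) ℝ} {γ : ℝ} (hγ : 0 < γ)
    (hA : ∀ x : E n, γ * ‖x‖ ^ 2 ≤ x.ofLp ⬝ᵥ (A *ᵥ x.ofLp)) :
    IsUnit A.det ∧ ‖A⁻¹‖ ≤ γ⁻¹ := by
  have hlow : ∀ x : E n, γ * ‖x‖ ≤ ‖(WithLp.toLp 2 (A *ᵥ x.ofLp) : E n)‖ := fun x => by
    have h1 := (hA x).trans ((le_abs_self _).trans
      (abs_dotProduct_le x (WithLp.toLp 2 (A *ᵥ x.ofLp))))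
    rcases (norm_nonneg x).eq_or_lt with h | h
    · rw [← h]; simp
    · nlinarith
  have hu : IsUnit A.det := by
    rw [← Matrix.isUnit_iff_isUnit_det, ← Matrix.mulVec_injective_iff_isUnit]
    refine (injective_iff_map_eq_zero (Matrix.mulVecLin A)).2 fun x hx => ?_
    have h1 := hlow (WithLp.toLp 2 x)
    rw [Matrix.mulVecLin_apply] at hx
    simp only [hx, WithLp.toLp_zero, norm_zero] at h1
    have h2 : ‖(WithLp.toLp 2 x : E n)‖ = 0 :=
      le_antisymm (by nlinarith) (norm_nonneg _)
    simpa using h2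
  refine ⟨hu, ?_⟩
  rw [Matrix.l2_opNorm_def]
  refine ContinuousLinearMap.opNorm_le_bound _ (by positivity) fun x => ?_
  have h1 := hlow (WithLp.toLp 2 (A⁻¹ *ᵥ x.ofLp))
  simp only [Matrix.mulVec_mulVec, Matrix.mul_nonsing_inv _ hu, Matrix.one_mulVec] at h1
  rw [le_inv_mul_iff₀ hγ]
  exact h1

lemma abs_eval_le_norm {n : ℕ} (x : E n) (i : Fin n) : |x i| ≤ ‖x‖ := PiLp.norm_apply_le x i

lemma abs_fst_le {n m : ℕ} (i : Fin n) (p : E n × E m) : |p.1 i| ≤ 1 + ‖p‖ := by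
  linarith [abs_eval_le_norm p.1 i, norm_fst_le p]

lemma abs_snd_le {n m : ℕ} (j : Fin m) (p : E n × E m) : |p.2 j| ≤ 1 + ‖p‖ := by
  linarith [abs_eval_le_norm p.2 j, norm_snd_le p]

/-- The covariance of the data is bounded below by the covariance of the noise. -/
lemma le_covYY_jointLaw {n m : ℕ} {S : Matrix (Fin m) (Fin m) ℝ} (hS : S.PosDef) {h : E n → E m}
    (hh : Measurable h) {κ : ℝ} (hκ : ∀ v, ‖h v‖ ≤ κ * (1 + ‖v‖)) {μ : Measure (E n)}
    [IsProbabilityMeasure μ] {M : ℝ} (hμ : HasMoment 2 μ M) (x : E m) :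
    x.ofLp ⬝ᵥ (S *ᵥ x.ofLp) ≤ x.ofLp ⬝ᵥ (covYY (jointLaw h S μ) *ᵥ x.ofLp) := by
  have := isProbabilityMeasure_noise hS
  have := isProbabilityMeasure_jointLaw hh hS μ
  have := isGaussian_noise hS
  have hπ := hasMoment_jointLaw hh hκ hS hμ
  have quad : ∀ A : Matrix (Fin m) (Fin m) ℝ,
      x.ofLp ⬝ᵥ (A *ᵥ x.ofLp) = ∑ i, ∑ j, x i * (x j * A i j) := by
    intro A
    simp only [dotProduct, Matrix.mulVec, Finset.mul_sum]
    exact Finset.sum_congr rfl fun i _ => Finset.sum_congr rfl fun j _ => by ring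
  have hvS : Var[fun η : E m => ∑ i, x i * η i; noise S] = x.ofLp ⬝ᵥ (S *ᵥ x.ofLp) := by
    rw [← covariance_self (by fun_prop), covariance_fun_sum_fun_sum, quad]
    · simp_rw [covariance_const_mul_left, covariance_const_mul_right,
        noise_eq_multivariateGaussian hS, covariance_eval_multivariateGaussian hS.posSemidef]
    all_goals
      exact fun i => ((hasMoment_noise hS 2).memLp_two (f := fun η : E m => η i) (by fun_prop)
        (A := 1) fun p => by linarith [abs_eval_le_norm p i]).const_mul _
  have hvY : Var[fun p : E n × E m => ∑ i, x i * p.2 i; jointLaw h S μ] =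
      x.ofLp ⬝ᵥ (covYY (jointLaw h S μ) *ᵥ x.ofLp) := by
    rw [← covariance_self (by fun_prop), covariance_fun_sum_fun_sum, quad]
    · simp_rw [covariance_const_mul_left, covariance_const_mul_right]
      rfl
    all_goals
      exact fun i => (hπ.memLp_two (f := fun p => p.2 i) (by fun_prop)
        (A := 1) fun p => by linarith [abs_snd_le i p]).const_mul _
  have hlin : ∀ y : E m, |∑ i, x i * y i| ≤ ‖x‖ * ‖y‖ := abs_dotProduct_le x
  rw [← hvS, ← hvY, variance_eq_integral (X := fun p : E n × E m => ∑ i, x i * p.2 i) (by fun_prop)]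
  set c := ∫ p, ∑ i, x i * p.2 i ∂jointLaw h S μ with hc
  have hFm : Measurable fun p : E n × E m => (∑ i, x i * p.2 i - c) ^ 2 := by fun_prop
  have hFb : ∀ p : E n × E m, |(∑ i, x i * p.2 i - c) ^ 2| ≤
      (‖x‖ + |c|) ^ 2 * (1 + ‖p‖) ^ 2 := fun p => by
    rw [abs_pow, ← mul_pow]
    refine pow_le_pow_left₀ (abs_nonneg _) ?_ 2
    have h1 := (hlin p.2).trans (mul_le_mul_of_nonneg_left (norm_snd_le p) (norm_nonneg x))
    have h2 := abs_sub (∑ i, x i * p.2 i) c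
    nlinarith [norm_nonneg x, abs_nonneg c, mul_nonneg (abs_nonneg c) (norm_nonneg p)]
  rw [integral_jointLaw hh hκ hS hμ hFm (A := (‖x‖ + |c|) ^ 2) fun p => ?_]
  -- Conditionally on the state `v`, the second moment about the fixed constant `c` is at least the
  -- conditional variance, which is that of the noise for every `v`.
  · have hpt : ∀ v, Var[fun η : E m => ∑ i, x i * η i; noise S] ≤
        ∫ ξ, (∑ i, x i * (h v + ξ) i - c) ^ 2 ∂noise S := fun v => by
      have hm : MemLp (fun η : E m => ∑ i, x i * η i) 2 (noise S) :=
        (hasMoment_noise hS 2).memLp_two (by fun_prop) (A := ‖x‖) fun p => (hlin p).trans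
          (mul_le_mul_of_nonneg_left (by linarith) (norm_nonneg x))
      set d := ∑ i, x i * (h v) i - c with hd
      have e : ∀ ξ : E m, ∑ i, x i * (h v + ξ) i - c = (∑ i, x i * ξ i) + d := fun ξ => by
        simp only [PiLp.add_apply, mul_add, Finset.sum_add_distrib, hd]; ring
      simp_rw [e]
      rw [← variance_add_const hm.aestronglyMeasurable d]
      exact variance_le_expectation_sq (hm.aestronglyMeasurable.add_const d)
    have hi : Integrable (fun v => ∫ ξ, (∑ i, x i * (h v + ξ) i - c) ^ 2 ∂noise S) μ :=
      hμ.integrable_of_le (measurable_integral_noise_graph hh hFm)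
        (abs_integral_noise_graph_le hκ hS (by positivity) hFb)
    simpa using integral_mono (integrable_const _) hi hpt
  · exact hFb p

/-! ### The Kalman gain and its dependence on the joint law. -/

/-- The Kalman gain of a joint law. -/
noncomputable def gain {n m : ℕ} (π : Measure (E n × E m)) : Matrix (Fin n) (Fin m) ℝ :=
  covUY π * (covYY π)⁻¹

/-- The affine map `(u, y) ↦ u + K (z - y)`. -/
noncomputable def gainMap {n m : ℕ} (K : Matrix (Fin n) (Fin m) ℝ) (z : E m) (p : E n × E m) :
    E n :=
  p.1 + WithLp.toLp 2 (K *ᵥ (z - p.2).ofLp)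

lemma kalmanMap_eq_gainMap {n m : ℕ} (π : Measure (E n × E m)) (z : E m) :
    kalmanMap π z = gainMap (gain π) z := rfl

lemma continuous_toLp_mulVec {n m : ℕ} (K : Matrix (Fin n) (Fin m) ℝ) :
    Continuous fun y : E m => (WithLp.toLp 2 (K *ᵥ y.ofLp) : E n) :=
  (PiLp.continuous_toLp 2 _).comp
    (Continuous.matrix_mulVec continuous_const (PiLp.continuous_ofLp 2 _))

@[fun_prop]
lemma continuous_gainMap {n m : ℕ} (K : Matrix (Fin n) (Fin m) ℝ) (z : E m) :
    Continuous (gainMap K z) :=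
  continuous_fst.add ((continuous_toLp_mulVec K).comp (by fun_prop))

@[fun_prop]
lemma measurable_gainMap {n m : ℕ} (K : Matrix (Fin n) (Fin m) ℝ) (z : E m) :
    Measurable (gainMap K z) := (continuous_gainMap K z).measurable

lemma norm_toLp_mulVec_le {n m : ℕ} (K : Matrix (Fin n) (Fin m) ℝ) (y : E m) :
    ‖(WithLp.toLp 2 (K *ᵥ y.ofLp) : E n)‖ ≤ ‖K‖ * ‖y‖ := Matrix.l2_opNorm_mulVec K y

lemma one_add_norm_gainMap_le {n m : ℕ} {K : Matrix (Fin n) (Fin m) ℝ} {z : E m} {k r : ℝ}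
    (hK : ‖K‖ ≤ k) (hz : ‖z‖ ≤ r) (p : E n × E m) :
    1 + ‖gainMap K z p‖ ≤ ((1 + k) * (1 + r)) * (1 + ‖p‖) := by
  have h1 := norm_toLp_mulVec_le K (z - p.2)
  have h2 := norm_add_le p.1 (WithLp.toLp 2 (K *ᵥ (z - p.2).ofLp))
  have h3 := norm_sub_le z p.2
  have h4 := norm_fst_le p
  have h5 := norm_snd_le p
  have h6 := norm_nonneg p
  have hk0 : 0 ≤ k := (norm_nonneg _).trans hK
  have hr0 : 0 ≤ r := (norm_nonneg _).trans hz
  have h7 : ‖K‖ * ‖z - p.2‖ ≤ k * (r + ‖p‖) :=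
    mul_le_mul hK (by linarith) (norm_nonneg _) hk0
  have h8 : ‖gainMap K z p‖ ≤ ‖p‖ + k * (r + ‖p‖) := by
    rw [gainMap]
    linarith
  nlinarith [mul_nonneg hr0 h6, mul_nonneg hk0 (mul_nonneg hr0 h6)]

lemma HasMoment.norm_gain_le {n m : ℕ} {π : Measure (E n × E m)} [IsProbabilityMeasure π] {M γ : ℝ}
    (h : HasMoment 2 π M) (hγ : 0 < γ)
    (hY : ∀ x : E m, γ * ‖x‖ ^ 2 ≤ x.ofLp ⬝ᵥ (covYY π *ᵥ x.ofLp)) :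
    ‖gain π‖ ≤ entryConst n m * (M + M * M) * γ⁻¹ := by
  have hA : ‖covUY π‖ ≤ entryConst n m * (M + M * M) := l2_opNorm_le_of_entries fun i j =>
    h.abs_covariance_le (by fun_prop) (by fun_prop) (abs_fst_le i) (abs_snd_le j)
  exact (Matrix.l2_opNorm_mul _ _).trans (mul_le_mul hA (isUnit_det_and_norm_inv_le hγ hY).2
    (norm_nonneg _) ((norm_nonneg _).trans hA))

/-- The Kalman gain depends Lipschitz continuously on the joint law. -/
lemma DistLE.norm_gain_sub_le {n m : ℕ} {π π₀ : Measure (E n × E m)} [IsProbabilityMeasure π]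
    [IsProbabilityMeasure π₀] {M γ δ : ℝ} (h : HasMoment 2 π M) (h₀ : HasMoment 2 π₀ M)
    (hγ : 0 < γ) (hY : ∀ x : E m, γ * ‖x‖ ^ 2 ≤ x.ofLp ⬝ᵥ (covYY π *ᵥ x.ofLp))
    (hY₀ : ∀ x : E m, γ * ‖x‖ ^ 2 ≤ x.ofLp ⬝ᵥ (covYY π₀ *ᵥ x.ofLp)) (hd : DistLE π π₀ δ) :
    ‖gain π - gain π₀‖ ≤ (entryConst n m * (1 + 2 * M) * γ⁻¹ +
      entryConst n m * (M + M * M) * (γ⁻¹ * (entryConst m m * (1 + 2 * M)) * γ⁻¹)) * δ := by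
  obtain ⟨hu, hi⟩ := isUnit_det_and_norm_inv_le hγ hY
  obtain ⟨hu₀, hi₀⟩ := isUnit_det_and_norm_inv_le hγ hY₀
  have hA₀ : ‖covUY π₀‖ ≤ entryConst n m * (M + M * M) := l2_opNorm_le_of_entries fun i j =>
    h₀.abs_covariance_le (by fun_prop) (by fun_prop) (abs_fst_le i) (abs_snd_le j)
  have hA : ‖covUY π - covUY π₀‖ ≤ entryConst n m * ((1 + 2 * M) * δ) :=
    l2_opNorm_le_of_entries fun i j =>
      hd.abs_covariance_sub_le h h₀ (by fun_prop) (by fun_prop) (abs_fst_le i) (abs_snd_le j)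
  have hC : ‖covYY π₀ - covYY π‖ ≤ entryConst m m * ((1 + 2 * M) * δ) :=
    l2_opNorm_le_of_entries fun i j =>
      hd.symm.abs_covariance_sub_le h₀ h (by fun_prop) (by fun_prop) (abs_snd_le i) (abs_snd_le j)
  -- The resolvent identity for the difference of the inverses, combined with the product rule.
  have e : gain π - gain π₀ = (covUY π - covUY π₀) * (covYY π)⁻¹ +
      covUY π₀ * ((covYY π)⁻¹ * (covYY π₀ - covYY π) * (covYY π₀)⁻¹) := by
    have : (covYY π)⁻¹ * (covYY π₀ - covYY π) * (covYY π₀)⁻¹ = (covYY π)⁻¹ - (covYY π₀)⁻¹ := by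
      rw [mul_sub, Matrix.nonsing_inv_mul _ hu, sub_mul, mul_assoc, Matrix.mul_nonsing_inv _ hu₀,
        mul_one, one_mul]
    rw [this, gain, gain, Matrix.sub_mul, Matrix.mul_sub]
    abel
  rw [e]
  have h1 : ‖(covUY π - covUY π₀) * (covYY π)⁻¹‖ ≤ entryConst n m * ((1 + 2 * M) * δ) * γ⁻¹ :=
    (Matrix.l2_opNorm_mul _ _).trans (mul_le_mul hA hi (norm_nonneg _) ((norm_nonneg _).trans hA))
  have h2 : ‖(covYY π)⁻¹ * (covYY π₀ - covYY π) * (covYY π₀)⁻¹‖ ≤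
      γ⁻¹ * (entryConst m m * ((1 + 2 * M) * δ)) * γ⁻¹ := by
    refine (Matrix.l2_opNorm_mul _ _).trans (mul_le_mul ((Matrix.l2_opNorm_mul _ _).trans
      (mul_le_mul hi hC (norm_nonneg _) (by positivity))) hi₀ (norm_nonneg _) ?_)
    exact mul_nonneg (by positivity) ((norm_nonneg _).trans hC)
  have h3 := (Matrix.l2_opNorm_mul (covUY π₀)
    ((covYY π)⁻¹ * (covYY π₀ - covYY π) * (covYY π₀)⁻¹)).trans
    (mul_le_mul hA₀ h2 (norm_nonneg _) ((norm_nonneg _).trans hA₀))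
  refine (norm_add_le _ _).trans ((add_le_add h1 h3).trans (le_of_eq (by ring)))

/-! ### Stability under a change of gain. -/

/-- Shearing the state by a function of the data preserves Lebesgue measure. -/
lemma measurePreserving_shear {n m : ℕ} {t : E m → E n} (ht : Measurable t) :
    MeasurePreserving (fun p : E n × E m => (p.1 + t p.2, p.2)) volume volume := by
  have hθ : Measurable (fun p : E n × E m => (p.1 + t p.2, p.2)) := by fun_prop
  refine ⟨hθ, Measure.ext_of_lintegral _ fun F hF => ?_⟩
  rw [lintegral_map hF hθ, Measure.volume_eq_prod, lintegral_prod_symm' _ (by fun_prop),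
    lintegral_prod_symm' _ hF]
  exact lintegral_congr fun y => lintegral_add_right_eq_self (fun u => F (u, y)) (t y)

/-- The joint density of state and data when the predicted state is centred at `a`. -/
noncomputable def pairDensity {n m : ℕ} (S : Matrix (Fin n) (Fin n) ℝ) (R : Matrix (Fin m) (Fin m) ℝ)
    (h : E n → E m) (a : E n) (p : E n × E m) : ℝ :=
  realDensity S (p.1 - a) * realDensity R (p.2 - h p.1)

/-- Fixing the centre of the prediction makes the joint density a product of two Gaussian factors,
to which the relative bound on shears applies. General laws are recovered as mixtures. -/
lemma jointLaw_predictLaw_dirac {n m : ℕ} (S : Matrix (Fin n) (Fin n) ℝ)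
    (R : Matrix (Fin m) (Fin m) ℝ) {h : E n → E m} (hh : Measurable h) (a : E n) :
    jointLaw h R (predictLaw (fun v => v) S (Measure.dirac a)) =
      volume.withDensity fun p => ENNReal.ofReal (pairDensity S R h a p) := by
  rw [← withDensity_predict measurable_id', ← withDensity_lift hh]
  · congr 1
    ext p
    rw [lift, predict, lintegral_dirac, pairDensity, gaussianDensity_eq, gaussianDensity_eq,
      ENNReal.ofReal_mul (realDensity_nonneg _ _), mul_comm]
  · exact measurable_predict measurable_id' _ _

lemma pairDensity_nonneg {n m : ℕ} (S : Matrix (Fin n) (Fin n) ℝ) (R : Matrix (Fin m) (Fin m) ℝ)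
    (h : E n → E m) (a : E n) (p : E n × E m) : 0 ≤ pairDensity S R h a p :=
  mul_nonneg (realDensity_nonneg _ _) (realDensity_nonneg _ _)

lemma measurable_pairDensity {n m : ℕ} (S : Matrix (Fin n) (Fin n) ℝ)
    (R : Matrix (Fin m) (Fin m) ℝ) {h : E n → E m} (hh : Measurable h) (a : E n) :
    Measurable (pairDensity S R h a) := by unfold pairDensity; fun_prop

lemma integral_withDensity_ofReal {X : Type*} [MeasurableSpace X] (μ : Measure X) {p : X → ℝ}
    (hp : Measurable p) (h0 : ∀ x, 0 ≤ p x) (F : X → ℝ) :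
    ∫ x, F x ∂μ.withDensity (fun x => ENNReal.ofReal (p x)) = ∫ x, F x * p x ∂μ := by
  rw [integral_withDensity_eq_integral_toReal_smul (by fun_prop) (by simp)]
  simp [ENNReal.toReal_ofReal (h0 _), mul_comm]

lemma integrable_withDensity_ofReal {X : Type*} [MeasurableSpace X] (μ : Measure X) {p : X → ℝ}
    (hp : Measurable p) (h0 : ∀ x, 0 ≤ p x) (F : X → ℝ) :
    Integrable F (μ.withDensity fun x => ENNReal.ofReal (p x)) ↔
      Integrable (fun x => F x * p x) μ := by
  rw [integrable_withDensity_iff (by fun_prop) (by simp)]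
  simp [ENNReal.toReal_ofReal (h0 _)]

/-- The shear `(u, y) ↦ (u + t y, y)`. -/
def shear {n m : ℕ} {t : E m → E n} (ht : Measurable t) : E n × E m ≃ᵐ E n × E m where
  toFun p := (p.1 + t p.2, p.2)
  invFun p := (p.1 - t p.2, p.2)
  left_inv p := by simp
  right_inv p := by simp
  measurable_toFun := by
    change Measurable fun p : E n × E m => (p.1 + t p.2, p.2)
    fun_prop
  measurable_invFun := by
    change Measurable fun p : E n × E m => (p.1 - t p.2, p.2)
    fun_prop

lemma integral_comp_shear {n m : ℕ} {t : E m → E n} (ht : Measurable t) (G : E n × E m → ℝ) :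
    ∫ p, G (shear ht p) = ∫ p, G p :=
  (measurePreserving_shear ht).integral_comp (shear ht).measurableEmbedding G

lemma integrable_comp_shear {n m : ℕ} {t : E m → E n} (ht : Measurable t) (G : E n × E m → ℝ) :
    Integrable (fun p => G (shear ht p)) ↔ Integrable G :=
  (measurePreserving_shear ht).integrable_comp_emb (shear ht).measurableEmbedding

/-- Shearing the pair density changes it by a small relative amount. -/
lemma abs_pairDensity_shear_sub_le {n m : ℕ} (S : Matrix (Fin n) (Fin n) ℝ)
    (R : Matrix (Fin m) (Fin m) ℝ) {h : E n → E m} {κ ℓ : ℝ}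
    (hκ : ∀ v, ‖h v‖ ≤ κ * (1 + ‖v‖)) (hℓ0 : 0 ≤ ℓ) (hℓ : ∀ u v, ‖h u - h v‖ ≤ ℓ * ‖u - v‖)
    (a t : E n) (p : E n × E m) {τ c : ℝ} (hτ : ‖t‖ ≤ τ * (1 + ‖p‖)) (hτc : τ ≤ c) (hτ0 : 0 ≤ τ) :
    |pairDensity S R h a (p.1 - t, p.2) - pairDensity S R h a p| ≤
      ((‖S⁻¹‖ * (2 + c) + ‖R⁻¹‖ * ℓ * (2 * (1 + κ) + ℓ * c)) * τ * (1 + ‖a‖)) *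
        (1 + ‖p‖) ^ 2 * (pairDensity S R h a (p.1 - t, p.2) + pairDensity S R h a p) := by
  obtain ⟨u, y⟩ := p
  set W := 1 + ‖(u, y)‖ with hW
  have hu : ‖u‖ ≤ W - 1 := by rw [hW]; linarith [norm_fst_le (u, y)]
  have hy : ‖y‖ ≤ W - 1 := by rw [hW]; linarith [norm_snd_le (u, y)]
  have hW1 : 1 ≤ W := by rw [hW]; linarith [norm_nonneg (u, y)]
  have hκ0 : 0 ≤ κ := by
    have := (norm_nonneg _).trans (hκ 0)
    simpa using this
  have hc0 : 0 ≤ c := hτ0.trans hτc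
  have ha := norm_nonneg a
  unfold pairDensity
  refine (abs_realDensity_mul_sub_le S R _ _ _ _).trans
    (mul_le_mul_of_nonneg_right ?_ (add_nonneg (mul_nonneg (realDensity_nonneg _ _)
      (realDensity_nonneg _ _)) (mul_nonneg (realDensity_nonneg _ _) (realDensity_nonneg _ _))))
  simp only
  have e1 : ‖u - t - a - (u - a)‖ = ‖t‖ := by
    rw [sub_sub_sub_cancel_right, sub_sub_cancel_left, norm_neg]
  have e2 : ‖y - h (u - t) - (y - h u)‖ ≤ ℓ * ‖t‖ := by
    rw [sub_sub_sub_cancel_left]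
    simpa using hℓ u (u - t)
  have htc : ‖t‖ ≤ c * W := hτ.trans (mul_le_mul_of_nonneg_right hτc (by linarith))
  have e3 : ‖u - a‖ ≤ W * (1 + ‖a‖) := by
    have := norm_sub_le u a
    nlinarith
  have e4 : ‖u - t - a‖ ≤ (1 + c) * (W * (1 + ‖a‖)) := by
    have : u - t - a = (u - a) - t := by abel
    rw [this]
    have := norm_sub_le (u - a) t
    nlinarith [mul_nonneg hc0 (mul_nonneg (by linarith : 0 ≤ W) ha)]
  have e5 : ‖y - h u‖ ≤ (1 + κ) * W := by
    have h1 := norm_sub_le y (h u)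
    have h2 := hκ u
    nlinarith
  have e6 : ‖y - h (u - t)‖ ≤ (1 + κ + ℓ * c) * W := by
    have h1 := norm_add_le (y - h u) (h u - h (u - t))
    have h2 := hℓ u (u - t)
    rw [sub_add_sub_cancel] at h1
    rw [sub_sub_cancel] at h2
    nlinarith [mul_le_mul_of_nonneg_left htc hℓ0]
  have hWA : W ≤ W * (1 + ‖a‖) := by nlinarith
  rw [e1]
  calc ‖S⁻¹‖ * ‖t‖ * (‖u - t - a‖ + ‖u - a‖) +
      ‖R⁻¹‖ * ‖y - h (u - t) - (y - h u)‖ * (‖y - h (u - t)‖ + ‖y - h u‖)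
      ≤ ‖S⁻¹‖ * (τ * W) * ((1 + c) * (W * (1 + ‖a‖)) + W * (1 + ‖a‖)) +
        ‖R⁻¹‖ * (ℓ * (τ * W)) * ((1 + κ + ℓ * c) * W + (1 + κ) * W) := by
        gcongr
        exact e2.trans (mul_le_mul_of_nonneg_left hτ hℓ0)
    _ ≤ ‖S⁻¹‖ * (τ * W) * ((1 + c) * (W * (1 + ‖a‖)) + W * (1 + ‖a‖)) +
        ‖R⁻¹‖ * (ℓ * (τ * W)) * ((1 + κ + ℓ * c) * (W * (1 + ‖a‖)) +
          (1 + κ) * (W * (1 + ‖a‖))) := by gcongr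
    _ = _ := by ring

/-- For a fixed prior state, the law of the Kalman update depends Lipschitz continuously on the
gain, in weighted total variation. -/
lemma exists_abs_integral_gainMap_sub_le {n m : ℕ} {S : Matrix (Fin n) (Fin n) ℝ}
    {R : Matrix (Fin m) (Fin m) ℝ} (hS : S.PosDef) (hR : R.PosDef) {κ ℓ k r : ℝ}
    (hκ0 : 0 ≤ κ) (hℓ0 : 0 ≤ ℓ) (hk0 : 0 ≤ k) (hr0 : 0 ≤ r) :
    ∃ C : ℝ, 0 ≤ C ∧ ∀ (h : E n → E m) (K K₀ : Matrix (Fin n) (Fin m) ℝ) (z : E m) (f : E n → ℝ)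
      (a : E n), Measurable h → (∀ v, ‖h v‖ ≤ κ * (1 + ‖v‖)) →
      (∀ u v, ‖h u - h v‖ ≤ ℓ * ‖u - v‖) → ‖K‖ ≤ k → ‖K₀‖ ≤ k → ‖z‖ ≤ r → Measurable f →
      (∀ x, |f x| ≤ (1 + ‖x‖) ^ 2) →
      |∫ p, f (gainMap K z p) ∂jointLaw h R (predictLaw (fun v => v) S (Measure.dirac a)) -
        ∫ p, f (gainMap K₀ z p) ∂jointLaw h R (predictLaw (fun v => v) S (Measure.dirac a))| ≤
      C * ‖K - K₀‖ * (1 + ‖a‖) ^ 5 := by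
  -- An a priori bound on the relative size of the shear, valid since `‖K - K₀‖ ≤ 2 * k`. It keeps
  -- the constants independent of the two gains.
  set c := 2 * k * (1 + r) with hc
  set c₁ := ‖S⁻¹‖ * (2 + c) + ‖R⁻¹‖ * ℓ * (2 * (1 + κ) + ℓ * c) with hc₁
  set c₂ := ((1 + k) * (1 + r)) ^ 2 with hc₂
  set c₃ := (1 + κ) ^ 4 * (noiseMoment R 4 * ((1 + 1) ^ 4 * noiseMoment S 4)) with hc₃
  have hm1 := noiseMoment_nonneg R 4
  have hm2 := noiseMoment_nonneg S 4
  have hc0 : 0 ≤ c := by positivity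
  have hc₁0 : 0 ≤ c₁ := by positivity
  have hc₂0 : 0 ≤ c₂ := by positivity
  have hc₃0 : 0 ≤ c₃ := by positivity
  refine ⟨c₂ * c₁ * (1 + r) * ((1 + c) ^ 4 + 1) * c₃, by positivity,
    fun h K K₀ z f a hh hκ hℓ hK hK₀ hz hf hb => ?_⟩
  set p : E n × E m → ℝ := pairDensity S R h a with hp
  have hpm : Measurable p := measurable_pairDensity S R hh a
  have hp0 : ∀ x, 0 ≤ p x := pairDensity_nonneg S R h a
  have hmom : HasMoment 4 (jointLaw h R (predictLaw (fun v => v) S (Measure.dirac a)))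
      (c₃ * (1 + ‖a‖) ^ 4) := by
    have h0 : HasMoment 4 (Measure.dirac a) ((1 + ‖a‖) ^ 4) :=
      ⟨integrable_dirac (by simp), by rw [integral_dirac]⟩
    have h1 := hasMoment_predictLaw (h := fun v : E n => v) measurable_id' (κ := 1)
      (fun v => by linarith [norm_nonneg v]) hS h0
    have := isProbabilityMeasure_predictLaw (h := fun v : E n => v) measurable_id' hS
      (Measure.dirac a)
    exact (hasMoment_jointLaw hh hκ hR h1).mono (le_of_eq (by rw [hc₃]; ring))
  have hmom2 := hmom.of_le (by norm_num : 2 ≤ 4)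
  set t : E m → E n := fun y => WithLp.toLp 2 ((K - K₀) *ᵥ (z - y).ofLp) with ht
  have htm : Measurable t :=
    ((continuous_toLp_mulVec (K - K₀)).comp (by fun_prop : Continuous fun y : E m => z - y)).measurable
  have hKK : ‖K - K₀‖ ≤ 2 * k := (norm_sub_le _ _).trans (by linarith)
  set τ := ‖K - K₀‖ * (1 + r) with hτ
  have hτ0 : 0 ≤ τ := by positivity
  have hτc : τ ≤ c := mul_le_mul_of_nonneg_right hKK (by positivity)
  have htb : ∀ x : E n × E m, ‖t x.2‖ ≤ τ * (1 + ‖x‖) := fun x => by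
    have h1 := norm_toLp_mulVec_le (K - K₀) (z - x.2)
    have h2 : ‖z - x.2‖ ≤ (1 + r) * (1 + ‖x‖) := by
      have := norm_sub_le z x.2
      have := norm_snd_le x
      nlinarith [norm_nonneg x, mul_nonneg hr0 (norm_nonneg x)]
    exact h1.trans ((mul_le_mul_of_nonneg_left h2 (norm_nonneg _)).trans (le_of_eq (by ring)))
  -- The key identity: replacing `K₀` by `K` is the same as first shearing by `t`, so the change of
  -- gain can be moved onto the density.
  have hgm : ∀ x, gainMap K z x = gainMap K₀ z (shear htm x) := fun x => by
    simp only [gainMap, shear, MeasurableEquiv.coe_mk, Equiv.coe_fn_mk, ht, Matrix.sub_mulVec,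
      WithLp.toLp_sub]
    abel
  rw [jointLaw_predictLaw_dirac S R hh a] at hmom hmom2 ⊢
  rw [integral_withDensity_ofReal _ hpm hp0, integral_withDensity_ofReal _ hpm hp0]
  have hFK : ∀ {K' : Matrix (Fin n) (Fin m) ℝ}, ‖K'‖ ≤ k → ∀ x,
      |f (gainMap K' z x)| ≤ c₂ * (1 + ‖x‖) ^ 2 := fun hK' x => by
    rw [hc₂, ← mul_pow]
    exact (hb _).trans (pow_le_pow_left₀ (by positivity) (one_add_norm_gainMap_le hK' hz x) 2)
  have hiK : ∀ {K' : Matrix (Fin n) (Fin m) ℝ}, ‖K'‖ ≤ k →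
      Integrable fun x => f (gainMap K' z x) * p x := fun hK' => by
    rw [← integrable_withDensity_ofReal _ hpm hp0]
    exact hmom2.integrable_of_le (hf.comp (by fun_prop)) (hFK hK')
  -- The sheared density; no Jacobian appears because shears preserve Lebesgue measure.
  set q : E n × E m → ℝ := fun x => p ((shear htm).symm x) with hq
  have hq_shear : ∀ x, q (shear htm x) = p x := fun x => by simp [hq]
  have hchange : ∫ x, f (gainMap K z x) * p x = ∫ x, f (gainMap K₀ z x) * q x := by
    rw [← integral_comp_shear htm fun x => f (gainMap K₀ z x) * q x]
    exact integral_congr_ae (ae_of_all _ fun x => by simp only [hgm, hq_shear])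
  have hiq : Integrable fun x => f (gainMap K₀ z x) * q x := by
    rw [← integrable_comp_shear htm]
    refine (hiK hK).congr (ae_of_all _ fun x => by simp only [hgm, hq_shear])
  have hW4p : Integrable fun x => (1 + ‖x‖) ^ 4 * p x :=
    (integrable_withDensity_ofReal _ hpm hp0 _).1 hmom.1
  have hW4p' : ∫ x, (1 + ‖x‖) ^ 4 * p x ≤ c₃ * (1 + ‖a‖) ^ 4 := by
    rw [← integral_withDensity_ofReal _ hpm hp0]; exact hmom.2
  have hshear : ∀ x, 1 + ‖shear htm x‖ ≤ (1 + c) * (1 + ‖x‖) := fun x => by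
    have h1 : ‖shear htm x‖ ≤ ‖x‖ + ‖t x.2‖ := by
      have : shear htm x = x + (t x.2, 0) := by
        ext1 <;> simp [shear]
      rw [this]
      exact (norm_add_le _ _).trans (by simp [Prod.norm_mk])
    have h2 := (htb x).trans (mul_le_mul_of_nonneg_right hτc (by positivity))
    linarith
  have hpow : ∀ x, (1 + ‖shear htm x‖) ^ 4 * q (shear htm x) ≤
      (1 + c) ^ 4 * ((1 + ‖x‖) ^ 4 * p x) := fun x => by
    rw [hq_shear, ← mul_assoc, ← mul_pow]
    exact mul_le_mul_of_nonneg_right (pow_le_pow_left₀ (by positivity) (hshear x) 4) (hp0 x)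
  have hqm : Measurable q := hpm.comp (shear htm).symm.measurable
  have hW4q : Integrable fun x => (1 + ‖x‖) ^ 4 * q x := by
    rw [← integrable_comp_shear htm]
    refine (hW4p.const_mul ((1 + c) ^ 4)).mono' ?_ (ae_of_all _ fun x => ?_)
    · exact ((by fun_prop : Measurable fun x : E n × E m => (1 + ‖x‖) ^ 4 * q x).comp
        (shear htm).measurable).aestronglyMeasurable
    · rw [Real.norm_of_nonneg (mul_nonneg (by positivity) (hp0 _))]
      exact hpow x
  have hW4q' : ∫ x, (1 + ‖x‖) ^ 4 * q x ≤ (1 + c) ^ 4 * (c₃ * (1 + ‖a‖) ^ 4) := by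
    rw [← integral_comp_shear htm]
    refine (integral_mono ((integrable_comp_shear htm _).2 hW4q) (hW4p.const_mul _) hpow).trans ?_
    rw [integral_const_mul]
    exact mul_le_mul_of_nonneg_left hW4p' (by positivity)
  rw [hchange, ← integral_sub hiq (hiK hK₀)]
  -- Fourth power: two from the test function and two from the relative bound. That bound also costs
  -- a factor `1 + ‖a‖`, which with the fourth moment gives the fifth power of `1 + ‖a‖`, and later
  -- the fifth moment of the reference measure.
  have hpt : ∀ x, ‖f (gainMap K₀ z x) * q x - f (gainMap K₀ z x) * p x‖ ≤
      (c₂ * (c₁ * τ * (1 + ‖a‖))) * ((1 + ‖x‖) ^ 4 * q x + (1 + ‖x‖) ^ 4 * p x) := fun x => by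
    rw [← mul_sub, norm_mul, Real.norm_eq_abs, Real.norm_eq_abs]
    have h1 : |q x - p x| ≤ c₁ * τ * (1 + ‖a‖) * (1 + ‖x‖) ^ 2 * (q x + p x) :=
      abs_pairDensity_shear_sub_le S R hκ hℓ0 hℓ a (t x.2) x (htb x) hτc hτ0
    clear_value c₁ c₂ p q τ
    exact (mul_le_mul (hFK hK₀ x) h1 (abs_nonneg _) (by positivity)).trans (le_of_eq (by ring))
  refine (norm_integral_le_of_norm_le ((hW4q.add hW4p).const_mul _) (ae_of_all _ hpt)).trans ?_
  simp only [Pi.add_apply]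
  rw [integral_const_mul, integral_add hW4q hW4p]
  clear_value c c₁ c₂ c₃ p q τ
  calc c₂ * (c₁ * τ * (1 + ‖a‖)) * ((∫ x, (1 + ‖x‖) ^ 4 * q x) + ∫ x, (1 + ‖x‖) ^ 4 * p x)
      ≤ c₂ * (c₁ * τ * (1 + ‖a‖)) *
        ((1 + c) ^ 4 * (c₃ * (1 + ‖a‖) ^ 4) + c₃ * (1 + ‖a‖) ^ 4) := by gcongr
    _ = _ := by rw [hτ]; ring

lemma integral_predictLaw {n m k : ℕ} {h : E n → E m} (hh : Measurable h) {κ : ℝ}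
    (hκ : ∀ v, ‖h v‖ ≤ κ * (1 + ‖v‖)) {S : Matrix (Fin m) (Fin m) ℝ} (hS : S.PosDef)
    {μ : Measure (E n)} [SFinite μ] {M : ℝ} (hμ : HasMoment k μ M) {F : E m → ℝ}
    (hF : Measurable F) {A : ℝ} (hA : 0 ≤ A) (hb : ∀ p, |F p| ≤ A * (1 + ‖p‖) ^ k) :
    ∫ p, F p ∂predictLaw h S μ = ∫ v, ∫ ξ, F (h v + ξ) ∂noise S ∂μ := by
  rw [predictLaw, integral_map measurable_snd.aemeasurable hF.aestronglyMeasurable,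
    integral_jointLaw hh hκ hS hμ (F := fun p => F p.2) (by fun_prop) (A := A)]
  exact fun p => (hb p.2).trans (mul_le_mul_of_nonneg_left
    (pow_le_pow_left₀ (by positivity) (by linarith [norm_snd_le p]) k) hA)

/-- The joint law is a mixture of the joint laws with deterministic prediction. -/
lemma integral_jointLaw_predictLaw {n m k : ℕ} {Ψ : E n → E n} {h : E n → E m}
    (hΨ : Measurable Ψ) (hh : Measurable h) {κ : ℝ}
    (hκΨ : ∀ v, ‖Ψ v‖ ≤ κ * (1 + ‖v‖)) (hκ : ∀ v, ‖h v‖ ≤ κ * (1 + ‖v‖))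
    {S : Matrix (Fin n) (Fin n) ℝ} {R : Matrix (Fin m) (Fin m) ℝ} (hS : S.PosDef) (hR : R.PosDef)
    {μ : Measure (E n)} [IsProbabilityMeasure μ] {M : ℝ} (hμ : HasMoment k μ M)
    {F : E n × E m → ℝ} (hF : Measurable F) {A : ℝ} (hA : 0 ≤ A)
    (hb : ∀ p, |F p| ≤ A * (1 + ‖p‖) ^ k) :
    ∫ p, F p ∂jointLaw h R (predictLaw Ψ S μ) =
      ∫ v, ∫ p, F p ∂jointLaw h R (predictLaw (fun u => u) S (Measure.dirac (Ψ v))) ∂μ := by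
  have hκ0 : 0 ≤ κ := by
    have := (norm_nonneg _).trans (hκ 0)
    simpa using this
  have := isProbabilityMeasure_predictLaw hΨ hS μ
  have hφm := measurable_integral_noise_graph hh (S := R) hF
  have hφb := abs_integral_noise_graph_le hκ hR hA hb
  have hid : ∀ v : E n, ‖v‖ ≤ 1 * (1 + ‖v‖) := fun v => by linarith
  have hA' : 0 ≤ A * (1 + κ) ^ k * noiseMoment R k :=
    mul_nonneg (by positivity) (noiseMoment_nonneg R k)
  rw [integral_jointLaw hh hκ hR (hasMoment_predictLaw hΨ hκΨ hS hμ) hF hb,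
    integral_predictLaw hΨ hκΨ hS hμ hφm hA' hφb]
  refine integral_congr_ae (ae_of_all _ fun v => ?_)
  have h0 : HasMoment k (Measure.dirac (Ψ v)) ((1 + ‖Ψ v‖) ^ k) :=
    ⟨integrable_dirac (by simp), by rw [integral_dirac]⟩
  have := isProbabilityMeasure_predictLaw (h := fun v : E n => v) measurable_id' hS
    (Measure.dirac (Ψ v))
  simp only
  rw [integral_jointLaw hh hκ hR (hasMoment_predictLaw measurable_id' hid hS h0) hF hb,
    integral_predictLaw measurable_id' hid hS h0 hφm hA' hφb, integral_dirac]

lemma measurable_integral_jointLaw_dirac {n m : ℕ} {Ψ : E n → E n} {h : E n → E m}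
    (hΨ : Measurable Ψ) (hh : Measurable h)
    {S : Matrix (Fin n) (Fin n) ℝ} {R : Matrix (Fin m) (Fin m) ℝ} {F : E n × E m → ℝ}
    (hF : Measurable F) :
    Measurable fun v =>
      ∫ p, F p ∂jointLaw h R (predictLaw (fun u => u) S (Measure.dirac (Ψ v))) := by
  simp_rw [jointLaw_predictLaw_dirac S R hh,
    integral_withDensity_ofReal _ (measurable_pairDensity S R hh _) (pairDensity_nonneg S R h _) F]
  refine (StronglyMeasurable.integral_prod_right' (ν := (volume : Measure (E n × E m)))
    (f := fun q : E n × (E n × E m) => F q.2 * pairDensity S R h (Ψ q.1) q.2) ?_).measurable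
  refine Measurable.stronglyMeasurable ?_
  unfold pairDensity
  fun_prop

/-- The law of the Kalman update depends Lipschitz continuously on the gain. -/
lemma exists_distLE_map_gainMap {n m : ℕ} {S : Matrix (Fin n) (Fin n) ℝ}
    {R : Matrix (Fin m) (Fin m) ℝ} (hS : S.PosDef) (hR : R.PosDef) {κ ℓ k r M : ℝ}
    (hκ0 : 0 ≤ κ) (hℓ0 : 0 ≤ ℓ) (hk0 : 0 ≤ k) (hr0 : 0 ≤ r) (hM0 : 0 ≤ M) :
    ∃ C : ℝ, 0 ≤ C ∧ ∀ (Ψ : E n → E n) (h : E n → E m) (K K₀ : Matrix (Fin n) (Fin m) ℝ) (z : E m)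
      (μ : Measure (E n)), Measurable Ψ → (∀ v, ‖Ψ v‖ ≤ κ * (1 + ‖v‖)) → Measurable h →
      (∀ v, ‖h v‖ ≤ κ * (1 + ‖v‖)) → (∀ u v, ‖h u - h v‖ ≤ ℓ * ‖u - v‖) → ‖K‖ ≤ k → ‖K₀‖ ≤ k →
      ‖z‖ ≤ r → IsProbabilityMeasure μ → HasMoment 5 μ M →
      DistLE ((jointLaw h R (predictLaw Ψ S μ)).map (gainMap K z))
        ((jointLaw h R (predictLaw Ψ S μ)).map (gainMap K₀ z)) (C * ‖K - K₀‖) := by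
  obtain ⟨C, hC0, hC⟩ := exists_abs_integral_gainMap_sub_le hS hR hκ0 hℓ0 hk0 hr0
  refine ⟨C * (1 + κ) ^ 5 * M, by positivity,
    fun Ψ h K K₀ z μ hΨ hκΨ hh hκ hℓ hK hK₀ hz hμ hM f hf hb => ?_⟩
  have hM2 := hM.of_le (by norm_num : 2 ≤ 5)
  rw [integral_map (by fun_prop) hf.aestronglyMeasurable,
    integral_map (by fun_prop) hf.aestronglyMeasurable]
  have hFK : ∀ {K' : Matrix (Fin n) (Fin m) ℝ}, ‖K'‖ ≤ k → ∀ x,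
      |f (gainMap K' z x)| ≤ ((1 + k) * (1 + r)) ^ 2 * (1 + ‖x‖) ^ 2 := fun hK' x => by
    rw [← mul_pow]
    exact (hb _).trans (pow_le_pow_left₀ (by positivity) (one_add_norm_gainMap_le hK' hz x) 2)
  have hFm : ∀ K' : Matrix (Fin n) (Fin m) ℝ, Measurable fun x => f (gainMap K' z x) :=
    fun K' => hf.comp (by fun_prop)
  have hsplit : ∀ {K' : Matrix (Fin n) (Fin m) ℝ}, ‖K'‖ ≤ k →
      ∫ p, f (gainMap K' z p) ∂jointLaw h R (predictLaw Ψ S μ) = ∫ v, ∫ p, f (gainMap K' z p)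
        ∂jointLaw h R (predictLaw (fun u => u) S (Measure.dirac (Ψ v))) ∂μ := fun hK' =>
    integral_jointLaw_predictLaw hΨ hh hκΨ hκ hS hR hM2 (hFm _) (by positivity) (hFK hK')
  have hi : ∀ {K' : Matrix (Fin n) (Fin m) ℝ}, ‖K'‖ ≤ k →
      Integrable (fun v => ∫ p, f (gainMap K' z p)
        ∂jointLaw h R (predictLaw (fun u => u) S (Measure.dirac (Ψ v)))) μ := fun {K'} hK' => by
    refine hM2.integrable_of_le (measurable_integral_jointLaw_dirac hΨ hh (hFm K'))
      (A := ((1 + k) * (1 + r)) ^ 2 *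
        ((1 + κ) ^ 2 * (noiseMoment R 2 * ((1 + 1) ^ 2 * (noiseMoment S 2 * (1 + κ) ^ 2)))))
      fun v => ?_
    have h1 : 1 + ‖Ψ v‖ ≤ (1 + κ) * (1 + ‖v‖) := by nlinarith [hκΨ v, norm_nonneg v]
    have h0 : HasMoment 2 (Measure.dirac (Ψ v)) ((1 + κ) ^ 2 * (1 + ‖v‖) ^ 2) :=
      ⟨integrable_dirac (by simp), by
        rw [integral_dirac, ← mul_pow]
        exact pow_le_pow_left₀ (by positivity) h1 2⟩
    have := isProbabilityMeasure_predictLaw (h := fun v : E n => v) measurable_id' hS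
      (Measure.dirac (Ψ v))
    have h2 := hasMoment_predictLaw (h := fun v : E n => v) measurable_id' (κ := 1)
      (fun v => by linarith [norm_nonneg v]) hS h0
    have h3 := hasMoment_jointLaw hh hκ hR h2
    exact (h3.abs_integral_le (by positivity) (hFK hK')).trans (le_of_eq (by ring))
  rw [hsplit hK, hsplit hK₀, ← integral_sub (hi hK) (hi hK₀)]
  refine (hM.abs_integral_le (A := C * ‖K - K₀‖ * (1 + κ) ^ 5) (by positivity) fun v => ?_).trans
    (le_of_eq (by ring))
  have h1 : 1 + ‖Ψ v‖ ≤ (1 + κ) * (1 + ‖v‖) := by nlinarith [hκΨ v, norm_nonneg v]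
  refine (hC h K K₀ z f (Ψ v) hh hκ hℓ hK hK₀ hz hf hb).trans ?_
  rw [mul_assoc (C * ‖K - K₀‖), ← mul_pow]
  exact mul_le_mul_of_nonneg_left (pow_le_pow_left₀ (by positivity) h1 5) (by positivity)

/-! ### One step of the mean field ensemble Kalman filter. -/

/-- The standing assumptions on a model `(Ψ, h)` and a reference model `(Ψ₀, h₀)`. -/
structure NearbyModels {n m : ℕ} (κ ℓ ε : ℝ) (Ψ Ψ₀ : E n → E n) (h h₀ : E n → E m) : Prop where
  measurable_Ψ : Measurable Ψ
  measurable_Ψ₀ : Measurable Ψ₀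
  measurable_h : Measurable h
  measurable_h₀ : Measurable h₀
  growth_Ψ : ∀ v, ‖Ψ v‖ ≤ κ * (1 + ‖v‖)
  growth_Ψ₀ : ∀ v, ‖Ψ₀ v‖ ≤ κ * (1 + ‖v‖)
  growth_h : ∀ v, ‖h v‖ ≤ κ * (1 + ‖v‖)
  growth_h₀ : ∀ v, ‖h₀ v‖ ≤ κ * (1 + ‖v‖)
  lipschitz_h₀ : ∀ u v, ‖h₀ u - h₀ v‖ ≤ ℓ * ‖u - v‖
  le_one : ε ≤ 1
  dist_Ψ : ∀ v, ‖Ψ v - Ψ₀ v‖ ≤ ε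
  dist_h : ∀ v, ‖h v - h₀ v‖ ≤ ε

lemma NearbyModels.nonneg {n m : ℕ} {κ ℓ ε : ℝ} {Ψ Ψ₀ : E n → E n} {h h₀ : E n → E m}
    (H : NearbyModels κ ℓ ε Ψ Ψ₀ h h₀) : 0 ≤ ε := (norm_nonneg _).trans (H.dist_Ψ 0)

/-- Stability of the prediction step. -/
lemma exists_distLE_predictLaw {n m : ℕ} {S : Matrix (Fin n) (Fin n) ℝ} (hS : S.PosDef)
    {κ ℓ M D : ℝ} (hM0 : 0 ≤ M) (hD0 : 0 ≤ D) :
    ∃ M' D' : ℝ, 0 ≤ M' ∧ 0 ≤ D' ∧ ∀ (ε : ℝ) (Ψ Ψ₀ : E n → E n) (h h₀ : E n → E m)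
      (μ μ₀ : Measure (E n)), NearbyModels κ ℓ ε Ψ Ψ₀ h h₀ → IsProbabilityMeasure μ →
      IsProbabilityMeasure μ₀ → Integrable (fun v => (1 + ‖v‖) ^ 2) μ → HasMoment 5 μ₀ M →
      DistLE μ μ₀ (D * ε) →
      HasMoment 2 (predictLaw Ψ S μ) M' ∧ HasMoment 5 (predictLaw Ψ₀ S μ₀) M' ∧
        DistLE (predictLaw Ψ S μ) (predictLaw Ψ₀ S μ₀) (D' * ε) := by
  have h2 := noiseMoment_nonneg S 2
  have h3 := noiseMoment_nonneg S 3
  have h5 := noiseMoment_nonneg S 5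
  -- Absolute values, because `κ` has no prescribed sign before the models are introduced.
  set M₁ := |(1 + κ) ^ 2 * (noiseMoment S 2 * (M + D))|
  set M₂ := |(1 + κ) ^ 5 * (noiseMoment S 5 * M)|
  refine ⟨M₁ + M₂, (1 + κ) ^ 2 * noiseMoment S 2 * D +
    ‖S⁻¹‖ * (1 + κ) ^ 2 * (10 * noiseMoment S 3) * M, by positivity, by positivity,
    fun ε Ψ Ψ₀ h h₀ μ μ₀ H hμ hμ₀ hi hM hd => ?_⟩
  have hε := H.nonneg
  -- The second moment of the perturbed measure is inherited from the reference, at a cost at most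
  -- `D` since `ε ≤ 1`. No separate moment recursion for the perturbed filters is needed.
  have hμ2 : HasMoment 2 μ (M + D) :=
    (hd.hasMoment (hM.of_le (by norm_num)) hi).mono (by nlinarith [H.le_one])
  refine ⟨(hasMoment_predictLaw H.measurable_Ψ H.growth_Ψ hS hμ2).mono ?_,
    (hasMoment_predictLaw H.measurable_Ψ₀ H.growth_Ψ₀ hS hM).mono ?_,
    (hd.predictLaw hS H.measurable_Ψ H.measurable_Ψ₀ H.growth_Ψ H.growth_Ψ₀ H.le_one H.dist_Ψ hμ2
      (hM.of_le (by norm_num))).mono (le_of_eq (by ring))⟩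
  · linarith [le_abs_self ((1 + κ) ^ 2 * (noiseMoment S 2 * (M + D))), abs_nonneg ((1 + κ) ^ 5 * (noiseMoment S 5 * M))]
  · linarith [le_abs_self ((1 + κ) ^ 5 * (noiseMoment S 5 * M)), abs_nonneg ((1 + κ) ^ 2 * (noiseMoment S 2 * (M + D)))]

/-- Stability of one step of the mean field ensemble Kalman filter around a reference measure. -/
lemma exists_distLE_kalmanTransport {n m : ℕ} {S : Matrix (Fin n) (Fin n) ℝ}
    {R : Matrix (Fin m) (Fin m) ℝ} (hS : S.PosDef) (hR : R.PosDef) {κ ℓ r M D : ℝ}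
    (hκ0 : 0 ≤ κ) (hℓ0 : 0 ≤ ℓ) (hr0 : 0 ≤ r) (hM0 : 0 ≤ M) (hD0 : 0 ≤ D) :
    ∃ M' D' : ℝ, 0 ≤ M' ∧ 0 ≤ D' ∧ ∀ (ε : ℝ) (Ψ Ψ₀ : E n → E n) (h h₀ : E n → E m)
      (μ μ₀ : Measure (E n)) (z : E m), NearbyModels κ ℓ ε Ψ Ψ₀ h h₀ → IsProbabilityMeasure μ →
      IsProbabilityMeasure μ₀ → Integrable (fun v => (1 + ‖v‖) ^ 2) μ → HasMoment 5 μ₀ M →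
      DistLE μ μ₀ (D * ε) → ‖z‖ ≤ r →
      HasMoment 2 (kalmanTransport z (jointLaw h R (predictLaw Ψ S μ))) M' ∧
      HasMoment 5 (kalmanTransport z (jointLaw h₀ R (predictLaw Ψ₀ S μ₀))) M' ∧
      DistLE (kalmanTransport z (jointLaw h R (predictLaw Ψ S μ)))
        (kalmanTransport z (jointLaw h₀ R (predictLaw Ψ₀ S μ₀))) (D' * ε) := by
  obtain ⟨M₁, D₁, hM₁0, hD₁0, h₁⟩ :=
    exists_distLE_predictLaw (m := m) hS (κ := κ) (ℓ := ℓ) hM0 hD0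
  obtain ⟨γ, hγ, hγR⟩ := exists_posDef_lower_bound hR
  have h2 := noiseMoment_nonneg R 2
  have h3 := noiseMoment_nonneg R 3
  have h5 := noiseMoment_nonneg R 5
  set D₂ := (1 + κ) ^ 2 * noiseMoment R 2 * D₁ +
    ‖R⁻¹‖ * (1 + κ) ^ 2 * (10 * noiseMoment R 3) * M₁ with hD₂
  set M₂ := (1 + κ) ^ 2 * (noiseMoment R 2 * M₁) + (1 + κ) ^ 5 * (noiseMoment R 5 * M₁) with hM₂
  have hD₂0 : 0 ≤ D₂ := by positivity
  have hM₂0 : 0 ≤ M₂ := by positivity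
  set k := entryConst n m * (M₂ + M₂ * M₂) * γ⁻¹ with hk
  have hen := entryConst_nonneg n m
  have hem := entryConst_nonneg m m
  have hk0 : 0 ≤ k := by positivity
  set L := entryConst n m * (1 + 2 * M₂) * γ⁻¹ +
      entryConst n m * (M₂ + M₂ * M₂) * (γ⁻¹ * (entryConst m m * (1 + 2 * M₂)) * γ⁻¹) with hL
  have hL0 : 0 ≤ L := by positivity
  obtain ⟨C, hC0, hC⟩ := exists_distLE_map_gainMap hS hR hκ0 hℓ0 hk0 hr0 hM0
  set b := (1 + k) * (1 + r) with hb
  have hb1 : 0 ≤ b := by positivity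
  refine ⟨b ^ 2 * M₂ + b ^ 5 * M₂, b ^ 2 * D₂ + C * L * D₂, by positivity, by positivity,
    fun ε Ψ Ψ₀ h h₀ μ μ₀ z H hμ hμ₀ hi hM hd hz => ?_⟩
  obtain ⟨hP, hP₀, hdP⟩ := h₁ ε Ψ Ψ₀ h h₀ μ μ₀ H hμ hμ₀ hi hM hd
  have hprob := isProbabilityMeasure_predictLaw H.measurable_Ψ hS μ
  have hprob₀ := isProbabilityMeasure_predictLaw H.measurable_Ψ₀ hS μ₀
  have hprob' := isProbabilityMeasure_jointLaw H.measurable_h hR (predictLaw Ψ S μ)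
  have hprob₀' := isProbabilityMeasure_jointLaw H.measurable_h₀ hR (predictLaw Ψ₀ S μ₀)
  have hπ : HasMoment 2 (jointLaw h R (predictLaw Ψ S μ)) M₂ :=
    (hasMoment_jointLaw H.measurable_h H.growth_h hR hP).mono
      (le_add_of_nonneg_right (by positivity))
  have hπ₀ : HasMoment 5 (jointLaw h₀ R (predictLaw Ψ₀ S μ₀)) M₂ :=
    (hasMoment_jointLaw H.measurable_h₀ H.growth_h₀ hR hP₀).mono
      (le_add_of_nonneg_left (by positivity))
  have hπ₀2 := hπ₀.of_le (by norm_num : 2 ≤ 5)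
  have hdπ : DistLE (jointLaw h R (predictLaw Ψ S μ)) (jointLaw h₀ R (predictLaw Ψ₀ S μ₀))
      (D₂ * ε) :=
    (hdP.jointLaw hR H.measurable_h H.measurable_h₀ H.growth_h H.growth_h₀ H.le_one H.dist_h hP
      (hP₀.of_le (by norm_num))).mono (le_of_eq (by rw [hD₂]; ring))
  have hY := fun x => (hγR x).trans (le_covYY_jointLaw hR H.measurable_h H.growth_h hP x)
  have hY₀ := fun x => (hγR x).trans
    (le_covYY_jointLaw hR H.measurable_h₀ H.growth_h₀ (hP₀.of_le (by norm_num : 2 ≤ 5)) x)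
  have hK : ‖gain (jointLaw h R (predictLaw Ψ S μ))‖ ≤ k := hπ.norm_gain_le hγ hY
  have hK₀ : ‖gain (jointLaw h₀ R (predictLaw Ψ₀ S μ₀))‖ ≤ k := hπ₀2.norm_gain_le hγ hY₀
  have hKK : ‖gain (jointLaw h R (predictLaw Ψ S μ)) -
      gain (jointLaw h₀ R (predictLaw Ψ₀ S μ₀))‖ ≤ L * (D₂ * ε) := hdπ.norm_gain_sub_le hπ hπ₀2 hγ hY hY₀
  clear_value k L D₂ M₂
  rw [kalmanTransport, kalmanTransport, kalmanMap_eq_gainMap, kalmanMap_eq_gainMap]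
  refine ⟨(hπ.map (by fun_prop) hb1 (one_add_norm_gainMap_le hK hz)).mono
      (le_add_of_nonneg_right (by positivity)),
    (hπ₀.map (by fun_prop) hb1 (one_add_norm_gainMap_le hK₀ hz)).mono
      (le_add_of_nonneg_left (by positivity)), ?_⟩
  -- First the joint law is changed with the perturbed gain held fixed, then the gain under the
  -- reference law. The shear estimate thus concerns only `h₀` and `μ₀`, for which the Lipschitz
  -- bound and the fifth moment are available.
  refine ((hdπ.map (measurable_gainMap _ z) (one_add_norm_gainMap_le hK hz)).trans
    (hC Ψ₀ h₀ _ _ z μ₀ H.measurable_Ψ₀ H.growth_Ψ₀ H.measurable_h₀ H.growth_h₀ H.lipschitz_h₀ hK hK₀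
      hz hμ₀ hM)).mono ?_
  have := mul_le_mul_of_nonneg_left hKK hC0
  calc _ ≤ b ^ 2 * (D₂ * ε) + C * (L * (D₂ * ε)) := by gcongr
    _ = _ := by ring

/-! ### Stability of the Bayesian update. -/

/-- The Bayesian update of the law `P` with the datum `z` observed through `h` and noise `R`. -/
noncomputable def posterior {n m : ℕ} (R : Matrix (Fin m) (Fin m) ℝ) (h : E n → E m) (z : E m)
    (P : Measure (E n)) : Measure (E n) :=
  (∫⁻ u, gaussianDensity R (z - h u) ∂P)⁻¹ • P.withDensity fun u => gaussianDensity R (z - h u)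

/-- The joint density at the datum is likelihood times prior density, so conditioning reweights the
predicted measure by the likelihood and normalises. -/
lemma withDensity_condition_lift {n m : ℕ} {h : E n → E m} (hh : Measurable h)
    (R : Matrix (Fin m) (Fin m) ℝ) (z : E m) {ρ : E n → ℝ≥0∞} (hρ : Measurable ρ) :
    volume.withDensity (condition z (lift h R ρ)) = posterior R h z (volume.withDensity ρ) := by
  have hL : Measurable fun u => gaussianDensity R (z - h u) := by fun_prop
  rw [posterior, lintegral_withDensity_eq_lintegral_mul _ hρ hL, ← withDensity_mul _ hρ hL,
    ← withDensity_smul _ (hρ.mul hL)]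
  congr 1
  ext u
  simp only [condition, lift, Pi.smul_apply, Pi.mul_apply, smul_eq_mul]
  rw [ENNReal.div_eq_inv_mul, mul_comm (gaussianDensity R (z - h u))]
  simp_rw [mul_comm (ρ _)]

/-- The evidence of the datum `z`. -/
noncomputable def evidence {n m : ℕ} (R : Matrix (Fin m) (Fin m) ℝ) (h : E n → E m) (z : E m)
    (P : Measure (E n)) : ℝ := ∫ u, realDensity R (z - h u) ∂P

/-- The maximum of the Gaussian density. -/
noncomputable def densityBound {m : ℕ} (R : Matrix (Fin m) (Fin m) ℝ) : ℝ :=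
  (√((2 * Real.pi) ^ m * R.det))⁻¹

lemma densityBound_pos {m : ℕ} {R : Matrix (Fin m) (Fin m) ℝ} (hR : R.PosDef) :
    0 < densityBound R := by
  have := hR.det_pos
  unfold densityBound; positivity

lemma abs_realDensity_le {m : ℕ} {R : Matrix (Fin m) (Fin m) ℝ} (hR : R.PosDef) (x : E m) :
    |realDensity R x| ≤ densityBound R := by
  rw [abs_of_nonneg (realDensity_nonneg R x)]; exact realDensity_le hR x

lemma integrable_realDensity_comp {n m : ℕ} {R : Matrix (Fin m) (Fin m) ℝ} (hR : R.PosDef)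
    {h : E n → E m} (hh : Measurable h) (z : E m) (P : Measure (E n)) [IsFiniteMeasure P] :
    Integrable (fun u => realDensity R (z - h u)) P :=
  Integrable.of_bound (C := densityBound R)
    (by fun_prop : Measurable _).aestronglyMeasurable
    (ae_of_all _ fun u => abs_realDensity_le hR _)

lemma lintegral_gaussianDensity_comp {n m : ℕ} {R : Matrix (Fin m) (Fin m) ℝ} (hR : R.PosDef)
    {h : E n → E m} (hh : Measurable h) (z : E m) (P : Measure (E n)) [IsFiniteMeasure P] :
    ∫⁻ u, gaussianDensity R (z - h u) ∂P = ENNReal.ofReal (evidence R h z P) := by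
  rw [evidence, ofReal_integral_eq_lintegral_ofReal (integrable_realDensity_comp hR hh z P)
    (ae_of_all _ fun u => realDensity_nonneg _ _)]
  rfl

lemma norm_sub_obs_le {n m : ℕ} {h : E n → E m} {κ r : ℝ} (hκ : ∀ v, ‖h v‖ ≤ κ * (1 + ‖v‖))
    {z : E m} (hz : ‖z‖ ≤ r) (u : E n) : ‖z - h u‖ ≤ (r + κ) * (1 + ‖u‖) := by
  have h1 := norm_sub_le z (h u)
  have h2 := hκ u
  have h3 : 0 ≤ r := (norm_nonneg _).trans hz
  nlinarith [mul_nonneg h3 (norm_nonneg u)]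

/-- The evidence is bounded below in terms of the second moment. -/
lemma le_evidence {n m : ℕ} {R : Matrix (Fin m) (Fin m) ℝ} (hR : R.PosDef)
    {h : E n → E m} (hh : Measurable h) {κ r : ℝ} (hκ : ∀ v, ‖h v‖ ≤ κ * (1 + ‖v‖))
    {z : E m} (hz : ‖z‖ ≤ r) {P : Measure (E n)} [IsProbabilityMeasure P] {M : ℝ}
    (hP : HasMoment 2 P M) :
    densityBound R * Real.exp (-(‖R⁻¹‖ * (r + κ) ^ 2 * M)) ≤ evidence R h z P := by
  set β := ‖R⁻¹‖ * (r + κ) ^ 2 with hβ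
  have hβ0 : 0 ≤ β := by positivity
  have hc := (densityBound_pos hR).le
  -- Jensen's inequality by hand: the exponential lies above its tangent at `M`, and that tangent
  -- has integral at least `exp (-(β * M))` because the second moment is at most `M`.
  have hpt : ∀ u, densityBound R * (Real.exp (-(β * M)) * (1 + β * M - β * (1 + ‖u‖) ^ 2)) ≤
      realDensity R (z - h u) := fun u => by
    refine le_trans (mul_le_mul_of_nonneg_left ?_ hc) (le_realDensity R (z - h u))
    have h1 : ‖R⁻¹‖ * ‖z - h u‖ ^ 2 ≤ β * (1 + ‖u‖) ^ 2 := by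
      rw [hβ, mul_assoc, ← mul_pow]
      exact mul_le_mul_of_nonneg_left
        (pow_le_pow_left₀ (norm_nonneg _) (norm_sub_obs_le hκ hz u) 2) (norm_nonneg _)
    refine le_trans ?_ (Real.exp_le_exp.2 (neg_le_neg h1))
    have h2 := Real.add_one_le_exp (β * M - β * (1 + ‖u‖) ^ 2)
    calc Real.exp (-(β * M)) * (1 + β * M - β * (1 + ‖u‖) ^ 2)
        ≤ Real.exp (-(β * M)) * Real.exp (β * M - β * (1 + ‖u‖) ^ 2) :=
          mul_le_mul_of_nonneg_left (by linarith) (Real.exp_pos _).le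
      _ = _ := by rw [← Real.exp_add]; ring_nf
  have hi : Integrable (fun u => 1 + β * M - β * (1 + ‖u‖) ^ 2) P :=
    (integrable_const _).sub (hP.1.const_mul β)
  have h3 := integral_mono ((hi.const_mul (Real.exp (-(β * M)))).const_mul (densityBound R))
    (integrable_realDensity_comp hR hh z P) hpt
  rw [integral_const_mul, integral_const_mul, integral_sub (integrable_const _) (hP.1.const_mul β),
    integral_const_mul, integral_const, probReal_univ, one_smul] at h3
  refine le_trans (mul_le_mul_of_nonneg_left ?_ hc) h3
  have h4 := mul_le_mul_of_nonneg_left hP.2 hβ0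
  exact le_mul_of_one_le_right (Real.exp_pos _).le (by linarith)

lemma integral_posterior {n m : ℕ} {R : Matrix (Fin m) (Fin m) ℝ} (hR : R.PosDef)
    {h : E n → E m} (hh : Measurable h) (z : E m) (P : Measure (E n)) [IsFiniteMeasure P]
    (f : E n → ℝ) :
    ∫ u, f u ∂posterior R h z P = (evidence R h z P)⁻¹ * ∫ u, f u * realDensity R (z - h u) ∂P := by
  have h0 : 0 ≤ evidence R h z P := integral_nonneg fun u => realDensity_nonneg _ _
  rw [posterior, integral_smul_measure, lintegral_gaussianDensity_comp hR hh, ENNReal.toReal_inv,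
    ENNReal.toReal_ofReal h0, smul_eq_mul]
  congr 1
  exact integral_withDensity_ofReal P (p := fun u => realDensity R (z - h u)) (by fun_prop)
    (fun u => realDensity_nonneg _ _) f

lemma integrable_posterior {n m : ℕ} {R : Matrix (Fin m) (Fin m) ℝ} (hR : R.PosDef)
    {h : E n → E m} (hh : Measurable h) (z : E m) {P : Measure (E n)} [IsFiniteMeasure P]
    (h0 : 0 < evidence R h z P) {f : E n → ℝ} (hf : Integrable f P) :
    Integrable f (posterior R h z P) := by
  rw [posterior]
  refine Integrable.smul_measure ?_ ?_
  · refine (integrable_withDensity_ofReal P (p := fun u => realDensity R (z - h u)) (by fun_prop)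
      (fun u => realDensity_nonneg _ _) f).2 ?_
    exact hf.mul_bdd (c := densityBound R)
      (by fun_prop : Measurable _).aestronglyMeasurable
      (ae_of_all _ fun u => abs_realDensity_le hR _)
  · rw [lintegral_gaussianDensity_comp hR hh]
    simpa using h0

lemma isProbabilityMeasure_posterior {n m : ℕ} {R : Matrix (Fin m) (Fin m) ℝ} (hR : R.PosDef)
    {h : E n → E m} (hh : Measurable h) (z : E m) {P : Measure (E n)} [IsFiniteMeasure P]
    (h0 : 0 < evidence R h z P) : IsProbabilityMeasure (posterior R h z P) := by
  refine ⟨?_⟩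
  rw [posterior, Measure.smul_apply, withDensity_apply _ MeasurableSet.univ,
    Measure.restrict_univ, lintegral_gaussianDensity_comp hR hh, smul_eq_mul]
  exact ENNReal.inv_mul_cancel (by simpa using h0) ENNReal.ofReal_ne_top

/-- Quotient rule with both normalisers bounded below by `ζ`; only the reference numerator has to be
bounded. -/
lemma abs_div_sub_div_le {N N₀ Z Z₀ ζ e B : ℝ} (hζ : 0 < ζ) (hZ : ζ ≤ Z) (hZ₀ : ζ ≤ Z₀)
    (hN : |N - N₀| ≤ e) (hZZ : |Z - Z₀| ≤ e) (hB : |N₀| ≤ B) :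
    |Z⁻¹ * N - Z₀⁻¹ * N₀| ≤ (ζ⁻¹ + ζ⁻¹ * B * ζ⁻¹) * e := by
  have hZ0 : 0 < Z := hζ.trans_le hZ
  have hZ₀0 : 0 < Z₀ := hζ.trans_le hZ₀
  have he : 0 ≤ e := (abs_nonneg _).trans hN
  have hB0 : 0 ≤ B := (abs_nonneg _).trans hB
  have h1 : Z⁻¹ * N - Z₀⁻¹ * N₀ = Z⁻¹ * (N - N₀) - Z⁻¹ * N₀ * Z₀⁻¹ * (Z - Z₀) := by
    field_simp; ring
  rw [h1]
  refine (abs_sub _ _).trans ?_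
  rw [abs_mul, abs_mul, abs_mul, abs_mul, abs_of_pos (inv_pos.2 hZ0), abs_of_pos (inv_pos.2 hZ₀0),
    add_mul]
  have hi : Z⁻¹ ≤ ζ⁻¹ := inv_anti₀ hζ hZ
  have hi₀ : Z₀⁻¹ ≤ ζ⁻¹ := inv_anti₀ hζ hZ₀
  gcongr

/-- Stability of the Bayesian update. -/
lemma DistLE.posterior {n m : ℕ} {R : Matrix (Fin m) (Fin m) ℝ} (hR : R.PosDef)
    {h h₀ : E n → E m} (hh : Measurable h) (hh₀ : Measurable h₀) {κ r : ℝ} (hκ0 : 0 ≤ κ)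
    (hκ : ∀ v, ‖h v‖ ≤ κ * (1 + ‖v‖)) (hκ₀ : ∀ v, ‖h₀ v‖ ≤ κ * (1 + ‖v‖))
    {ε : ℝ} (hd : ∀ v, ‖h v - h₀ v‖ ≤ ε)
    {z : E m} (hz : ‖z‖ ≤ r) {P P₀ : Measure (E n)} [IsProbabilityMeasure P]
    [IsProbabilityMeasure P₀] {M δ : ℝ} (hP : HasMoment 2 P M) (hP₀ : HasMoment 3 P₀ M)
    (hdist : DistLE P P₀ δ) {ζ : ℝ}
    (hζ : ζ = densityBound R * Real.exp (-(‖R⁻¹‖ * (r + κ) ^ 2 * M))) :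
    DistLE (posterior R h z P) (posterior R h₀ z P₀)
      ((ζ⁻¹ + ζ⁻¹ * (densityBound R * M) * ζ⁻¹) *
        (densityBound R * δ + ‖R⁻¹‖ * (2 * (r + κ)) * (2 * densityBound R) * M * ε)) := by
  have hc := densityBound_pos hR
  have hζ0 : 0 < ζ := by rw [hζ]; positivity
  have hr0 : 0 ≤ r := (norm_nonneg _).trans hz
  have hε0 : 0 ≤ ε := (norm_nonneg _).trans (hd 0)
  have hP₀2 := hP₀.of_le (by norm_num : 2 ≤ 3)
  have hfLm : ∀ {f : E n → ℝ} {k : E n → E m}, Measurable f → Measurable k →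
      Measurable fun u => f u * realDensity R (z - k u) := fun hf hk => by fun_prop
  have main : ∀ f : E n → ℝ, Measurable f → (∀ x, |f x| ≤ (1 + ‖x‖) ^ 2) →
      |∫ u, f u * realDensity R (z - h u) ∂P - ∫ u, f u * realDensity R (z - h₀ u) ∂P₀| ≤
        densityBound R * δ + ‖R⁻¹‖ * (2 * (r + κ)) * (2 * densityBound R) * M * ε := by
    intro f hf hb
    have hgb : ∀ {k : E n → E m}, ∀ u,
        |f u * realDensity R (z - k u)| ≤ densityBound R * (1 + ‖u‖) ^ 2 := fun u => by
      rw [abs_mul, mul_comm]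
      exact mul_le_mul (abs_realDensity_le hR _) (hb u) (abs_nonneg _) hc.le
    have h1 := hdist.abs_sub_le (hfLm hf hh) hc.le hgb
    have h2 : |∫ u, f u * realDensity R (z - h u) ∂P₀ - ∫ u, f u * realDensity R (z - h₀ u) ∂P₀| ≤
        ‖R⁻¹‖ * (2 * (r + κ)) * (2 * densityBound R) * M * ε := by
      rw [← integral_sub (hP₀2.integrable_of_le (hfLm hf hh) hgb)
        (hP₀2.integrable_of_le (hfLm hf hh₀) hgb)]
      -- The third moment enters here: two powers from the test function, one from the data misfit.
      refine (hP₀.abs_integral_le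
        (A := ‖R⁻¹‖ * (2 * (r + κ)) * (2 * densityBound R) * ε) (by positivity) fun u => ?_).trans
        (le_of_eq (by ring))
      rw [← mul_sub, abs_mul]
      have h3 := abs_realDensity_sub_le R (z - h u) (z - h₀ u)
      rw [sub_sub_sub_cancel_left, norm_sub_rev] at h3
      have h4 := norm_sub_obs_le hκ hz u
      have h5 := norm_sub_obs_le hκ₀ hz u
      have h6 := realDensity_le hR (z - h u)
      have h7 := realDensity_le hR (z - h₀ u)
      have h8 := realDensity_nonneg R (z - h u)
      have h9 := realDensity_nonneg R (z - h₀ u)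
      have h10 : |realDensity R (z - h u) - realDensity R (z - h₀ u)| ≤
          ‖R⁻¹‖ * ε * (2 * (r + κ) * (1 + ‖u‖)) * (2 * densityBound R) := by
        refine h3.trans ?_
        have e1 : ‖z - h u‖ + ‖z - h₀ u‖ ≤ 2 * (r + κ) * (1 + ‖u‖) := by linarith
        have e2 : realDensity R (z - h u) + realDensity R (z - h₀ u) ≤ 2 * densityBound R := by
          unfold densityBound; linarith
        have e3 := hd u
        gcongr
      exact (mul_le_mul (hb u) h10 (abs_nonneg _) (by positivity)).trans (le_of_eq (by ring))
    exact (_root_.abs_sub_le _ _ _).trans (add_le_add h1 h2)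
  intro f hf hb
  rw [integral_posterior hR hh, integral_posterior hR hh₀]
  have hZ := le_evidence hR hh hκ hz hP
  have hZ₀ := le_evidence hR hh₀ hκ₀ hz hP₀2
  rw [← hζ] at hZ hZ₀
  -- The evidences are the case of the constant test function.
  have hone := main (fun _ => 1) measurable_const fun x => by
    rw [abs_one]; exact one_le_pow₀ (by linarith [norm_nonneg x])
  simp only [one_mul] at hone
  refine abs_div_sub_div_le hζ0 hZ hZ₀ (main f hf hb) hone ?_
  refine hP₀2.abs_integral_le hc.le fun u => ?_
  rw [abs_mul, mul_comm]
  exact mul_le_mul (abs_realDensity_le hR _) (hb u) (abs_nonneg _) hc.le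

lemma evidence_pos {n m : ℕ} {R : Matrix (Fin m) (Fin m) ℝ} (hR : R.PosDef)
    {h : E n → E m} (hh : Measurable h) (z : E m) (P : Measure (E n)) [IsProbabilityMeasure P] :
    0 < evidence R h z P := by
  rw [evidence, integral_pos_iff_support_of_nonneg (fun u => realDensity_nonneg _ _)
    (integrable_realDensity_comp hR hh z P)]
  have : (Function.support fun u => realDensity R (z - h u)) = Set.univ :=
    Set.eq_univ_of_forall fun u => (realDensity_pos hR _).ne'
  rw [this]; simp

/-- Stability of one step of the true filter around a reference measure. -/
lemma exists_distLE_posterior {n m : ℕ} {S : Matrix (Fin n) (Fin n) ℝ}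
    {R : Matrix (Fin m) (Fin m) ℝ} (hS : S.PosDef) (hR : R.PosDef) {κ ℓ r M D : ℝ}
    (hκ0 : 0 ≤ κ) (hr0 : 0 ≤ r) (hM0 : 0 ≤ M) (hD0 : 0 ≤ D) :
    ∃ D' : ℝ, 0 ≤ D' ∧ ∀ (ε : ℝ) (Ψ Ψ₀ : E n → E n) (h h₀ : E n → E m)
      (μ μ₀ : Measure (E n)) (z : E m), NearbyModels κ ℓ ε Ψ Ψ₀ h h₀ → IsProbabilityMeasure μ →
      IsProbabilityMeasure μ₀ → Integrable (fun v => (1 + ‖v‖) ^ 2) μ → HasMoment 5 μ₀ M →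
      DistLE μ μ₀ (D * ε) → ‖z‖ ≤ r →
      Integrable (fun v => (1 + ‖v‖) ^ 2) (posterior R h z (predictLaw Ψ S μ)) ∧
      DistLE (posterior R h z (predictLaw Ψ S μ))
        (posterior R h₀ z (predictLaw Ψ₀ S μ₀)) (D' * ε) := by
  obtain ⟨M₁, D₁, hM₁0, hD₁0, h₁⟩ :=
    exists_distLE_predictLaw (m := m) hS (κ := κ) (ℓ := ℓ) hM0 hD0
  have hc := densityBound_pos hR
  obtain ⟨ζ, hζ⟩ : ∃ ζ, ζ = densityBound R * Real.exp (-(‖R⁻¹‖ * (r + κ) ^ 2 * M₁)) := ⟨_, rfl⟩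
  have hζ0 : 0 < ζ := by rw [hζ]; positivity
  refine ⟨(ζ⁻¹ + ζ⁻¹ * (densityBound R * M₁) * ζ⁻¹) *
    (densityBound R * D₁ + ‖R⁻¹‖ * (2 * (r + κ)) * (2 * densityBound R) * M₁), by positivity,
    fun ε Ψ Ψ₀ h h₀ μ μ₀ z H hμ hμ₀ hi hM hd hz => ?_⟩
  obtain ⟨hP, hP₀, hdP⟩ := h₁ ε Ψ Ψ₀ h h₀ μ μ₀ H hμ hμ₀ hi hM hd
  have hprob := isProbabilityMeasure_predictLaw H.measurable_Ψ hS μ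
  have hprob₀ := isProbabilityMeasure_predictLaw H.measurable_Ψ₀ hS μ₀
  exact ⟨integrable_posterior hR H.measurable_h z (evidence_pos hR H.measurable_h z _) hP.1,
    (hdP.posterior hR H.measurable_h H.measurable_h₀ hκ0 H.growth_h H.growth_h₀ H.dist_h hz hP
      (hP₀.of_le (by norm_num)) hζ).mono (le_of_eq (by ring))⟩

/-! ### Affine models: Kalman transport equals conditioning. -/

/-- The pair is an affine image of a product of Gaussians, so `μ` may be degenerate. -/
lemma isGaussian_jointLaw {n m : ℕ} (h : E n →ᵃ[ℝ] E m) {S : Matrix (Fin m) (Fin m) ℝ}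
    (hS : S.PosDef) (μ : Measure (E n)) [IsGaussian μ] : IsGaussian (jointLaw h S μ) := by
  have := isGaussian_noise hS
  set A : E n →L[ℝ] E m := h.linear.toContinuousLinearMap
  set L : E n × E m →L[ℝ] E n × E m :=
    (ContinuousLinearMap.fst ℝ (E n) (E m)).prod
      (A.comp (ContinuousLinearMap.fst ℝ (E n) (E m)) + ContinuousLinearMap.snd ℝ (E n) (E m))
  have e : (fun p : E n × E m => (p.1, h p.1 + p.2)) = (fun q => q + ((0 : E n), h 0)) ∘ L := by
    ext1 p
    have : h p.1 = h.linear p.1 + h 0 := congrFun h.decomp p.1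
    simp only [Function.comp, L, A, ContinuousLinearMap.prod_apply, ContinuousLinearMap.coe_fst',
      add_apply, ContinuousLinearMap.comp_apply,
      LinearMap.coe_toContinuousLinearMap', ContinuousLinearMap.coe_snd', Prod.mk_add_mk, add_zero]
    rw [this]
    congr 1
    abel
  rw [jointLaw, e, ← Measure.map_map (by fun_prop) (by fun_prop)]
  infer_instance

lemma isGaussian_predictLaw {n m : ℕ} (h : E n →ᵃ[ℝ] E m) {S : Matrix (Fin m) (Fin m) ℝ}
    (hS : S.PosDef) (μ : Measure (E n)) [IsGaussian μ] : IsGaussian (predictLaw h S μ) := by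
  have := isGaussian_jointLaw h hS μ
  exact isGaussian_map (ContinuousLinearMap.snd ℝ (E n) (E m))

/-- The continuous linear map given by a matrix. -/
noncomputable def matrixCLM {n m : ℕ} (K : Matrix (Fin n) (Fin m) ℝ) : E m →L[ℝ] E n :=
  (Matrix.toLpLin 2 2 K).toContinuousLinearMap

lemma matrixCLM_apply {n m : ℕ} (K : Matrix (Fin n) (Fin m) ℝ) (y : E m) :
    matrixCLM K y = WithLp.toLp 2 (K *ᵥ y.ofLp) := rfl

/-- The innovation-free part `u - K y` of the state. -/
noncomputable def residual {n m : ℕ} (K : Matrix (Fin n) (Fin m) ℝ) : E n × E m →L[ℝ] E n :=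
  ContinuousLinearMap.fst ℝ (E n) (E m) -
    (matrixCLM K).comp (ContinuousLinearMap.snd ℝ (E n) (E m))

lemma gainMap_eq_residual_add {n m : ℕ} (K : Matrix (Fin n) (Fin m) ℝ) (z : E m)
    (p : E n × E m) : gainMap K z p = residual K p + matrixCLM K z := by
  rw [gainMap, ← matrixCLM_apply, map_sub]
  simp only [residual, sub_apply, ContinuousLinearMap.coe_fst',
    ContinuousLinearMap.comp_apply, ContinuousLinearMap.coe_snd']
  abel

lemma isGaussian_map_gainMap {n m : ℕ} (π : Measure (E n × E m)) [IsGaussian π]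
    (K : Matrix (Fin n) (Fin m) ℝ) (z : E m) : IsGaussian (π.map (gainMap K z)) := by
  have e : gainMap K z = (fun q => q + matrixCLM K z) ∘ residual K :=
    funext fun p => gainMap_eq_residual_add K z p
  rw [e, ← Measure.map_map (by fun_prop) (by fun_prop)]
  infer_instance

/-- For a Gaussian joint law the residual `u - K y` with the Kalman gain `K` is independent of
the data. -/
lemma indepFun_residual {n m : ℕ} (π : Measure (E n × E m)) [IsGaussian π]
    (hY : IsUnit (covYY π).det) : IndepFun (residual (gain π)) Prod.snd π := by
  have hmem : ∀ L : E n × E m →L[ℝ] ℝ, MemLp (fun p => L p) 2 π := fun L =>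
    IsGaussian.memLp_dual π L 2 (by simp)
  have hU : ∀ i, MemLp (fun p : E n × E m => p.1 i) 2 π := fun i =>
    hmem ((EuclideanSpace.proj i).comp (ContinuousLinearMap.fst ℝ (E n) (E m)))
  have hYm : ∀ j, MemLp (fun p : E n × E m => p.2 j) 2 π := fun j =>
    hmem ((EuclideanSpace.proj j).comp (ContinuousLinearMap.snd ℝ (E n) (E m)))
  have hW : ∀ i, MemLp (fun p : E n × E m => residual (gain π) p i) 2 π := fun i =>
    hmem ((EuclideanSpace.proj i).comp (residual (gain π)))
  have hWe : ∀ i, (fun p : E n × E m => residual (gain π) p i) =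
      fun p => p.1 i - ∑ l, gain π i l * p.2 l := fun i => rfl
  have hcov : ∀ i j, cov[fun p => residual (gain π) p i, fun p => p.2 j; π] = 0 := fun i j => by
    rw [hWe, covariance_fun_sub_left (hU i)
      (memLp_finsetSum _ fun l _ => (hYm l).const_mul _) (hYm j),
      covariance_fun_sum_left (fun l => (hYm l).const_mul _) (hYm j)]
    simp_rw [covariance_const_mul_left]
    -- The normal equation defining the gain; it says exactly that the residual is uncorrelated with
    -- the data. Joint Gaussianity then upgrades this to independence.
    have h1 : gain π * covYY π = covUY π := by
      rw [gain, Matrix.mul_assoc, Matrix.nonsing_inv_mul _ hY, Matrix.mul_one]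
    have h2 := congrFun (congrFun h1 i) j
    rw [Matrix.mul_apply] at h2
    simp only [covYY, covUY, Matrix.of_apply] at h2
    rw [← h2]
    simp
  have hlaw : HasGaussianLaw (fun p => (residual (gain π) p, p.2)) π :=
    (IsGaussian.hasGaussianLaw_id (μ := π)).map_fun
      ((residual (gain π)).prod (ContinuousLinearMap.snd ℝ (E n) (E m)))
  refine hlaw.indepFun_of_covariance_inner fun x y => ?_
  have hin : ∀ {k : ℕ} (a b : E k), inner ℝ a b = ∑ i, a i * b i := fun a b => by
    simp [PiLp.inner_apply, mul_comm]
  simp_rw [hin]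
  rw [covariance_fun_sum_fun_sum (fun i => (hW i).const_mul _) (fun j => (hYm j).const_mul _)]
  refine Finset.sum_eq_zero fun i _ => Finset.sum_eq_zero fun j _ => ?_
  rw [covariance_const_mul_left, covariance_const_mul_right, hcov, mul_zero, mul_zero]

/-- On Gaussian joint laws, the Kalman transport is the Bayesian update. -/
lemma kalmanTransport_eq_posterior {n m : ℕ} {R : Matrix (Fin m) (Fin m) ℝ} (hR : R.PosDef)
    {h : E n → E m} (hh : Measurable h) (P : Measure (E n)) [IsProbabilityMeasure P]
    (hG : IsGaussian (jointLaw h R P)) (hY : IsUnit (covYY (jointLaw h R P)).det) (z : E m) :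
    kalmanTransport z (jointLaw h R P) = posterior R h z P := by
  have hev := evidence_pos hR hh z P
  have := isProbabilityMeasure_posterior hR hh z hev
  set π := jointLaw h R P with hπ
  set K := gain π with hK
  set ν := π.map (residual K) with hν
  have : IsProbabilityMeasure ν := Measure.isProbabilityMeasure_map (by fun_prop)
  have : IsProbabilityMeasure (π.map Prod.snd) := Measure.isProbabilityMeasure_map (by fun_prop)
  have : IsProbabilityMeasure (kalmanTransport z π) := by
    rw [kalmanTransport, kalmanMap_eq_gainMap]
    exact Measure.isProbabilityMeasure_map (by fun_prop)
  have hprod : π.map (fun p => (residual K p, p.2)) = ν.prod (π.map Prod.snd) :=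
    (indepFun_iff_map_prod_eq_prod_map_map (by fun_prop) (by fun_prop)).1 (indepFun_residual π hY)
  refine ext_of_forall_lintegral_eq_of_IsFiniteMeasure fun f => ?_
  have hfm : Measurable fun x => (f x : ℝ≥0∞) :=
    (f.continuous.measurable).coe_nnreal_ennreal
  obtain ⟨B, hB0, hfb⟩ : ∃ B : ℝ, 0 ≤ B ∧ ∀ x, ‖(f x : ℝ)‖ ≤ B :=
    ⟨nndist f 0, by positivity, fun x => by
      rw [Real.norm_of_nonneg (by positivity)]
      exact_mod_cast BoundedContinuousFunction.NNReal.upper_bound f x⟩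
  have hfc : Continuous fun x => (f x : ℝ) := NNReal.continuous_coe.comp f.continuous
  -- the disintegrated densities of `f(u) π(du, dy)` in two forms
  set a : E m → ℝ≥0∞ := fun y => ∫⁻ u, f u * gaussianDensity R (y - h u) ∂P with ha
  set ℓ : E m → ℝ≥0∞ := fun y => ∫⁻ u, gaussianDensity R (y - h u) ∂P with hℓ
  set c : E m → ℝ≥0∞ := fun y => ∫⁻ w, f (w + matrixCLM K y) ∂ν with hc
  have hℓm : Measurable ℓ := Measurable.lintegral_prod_right'
    (f := fun q : E m × E n => gaussianDensity R (q.1 - h q.2)) (by fun_prop)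
  have ham : Measurable a := Measurable.lintegral_prod_right'
    (f := fun q : E m × E n => (f q.2 : ℝ≥0∞) * gaussianDensity R (q.1 - h q.2)) (by fun_prop)
  have hcm : Measurable c := Measurable.lintegral_prod_right'
    (f := fun q : E m × E n => (f (q.2 + matrixCLM K q.1) : ℝ≥0∞)) (by fun_prop)
  have hjoint : ∀ (F : E n → ℝ≥0∞) (G : E m → ℝ≥0∞), Measurable F → Measurable G →
      ∫⁻ p, F p.1 * G p.2 ∂π =
        ∫⁻ y, (∫⁻ u, F u * gaussianDensity R (y - h u) ∂P) * G y := by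
    intro F G hF hG
    rw [hπ, lintegral_jointLaw hh R P (F := fun p => F p.1 * G p.2) (by fun_prop)]
    have e1 : ∀ u, ∫⁻ ξ, F u * G (h u + ξ) ∂noise R =
        ∫⁻ y, F u * gaussianDensity R (y - h u) * G y := fun u => by
      rw [lintegral_noise_add R (fun y => F u * G y) (by fun_prop)]
      exact lintegral_congr fun y => by ring
    simp_rw [e1]
    rw [lintegral_lintegral_swap (by fun_prop)]
    exact lintegral_congr fun y => lintegral_mul_const _ (by fun_prop)
  have hsnd : ∀ G : E m → ℝ≥0∞, Measurable G →
      ∫⁻ y, G y ∂π.map Prod.snd = ∫⁻ y, ℓ y * G y := fun G hG => by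
    rw [lintegral_map hG measurable_snd]
    simpa using hjoint (fun _ => 1) G measurable_const hG
  -- The integral of `f(u) 1_s(y)` under `π` is computed twice: from the definition of the joint
  -- law, and from `u = w + K y` with residual `w` independent of `y`.
  have hset : ∀ s : Set (E m), MeasurableSet s → volume s < ∞ →
      ∫⁻ y in s, a y = ∫⁻ y in s, ℓ y * c y := fun s hs _ => by
    have hind : Measurable (s.indicator (1 : E m → ℝ≥0∞)) := measurable_one.indicator hs
    have e1 := hjoint (fun u => f u) _ hfm hind
    have e2 : ∫⁻ p, f p.1 * s.indicator (1 : E m → ℝ≥0∞) p.2 ∂π =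
        ∫⁻ q, f (q.1 + matrixCLM K q.2) * s.indicator (1 : E m → ℝ≥0∞) q.2
          ∂ν.prod (π.map Prod.snd) := by
      rw [← hprod, lintegral_map (by fun_prop) (by fun_prop)]
      refine lintegral_congr fun p => ?_
      simp [residual]
    rw [lintegral_prod_symm' _ (by fun_prop)] at e2
    have e3 : ∀ y, ∫⁻ w, f (w + matrixCLM K y) * s.indicator (1 : E m → ℝ≥0∞) y ∂ν =
        c y * s.indicator (1 : E m → ℝ≥0∞) y := fun y => lintegral_mul_const _ (by fun_prop)
    simp only [e3] at e2
    rw [hsnd _ (by fun_prop), e1] at e2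
    have e4 : ∀ (G : E m → ℝ≥0∞) (y : E m),
        s.indicator G y = G y * s.indicator (1 : E m → ℝ≥0∞) y := fun G y => by
      by_cases hy : y ∈ s <;> simp [hy]
    rw [← lintegral_indicator hs, ← lintegral_indicator hs, lintegral_congr (e4 a),
      lintegral_congr (e4 fun y => ℓ y * c y)]
    simp_rw [mul_assoc]
    exact e2
  have hae : a =ᵐ[volume] fun y => ℓ y * c y :=
    ae_eq_of_forall_setLIntegral_eq_of_sigmaFinite ham (hℓm.mul hcm) hset
  -- So far the identity holds for almost every datum, while the filter conditions on one given `z`.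
  -- Both sides are continuous in `y`, by dominated convergence, so it holds at every point.
  have hdb := (densityBound_pos hR).le
  have hcont_real : ∀ F : E n → ℝ, Measurable F → (∀ u, ‖F u‖ ≤ B + 1) →
      Continuous fun y => ∫ u, F u * realDensity R (y - h u) ∂P := fun F hF hFb => by
    refine continuous_of_dominated (bound := fun _ => (B + 1) * densityBound R)
      (fun y => (by fun_prop : Measurable _).aestronglyMeasurable)
      (fun y => ae_of_all _ fun u => ?_) (integrable_const _) (ae_of_all _ fun u => ?_)
    · rw [norm_mul]
      exact mul_le_mul (hFb u) (abs_realDensity_le hR _) (norm_nonneg _) (by positivity)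
    · exact continuous_const.mul ((continuous_realDensity R).comp (by fun_prop))
  have hconv : ∀ (F : E n → ℝ≥0), Measurable F → (∀ u, ‖(F u : ℝ)‖ ≤ B + 1) → ∀ y,
      ∫⁻ u, F u * gaussianDensity R (y - h u) ∂P =
        ENNReal.ofReal (∫ u, F u * realDensity R (y - h u) ∂P) := fun F hF hFb y => by
    rw [ofReal_integral_eq_lintegral_ofReal]
    · refine lintegral_congr fun u => ?_
      rw [ENNReal.ofReal_mul (by positivity), ENNReal.ofReal_coe_nnreal, gaussianDensity_eq]
    · refine Integrable.of_bound (C := (B + 1) * densityBound R)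
        (by fun_prop : Measurable _).aestronglyMeasurable (ae_of_all _ fun u => ?_)
      rw [norm_mul]
      exact mul_le_mul (hFb u) (abs_realDensity_le hR _) (norm_nonneg _) (by positivity)
    · exact ae_of_all _ fun u => mul_nonneg (by positivity) (realDensity_nonneg _ _)
  have hfb1 : ∀ u, ‖(f u : ℝ)‖ ≤ B + 1 := fun u => (hfb u).trans (by linarith)
  have hac : Continuous a := by
    rw [ha]
    simp_rw [hconv (fun u => f u) f.continuous.measurable hfb1]
    exact ENNReal.continuous_ofReal.comp (hcont_real _ hfc.measurable hfb1)
  have hℓe : ∀ y, ℓ y = ENNReal.ofReal (evidence R h y P) := fun y =>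
    lintegral_gaussianDensity_comp hR hh y P
  have hce : ∀ y, c y = ENNReal.ofReal (∫ w, (f (w + matrixCLM K y) : ℝ) ∂ν) := fun y => by
    rw [ofReal_integral_eq_lintegral_ofReal]
    · simp [hc]
    · exact Integrable.of_bound (C := B)
        (hfc.comp (by fun_prop)).aestronglyMeasurable (ae_of_all _ fun u => hfb _)
    · exact ae_of_all _ fun u => by positivity
  have hcc : Continuous fun y => ∫ w, (f (w + matrixCLM K y) : ℝ) ∂ν :=
    continuous_of_dominated (bound := fun _ => B)
      (fun y => (hfc.comp (by fun_prop)).aestronglyMeasurable)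
      (fun y => ae_of_all _ fun u => hfb _) (integrable_const _)
      (ae_of_all _ fun u => hfc.comp (by fun_prop))
  have hbc : Continuous fun y => ℓ y * c y := by
    have e : (fun y => ℓ y * c y) = fun y =>
        ENNReal.ofReal (evidence R h y P * ∫ w, (f (w + matrixCLM K y) : ℝ) ∂ν) :=
      funext fun y => by
        rw [hℓe, hce, ENNReal.ofReal_mul
          (show 0 ≤ evidence R h y P from integral_nonneg fun u => realDensity_nonneg _ _)]
    rw [e]
    refine ENNReal.continuous_ofReal.comp (Continuous.mul ?_ hcc)
    simpa [evidence] using hcont_real (fun _ => 1) measurable_const (by simpa using hB0)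
  have hz : a z = ℓ z * c z := congrFun ((hac.ae_eq_iff_eq volume hbc).1 hae) z
  -- Given the datum `z`, the Bayesian law is that of `w + K z`, and `w + K z` is also the Kalman
  -- map.
  have hT : ∫⁻ x, f x ∂kalmanTransport z π = c z := by
    rw [kalmanTransport, kalmanMap_eq_gainMap, lintegral_map hfm (by fun_prop)]
    change _ = ∫⁻ w, (f (w + matrixCLM K z) : ℝ≥0∞) ∂π.map (residual K)
    rw [lintegral_map (by fun_prop) (by fun_prop)]
    exact lintegral_congr fun p => by rw [gainMap_eq_residual_add]
  have hgm : Measurable fun u => gaussianDensity R (z - h u) := by fun_prop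
  rw [hT, posterior, lintegral_smul_measure, lintegral_withDensity_eq_lintegral_mul _ hgm hfm]
  have hB : ∫⁻ u, ((fun u => gaussianDensity R (z - h u)) * fun x => (f x : ℝ≥0∞)) u ∂P = a z :=
    lintegral_congr fun u => by simp [mul_comm]
  have hℓ0 : ℓ z ≠ 0 := by rw [hℓe]; simpa using hev
  have hℓt : ℓ z ≠ ∞ := by rw [hℓe]; exact ENNReal.ofReal_ne_top
  rw [hB, hz, smul_eq_mul, ← mul_assoc, ENNReal.inv_mul_cancel hℓ0 hℓt, one_mul]

/-! ### Null sets and the filter recursions. -/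

lemma predict_congr {n : ℕ} {Ψ Ψ' : E n → E n} {μ : Measure (E n)} (h : Ψ =ᵐ[μ] Ψ')
    (S : Matrix (Fin n) (Fin n) ℝ) : predict Ψ S μ = predict Ψ' S μ :=
  funext fun u => lintegral_congr_ae (h.mono fun v hv => by simp only [hv])

/-- For each fixed `y` the map is a translation in the state, so Fubini makes preimages of null sets
null, whatever `K` is. -/
lemma map_gainMap_absolutelyContinuous {n m : ℕ} {π : Measure (E n × E m)} (hπ : π ≪ volume)
    (K : Matrix (Fin n) (Fin m) ℝ) (z : E m) : π.map (gainMap K z) ≪ volume := by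
  have hg := measurable_gainMap K z
  refine (hπ.map hg).trans (Measure.AbsolutelyContinuous.mk fun s hs h0 => ?_)
  rw [Measure.map_apply hg hs, Measure.volume_eq_prod, Measure.prod_apply_symm (hg hs)]
  refine (lintegral_congr fun y => ?_).trans lintegral_zero
  exact (measure_preimage_add_right volume (WithLp.toLp 2 (K *ᵥ (z - y).ofLp)) s).trans h0

/-- Every iterate after the initial one has a Lebesgue density, so a Lebesgue-null change of `Ψ` is
invisible; only time zero requires agreement almost everywhere for `μ₀`. The two claims must be
proved together, since each prediction uses agreement under the current law. -/
lemma trueFilter_congr {n m : ℕ} {Ψ Ψ' : E n → E n} {μ₀ : Measure (E n)}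
    (hv : Ψ =ᵐ[volume] Ψ') (h₀ : Ψ =ᵐ[μ₀] Ψ') (h : E n → E m) (S : Matrix (Fin n) (Fin n) ℝ)
    (R : Matrix (Fin m) (Fin m) ℝ) (y : ℕ → E m) (j : ℕ) :
    trueFilter Ψ h S R y μ₀ j = trueFilter Ψ' h S R y μ₀ j ∧
      Ψ =ᵐ[trueFilter Ψ h S R y μ₀ j] Ψ' := by
  induction j with
  | zero => exact ⟨rfl, h₀⟩
  | succ j ih =>
    refine ⟨?_, (withDensity_absolutelyContinuous _ _).ae_eq hv⟩
    rw [trueFilter, trueFilter, predict_congr ih.2, ih.1]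

lemma meanFieldEnKF_congr {n m : ℕ} {Ψ Ψ' : E n → E n} {μ₀ : Measure (E n)}
    (hv : Ψ =ᵐ[volume] Ψ') (h₀ : Ψ =ᵐ[μ₀] Ψ') (h : E n → E m) (S : Matrix (Fin n) (Fin n) ℝ)
    (R : Matrix (Fin m) (Fin m) ℝ) (y : ℕ → E m) (j : ℕ) :
    meanFieldEnKF Ψ h S R y μ₀ j = meanFieldEnKF Ψ' h S R y μ₀ j ∧
      Ψ =ᵐ[meanFieldEnKF Ψ h S R y μ₀ j] Ψ' := by
  induction j with
  | zero => exact ⟨rfl, h₀⟩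
  | succ j ih =>
    refine ⟨by rw [meanFieldEnKF, meanFieldEnKF, predict_congr ih.2, ih.1], ?_⟩
    rw [meanFieldEnKF, kalmanTransport, kalmanMap_eq_gainMap]
    exact (map_gainMap_absolutelyContinuous
      (withDensity_absolutelyContinuous _ _) _ _).ae_eq hv

lemma trueFilter_succ {n m : ℕ} {Ψ : E n → E n} (hΨ : Measurable Ψ) {h : E n → E m}
    (hh : Measurable h) (S : Matrix (Fin n) (Fin n) ℝ) (R : Matrix (Fin m) (Fin m) ℝ)
    (y : ℕ → E m) (μ₀ : Measure (E n)) (j : ℕ) [SFinite (trueFilter Ψ h S R y μ₀ j)] :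
    trueFilter Ψ h S R y μ₀ (j + 1) =
      posterior R h (y (j + 1)) (predictLaw Ψ S (trueFilter Ψ h S R y μ₀ j)) := by
  rw [trueFilter, withDensity_condition_lift hh R _ (measurable_predict hΨ S _),
    withDensity_predict hΨ]

lemma meanFieldEnKF_succ {n m : ℕ} {Ψ : E n → E n} (hΨ : Measurable Ψ) {h : E n → E m}
    (hh : Measurable h) (S : Matrix (Fin n) (Fin n) ℝ) (R : Matrix (Fin m) (Fin m) ℝ)
    (y : ℕ → E m) (μ₀ : Measure (E n)) (j : ℕ) [SFinite (meanFieldEnKF Ψ h S R y μ₀ j)] :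
    meanFieldEnKF Ψ h S R y μ₀ (j + 1) = kalmanTransport (y (j + 1))
      (jointLaw h R (predictLaw Ψ S (meanFieldEnKF Ψ h S R y μ₀ j))) := by
  rw [meanFieldEnKF, withDensity_lift hh R (measurable_predict hΨ S _), withDensity_predict hΨ]

/-! ### The induction over time and the conclusion. -/

lemma hasMoment_five_of_isGaussian {n q : ℕ} (hq : 5 ≤ q) (μ : Measure (E n)) [IsGaussian μ] :
    HasMoment 5 μ (32 * (2 + polyMoment q μ)) := by
  have hm : Integrable (fun x : E n => ‖x‖ ^ q) μ :=
    (IsGaussian.memLp_id μ q (by simp)).integrable_norm_pow (by omega)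
  have hi : Integrable (fun x : E n => 32 * (2 + ‖x‖ ^ q)) μ :=
    ((integrable_const 2).add hm).const_mul 32
  have hle : ∀ x : E n, (1 + ‖x‖) ^ 5 ≤ 32 * (2 + ‖x‖ ^ q) := fun x => by
    rcases le_total ‖x‖ 1 with hx | hx
    · have : (1 + ‖x‖) ^ 5 ≤ 2 ^ 5 := by gcongr; linarith
      nlinarith [pow_nonneg (norm_nonneg x) q]
    · have h1 : (1 + ‖x‖) ^ 5 ≤ (2 * ‖x‖) ^ 5 := by gcongr; linarith
      have h2 := pow_le_pow_right₀ hx hq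
      rw [mul_pow] at h1
      linarith
  have h5 : Integrable (fun x : E n => (1 + ‖x‖) ^ 5) μ :=
    hi.mono' (by fun_prop) (ae_of_all _ fun x => by
      rw [Real.norm_of_nonneg (by positivity)]; exact hle x)
  refine ⟨h5, (integral_mono h5 hi hle).trans_eq ?_⟩
  rw [integral_const_mul, integral_add (integrable_const 2) hm]
  simp [polyMoment]

/-- On a unit vector the linear part is a difference of two values, bounded by `2 * κ` and `κ`;
homogeneity does the rest. -/
lemma norm_affineMap_sub_le {n m : ℕ} (h : E n →ᵃ[ℝ] E m) {κ : ℝ}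
    (hκ : ∀ v, ‖h v‖ ≤ κ * (1 + ‖v‖)) (u v : E n) : ‖h u - h v‖ ≤ 3 * κ * ‖u - v‖ := by
  have hlin : ∀ t, h.linear t = h t - h 0 := fun t => by
    simpa using h.linearMap_vsub t 0
  have hsub : h u - h v = h.linear (u - v) := (h.linearMap_vsub u v).symm
  rw [hsub]
  rcases eq_or_ne (u - v) 0 with h0 | h0
  · simp [h0]
  have ht := norm_pos_iff.2 h0
  have hs : ‖‖u - v‖⁻¹ • (u - v)‖ = 1 := by
    rw [norm_smul, norm_inv, norm_norm, inv_mul_cancel₀ ht.ne']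
  have h1 : ‖h.linear (‖u - v‖⁻¹ • (u - v))‖ ≤ 3 * κ := by
    rw [hlin]
    have a := hκ (‖u - v‖⁻¹ • (u - v))
    have b := hκ 0
    rw [hs] at a
    rw [norm_zero] at b
    linarith [norm_sub_le (h (‖u - v‖⁻¹ • (u - v))) (h 0)]
  rwa [map_smul, norm_smul, norm_inv, norm_norm, inv_mul_le_iff₀ ht, mul_comm] at h1

lemma ae_norm_le_of_eLpNorm_top_le {n m : ℕ} {f : E n → E m} {μ : Measure (E n)} {ε : ℝ}
    (hε : 0 ≤ ε) (hf : eLpNorm f ∞ μ ≤ ENNReal.ofReal ε) : ∀ᵐ x ∂μ, ‖f x‖ ≤ ε := by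
  rw [eLpNorm_exponent_top] at hf
  filter_upwards [ae_le_eLpNormEssSup (f := f) (μ := μ)] with x hx
  have := hx.trans hf
  rwa [← ofReal_norm, ENNReal.ofReal_le_ofReal_iff hε] at this

/-- A conull set is dense and the set where the bound holds is closed. -/
lemma norm_le_of_eLpNorm_top_le {n m : ℕ} {f : E n → E m} (hc : Continuous f) {ε : ℝ}
    (hε : 0 ≤ ε) (hf : eLpNorm f ∞ volume ≤ ENNReal.ofReal ε) (x : E n) : ‖f x‖ ≤ ε := by
  have hd := Measure.dense_of_ae (ae_norm_le_of_eLpNorm_top_le hε hf)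
  have hcl : IsClosed {x | ‖f x‖ ≤ ε} := isClosed_le (by fun_prop) continuous_const
  have := hd x
  rwa [hcl.closure_eq] at this

lemma DistLE.weightedTV_le {n : ℕ} {μ ν : Measure (E n)} {δ : ℝ} (h : DistLE μ ν δ) :
    weightedTV μ ν ≤ ENNReal.ofReal δ :=
  iSup_le fun f => iSup_le fun hf => iSup_le fun hb => iSup_le fun _ => iSup_le fun _ =>
    ENNReal.ofReal_le_ofReal (h f hf fun v => (hb v).trans (by nlinarith [norm_nonneg v]))

lemma isUnit_det_covYY_jointLaw {n m : ℕ} {R : Matrix (Fin m) (Fin m) ℝ} (hR : R.PosDef)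
    {h : E n → E m} (hh : Measurable h) {κ : ℝ} (hκ : ∀ v, ‖h v‖ ≤ κ * (1 + ‖v‖))
    {μ : Measure (E n)} [IsProbabilityMeasure μ] {M : ℝ} (hμ : HasMoment 2 μ M) :
    IsUnit (covYY (jointLaw h R μ)).det := by
  obtain ⟨γ, hγ, hγR⟩ := exists_posDef_lower_bound hR
  exact (isUnit_det_and_norm_inv_le hγ fun x =>
    (hγR x).trans (le_covYY_jointLaw hR hh hκ hμ x)).1

/-- Both filters stay within `O(ε)` of the Gaussian filter of the affine model. -/
lemma exists_distLE_filters {n m : ℕ} {S : Matrix (Fin n) (Fin n) ℝ}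
    {R : Matrix (Fin m) (Fin m) ℝ} (hS : S.PosDef) (hR : R.PosDef) {κ ℓ r M : ℝ}
    (hκ0 : 0 ≤ κ) (hℓ0 : 0 ≤ ℓ) (hr0 : 0 ≤ r) (hM0 : 0 ≤ M) (j : ℕ) :
    ∃ M' D' : ℝ, 0 ≤ M' ∧ 0 ≤ D' ∧ ∀ (ε : ℝ) (Ψ : E n → E n) (Ψ₀ : E n →ᵃ[ℝ] E n)
      (h : E n → E m) (h₀ : E n →ᵃ[ℝ] E m) (μ₀ : Measure (E n)) (y : ℕ → E m),
      NearbyModels κ ℓ ε Ψ Ψ₀ h h₀ → IsGaussian μ₀ → HasMoment 5 μ₀ M →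
      (∀ i ∈ Finset.Icc 1 j, ‖y i‖ ≤ r) →
      IsGaussian (meanFieldEnKF Ψ₀ h₀ S R y μ₀ j) ∧
      HasMoment 5 (meanFieldEnKF Ψ₀ h₀ S R y μ₀ j) M' ∧
      (IsProbabilityMeasure (meanFieldEnKF Ψ h S R y μ₀ j) ∧
        Integrable (fun v => (1 + ‖v‖) ^ 2) (meanFieldEnKF Ψ h S R y μ₀ j) ∧
        DistLE (meanFieldEnKF Ψ h S R y μ₀ j) (meanFieldEnKF Ψ₀ h₀ S R y μ₀ j) (D' * ε)) ∧
      (IsProbabilityMeasure (trueFilter Ψ h S R y μ₀ j) ∧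
        Integrable (fun v => (1 + ‖v‖) ^ 2) (trueFilter Ψ h S R y μ₀ j) ∧
        DistLE (trueFilter Ψ h S R y μ₀ j) (meanFieldEnKF Ψ₀ h₀ S R y μ₀ j) (D' * ε)) := by
  induction j with
  | zero =>
    -- At time zero all three sequences coincide, so the distance constant is 0.
    refine ⟨M, 0, hM0, le_rfl, fun ε Ψ Ψ₀ h h₀ μ₀ y _ hG hμ₀ _ => ?_⟩
    have hi := (hμ₀.of_le (by norm_num : 2 ≤ 5)).1
    have hd : DistLE μ₀ μ₀ (0 * ε) := DistLE.refl μ₀ (by simp)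
    exact ⟨hG, hμ₀, ⟨inferInstanceAs (IsProbabilityMeasure μ₀), hi, hd⟩,
      inferInstanceAs (IsProbabilityMeasure μ₀), hi, hd⟩
  | succ j ih =>
    obtain ⟨M₁, D₁, hM₁, hD₁, ih⟩ := ih
    obtain ⟨M₂, D₂, hM₂, hD₂, hK⟩ := exists_distLE_kalmanTransport hS hR hκ0 hℓ0 hr0 hM₁ hD₁
    obtain ⟨D₃, hD₃, hP⟩ := exists_distLE_posterior (ℓ := ℓ) hS hR hκ0 hr0 hM₁ hD₁
    refine ⟨M₂, max D₂ D₃, hM₂, le_max_of_le_left hD₂,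
      fun ε Ψ Ψ₀ h h₀ μ₀ y hN hG₀ hμ₀ hy => ?_⟩
    obtain ⟨hG, hM, ⟨hK1, hK2, hK3⟩, hT1, hT2, hT3⟩ := ih ε Ψ Ψ₀ h h₀ μ₀ y hN hG₀ hμ₀
      fun i hi => hy i (Finset.Icc_subset_Icc_right j.le_succ hi)
    have hz : ‖y (j + 1)‖ ≤ r := hy _ (by simp)
    have hε := hN.nonneg
    obtain ⟨k1, k2, k3⟩ := hK ε Ψ Ψ₀ h h₀ _ _ (y (j + 1)) hN hK1 inferInstance hK2 hM hK3 hz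
    obtain ⟨p1, p2⟩ := hP ε Ψ Ψ₀ h h₀ _ _ (y (j + 1)) hN hT1 inferInstance hT2 hM hT3 hz
    rw [meanFieldEnKF_succ hN.measurable_Ψ hN.measurable_h,
      meanFieldEnKF_succ hN.measurable_Ψ₀ hN.measurable_h₀,
      trueFilter_succ hN.measurable_Ψ hN.measurable_h]
    have hG1 := isGaussian_predictLaw Ψ₀ hS (meanFieldEnKF Ψ₀ h₀ S R y μ₀ j)
    have hG2 := isGaussian_jointLaw h₀ hR (predictLaw Ψ₀ S (meanFieldEnKF Ψ₀ h₀ S R y μ₀ j))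
    have hM2 := (hasMoment_predictLaw hN.measurable_Ψ₀ hN.growth_Ψ₀ hS hM).of_le
      (by norm_num : 2 ≤ 5)
    have hpΨ := isProbabilityMeasure_predictLaw hN.measurable_Ψ hS (meanFieldEnKF Ψ h S R y μ₀ j)
    have hpT := isProbabilityMeasure_predictLaw hN.measurable_Ψ hS (trueFilter Ψ h S R y μ₀ j)
    have hpJ := isProbabilityMeasure_jointLaw hN.measurable_h hR
      (predictLaw Ψ S (meanFieldEnKF Ψ h S R y μ₀ j))
    -- The two stability results have different targets: the Kalman update and the posterior of the
    -- reference. Exactness in the Gaussian case identifies them.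
    rw [← kalmanTransport_eq_posterior hR hN.measurable_h₀ _ hG2
      (isUnit_det_covYY_jointLaw hR hN.measurable_h₀ hN.growth_h₀ hM2)] at p2
    refine ⟨?_, k2, ⟨?_, k1.1, k3.mono ?_⟩, ?_, p1, p2.mono ?_⟩
    · rw [kalmanTransport, kalmanMap_eq_gainMap]
      exact isGaussian_map_gainMap _ _ _
    · rw [kalmanTransport, kalmanMap_eq_gainMap]
      exact Measure.isProbabilityMeasure_map (measurable_gainMap _ _).aemeasurable
    · gcongr; exact le_max_left _ _
    · exact isProbabilityMeasure_posterior hR hN.measurable_h _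
        (evidence_pos hR hN.measurable_h _ _)
    · gcongr; exact le_max_right _ _

lemma nearbyModels_of_dist_le {n m : ℕ} {κ₁ κ₂ ε : ℝ} (hκ₁ : 0 ≤ κ₁) (hκ₂ : 0 ≤ κ₂)
    (hε : ε ≤ 1) {Ψ : E n → E n} {h : E n → E m} (hΨ : Measurable Ψ) (hh : Measurable h)
    (Ψ₀ : E n →ᵃ[ℝ] E n) (h₀ : E n →ᵃ[ℝ] E m) (hΨ₀ : ∀ u, ‖Ψ₀ u‖ ≤ κ₁ * (1 + ‖u‖))
    (hh₀ : ∀ u, ‖h₀ u‖ ≤ κ₂ * (1 + ‖u‖)) (hdΨ : ∀ v, ‖Ψ v - Ψ₀ v‖ ≤ ε)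
    (hdh : ∀ v, ‖h v - h₀ v‖ ≤ ε) :
    NearbyModels (κ₁ + κ₂ + 1) (3 * κ₂) ε Ψ Ψ₀ h h₀ := by
  have a : ∀ v : E n, 0 ≤ κ₁ * (1 + ‖v‖) := fun v => by positivity
  have b : ∀ v : E n, 0 ≤ κ₂ * (1 + ‖v‖) := fun v => by positivity
  refine ⟨hΨ, Ψ₀.continuous_of_finiteDimensional.measurable, hh,
    h₀.continuous_of_finiteDimensional.measurable, fun v => ?_, fun v => ?_, fun v => ?_,
    fun v => ?_, norm_affineMap_sub_le h₀ hh₀, hε, hdΨ, hdh⟩ <;>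
  rw [add_mul, add_mul] <;>
  linarith [hΨ₀ v, hh₀ v, a v, b v, norm_nonneg v, hdΨ v, hdh v, norm_le_norm_sub_add (Ψ v) (Ψ₀ v),
    norm_le_norm_sub_add (h v) (h₀ v)]

end MeanFieldEnKF

theorem mainTheorem3 (d_u d_y J : ℕ)
    (Sig : Matrix (Fin d_u) (Fin d_u) ℝ) (Gam : Matrix (Fin d_y) (Fin d_y) ℝ)
    (hSig : Sig.PosDef) (hGam : Gam.PosDef)
    (κ_y κ_Ψ κ_h : ℝ) (hκ_y : 0 < κ_y) (hκ_Ψ : 0 < κ_Ψ) (hκ_h : 0 < κ_h)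
    (ℓ_h : ℝ≥0) (hℓ_h : 0 < ℓ_h) :
    ∃ C : ℝ → ℝ,
      ∀ μ₀ : Measure (E d_u), IsGaussian μ₀ →
      ∀ y : ℕ → E d_y, (∀ j ∈ Finset.Icc 1 J, ‖y j‖ ≤ κ_y) →
      ∀ (Ψ₀ : E d_u →ᵃ[ℝ] E d_u) (h₀ : E d_u →ᵃ[ℝ] E d_y),
      (∀ u, ‖Ψ₀ u‖ ≤ κ_Ψ * (1 + ‖u‖)) → (∀ u, ‖h₀ u‖ ≤ κ_h * (1 + ‖u‖)) →
      ∀ ε ∈ Set.Icc (0 : ℝ) 1,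
      ∀ (Ψ : E d_u → E d_u) (h : E d_u → E d_y), Measurable Ψ → LipschitzWith ℓ_h h →
      -- `L^∞` closeness; the bound with respect to `μ₀` follows from the one with respect to
      -- Lebesgue measure unless the Gaussian `μ₀` is degenerate
      eLpNorm (fun u => Ψ u - Ψ₀ u) ∞ volume ≤ ENNReal.ofReal ε →
      eLpNorm (fun u => Ψ u - Ψ₀ u) ∞ μ₀ ≤ ENNReal.ofReal ε →
      eLpNorm (fun u => h u - h₀ u) ∞ volume ≤ ENNReal.ofReal ε →
      weightedTV (meanFieldEnKF Ψ h Sig Gam y μ₀ J) (trueFilter Ψ h Sig Gam y μ₀ J) ≤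
        ENNReal.ofReal (C (polyMoment (2 * max (3 + d_u) (4 + d_y)) μ₀) * ε) := by
  have hq : 5 ≤ 2 * max (3 + d_u) (4 + d_y) := by omega
  -- A constant is found for each value `M` of the moment; choice then assembles the function `C`.
  have key : ∀ M : ℝ, ∃ c : ℝ, ∀ μ₀ : Measure (E d_u), IsGaussian μ₀ →
      polyMoment (2 * max (3 + d_u) (4 + d_y)) μ₀ = M →
      ∀ y : ℕ → E d_y, (∀ j ∈ Finset.Icc 1 J, ‖y j‖ ≤ κ_y) →
      ∀ (Ψ₀ : E d_u →ᵃ[ℝ] E d_u) (h₀ : E d_u →ᵃ[ℝ] E d_y),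
      (∀ u, ‖Ψ₀ u‖ ≤ κ_Ψ * (1 + ‖u‖)) → (∀ u, ‖h₀ u‖ ≤ κ_h * (1 + ‖u‖)) →
      ∀ ε ∈ Set.Icc (0 : ℝ) 1,
      ∀ (Ψ : E d_u → E d_u) (h : E d_u → E d_y), Measurable Ψ → LipschitzWith ℓ_h h →
      eLpNorm (fun u => Ψ u - Ψ₀ u) ∞ volume ≤ ENNReal.ofReal ε →
      eLpNorm (fun u => Ψ u - Ψ₀ u) ∞ μ₀ ≤ ENNReal.ofReal ε →
      eLpNorm (fun u => h u - h₀ u) ∞ volume ≤ ENNReal.ofReal ε →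
      weightedTV (meanFieldEnKF Ψ h Sig Gam y μ₀ J) (trueFilter Ψ h Sig Gam y μ₀ J) ≤
        ENNReal.ofReal (c * ε) := by
    intro M
    obtain ⟨M', D', -, -, H⟩ := exists_distLE_filters hSig hGam (κ := κ_Ψ + κ_h + 1)
      (ℓ := 3 * κ_h) (r := κ_y) (M := 32 * (2 + |M|)) (by positivity) (by positivity)
      hκ_y.le (by positivity) J
    refine ⟨D' + D', fun μ₀ hμ₀ hM y hy Ψ₀ h₀ hΨ₀ hh₀ ε hε Ψ h hΨ hh hdv hdμ hdh => ?_⟩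
    have hΨ₀m : Measurable Ψ₀ := Ψ₀.continuous_of_finiteDimensional.measurable
    -- The stability estimates require closeness everywhere, so `Ψ` is replaced by `Ψ₀` on the
    -- exceptional set. That set is null for Lebesgue measure and for `μ₀`, hence neither filter
    -- changes.
    set Ψ' : E d_u → E d_u := fun v => if ‖Ψ v - Ψ₀ v‖ ≤ ε then Ψ v else Ψ₀ v with hΨ'
    have hΨ'm : Measurable Ψ' :=
      Measurable.ite (measurableSet_le (by fun_prop) measurable_const) hΨ hΨ₀m
    have hΨ'd : ∀ v, ‖Ψ' v - Ψ₀ v‖ ≤ ε := fun v => by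
      by_cases hv : ‖Ψ v - Ψ₀ v‖ ≤ ε
      · simp [hΨ', hv]
      · simp [hΨ', hv, hε.1]
    have hae : ∀ {μ : Measure (E d_u)}, eLpNorm (fun u => Ψ u - Ψ₀ u) ∞ μ ≤ ENNReal.ofReal ε →
        Ψ =ᵐ[μ] Ψ' := fun hd =>
      (ae_norm_le_of_eLpNorm_top_le hε.1 hd).mono fun v hv => by simp [hΨ', hv]
    have hhd : ∀ v, ‖h v - h₀ v‖ ≤ ε :=
      norm_le_of_eLpNorm_top_le (hh.continuous.sub h₀.continuous_of_finiteDimensional) hε.1 hdh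
    have hμ₀M : HasMoment 5 μ₀ (32 * (2 + |M|)) :=
      (hasMoment_five_of_isGaussian hq μ₀).mono (by rw [hM]; gcongr; exact le_abs_self M)
    obtain ⟨-, -, ⟨-, -, hK⟩, -, -, hT⟩ := H ε Ψ' Ψ₀ h h₀ μ₀ y
      (nearbyModels_of_dist_le hκ_Ψ.le hκ_h.le hε.2 hΨ'm hh.continuous.measurable Ψ₀ h₀ hΨ₀ hh₀
        hΨ'd hhd) hμ₀ hμ₀M hy
    rw [(meanFieldEnKF_congr (hae hdv) (hae hdμ) h Sig Gam y J).1,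
      (trueFilter_congr (hae hdv) (hae hdμ) h Sig Gam y J).1, add_mul]
    -- Triangle inequality through the common Gaussian reference, whence the constant `D' + D'`.
    exact (hK.trans hT.symm).weightedTV_le
  choose C hC using key
  exact ⟨C, fun μ₀ hμ₀ => hC _ μ₀ hμ₀ rfl⟩
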